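/- Let $\mathbb{D}$ be the open unit disk in $\mathbb{C}$, $dA$ the area measure on $\mathbb{D}$ normalized to have total mass $1$, and, for $\alpha>-1$, $\omega_\alpha(z)=(1+\alpha)(1-|z|^2)^\alpha$. For $0<p<\infty$ let $L^p_a(\omega_\alpha)$ be the space of analytic functions $f$ on $\mathbb{D}$ with $$\|f\|_{L^p(\omega_\alpha)}=\Big(\int_{\mathbb{D}}|f|^p\,\omega_\alpha\,dA\Big)^{1/p}<\infty .$$ For a positive Borel measure $\mu$ on $\mathbb{D}$ and $\beta>-1$ let $$T_{\mu,\beta}(f)(z)=\int_{\mathbb{D}}\frac{f(w)}{(1-z\bar w)^{2+\beta}}\,d\mu(w),\qquad z\in\mathbb{D},$$ with the principal branch of the power. The operator $T_{\mu,\beta}:L^p_a(\omega_\alpha)\to L^1_a(\omega_\beta)$ is called compact if, for every $f\in L^p_a(\omega_\alpha)$, these integrals converge absolutely for all $z\in\mathbb{D}$ and $T_{\mu,\beta}(f)\in L^1_a(\omega_\beta)$, and if moreover $\|T_{\mu,\beta}(f_n)\|_{L^1(\omega_\beta)}\to0$ for every bounded sequence $(f_n)$ in $L^p_a(\omega_\alpha)$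 that converges to $0$ uniformly on each compact subset of $\mathbb{D}$. The measure $\mu$ is a vanishing $q$-Carleson measure for $L^1_a(\omega_\alpha)$ if it is finite and $\int_{\mathbb{D}}|f_n|^q\,d\mu\to0$ for every bounded sequence $(f_n)$ in $L^1_a(\omega_\alpha)$ that converges to $0$ uniformly on each compact subset of $\mathbb{D}$. The little logarithmic Bloch space $\mathcal{LB}^1_0$ consists of the analytic functions $f$ on $\mathbb{D}$ with $$\lim_{|z|\to1^-}(1-|z|^2)\Big(\log\frac{2}{1-|z|^2}\Big)|f'(z)|=0 .$$ **Theorem.** Let $\mu$ be a positive Borel measure on $\mathbb{D}$, $0<p\le1$ and $-1<\alpha,\beta<\infty$. Then $T_{\mu,\beta}:L^p_a(\omega_\alpha)\to L^1_a(\omega_\beta)$ is compact if and only if $\mu$ is a vanishing $\frac1p$-Carleson measure for $L^1_a(\omega_\alpha)$ and $T_{\mu,\frac{2+\alpha}{p}-2}(1)\in\mathcal{LB}^1_0$. If $p=1$, the same equivalence holds with compactness understood in the usual sense: $T_{\mu,\beta}$ is well defined from $L^1_a(\omega_\alpha)$ to $L^1_a(\omega_\beta)$ as above, and for every bounded sequence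 $(f_n)$ in $L^1_a(\omega_\alpha)$ some subsequence of $(T_{\mu,\beta}(f_n))$ converges in $L^1_a(\omega_\beta)$. -/

import Mathlib

namespace ToeplitzBergman

open MeasureTheory Filter Topology

/-- The open unit disk. -/
def disk : Set ℂ := Metric.ball 0 1

/-- The standard weight `ω_α(z) = (1 + α) (1 - |z|²)^α`. -/
noncomputable def weight (α : ℝ) (z : ℂ) : ℝ := (1 + α) * (1 - ‖z‖ ^ 2) ^ α

/-- The normalized area measure `dA` of the unit disk (total mass one), as a measure on `ℂ`. -/
noncomputable def diskArea : Measure ℂ :=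
  ENNReal.ofReal Real.pi⁻¹ • volume.restrict disk

/-- The measure `ω_α dA`. -/
noncomputable def weightedArea (α : ℝ) : Measure ℂ :=
  diskArea.withDensity fun z => ENNReal.ofReal (weight α z)

/-- The `L^p(ω_α)` (quasi-)norm `(∫ |f|^p ω_α dA)^(1/p)`, with values in `[0, ∞]`,
for `0 < p < ∞`. -/
noncomputable def bergmanNorm (p α : ℝ) (f : ℂ → ℂ) : ENNReal :=
  eLpNorm f (ENNReal.ofReal p) (weightedArea α)

/-- `f` belongs to the weighted Bergman space `L^p_a(ω_α)`: it is analytic in the disk with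
finite norm. Values of `f` outside the disk are irrelevant. -/
def MemBergman (p α : ℝ) (f : ℂ → ℂ) : Prop :=
  DifferentiableOn ℂ f disk ∧ bergmanNorm p α f < ⊤

/-- `(f_n)` is a bounded sequence in `L^p_a(ω_α)`. -/
def IsBoundedSeq (p α : ℝ) (f : ℕ → ℂ → ℂ) : Prop :=
  (∀ n, MemBergman p α (f n)) ∧ ∃ C : NNReal, ∀ n, bergmanNorm p α (f n) ≤ C

/-- `(f_n)` converges to `0` uniformly on each compact subset of the disk. -/
def LocallyUniformlyNull (f : ℕ → ℂ → ℂ) : Prop :=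
  ∀ K : Set ℂ, K ⊆ disk → IsCompact K → TendstoUniformlyOn f (fun _ => 0) atTop K

/-- The integrand `f(w) / (1 - z w̄)^(2+β)` of the Toeplitz operator; the power is the principal
one (for `z`, `w` in the disk, `1 - z w̄` has positive real part). -/
noncomputable def toeplitzIntegrand (β : ℝ) (f : ℂ → ℂ) (z w : ℂ) : ℂ :=
  f w / (1 - z * (starRingEnd ℂ) w) ^ ((2 + β : ℝ) : ℂ)

/-- The Toeplitz operator `T_{μ,β}(f)(z) = ∫ f(w) / (1 - z w̄)^(2+β) dμ(w)`. -/
noncomputable def toeplitz (μ : Measure ℂ) (β : ℝ) (f : ℂ → ℂ) (z : ℂ) : ℂ :=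
  ∫ w, toeplitzIntegrand β f z w ∂μ

/-- `T_{μ,β}` is a well-defined operator from `L^p_a(ω_α)` to `L^q_a(ω_β)`: the defining
integrals converge absolutely and `T_{μ,β}(f)` lies in `L^q_a(ω_β)`. -/
def ToeplitzMaps (μ : Measure ℂ) (p α q β : ℝ) : Prop :=
  ∀ f : ℂ → ℂ, MemBergman p α f →
    (∀ z ∈ disk, Integrable (toeplitzIntegrand β f z) μ) ∧ MemBergman q β (toeplitz μ β f)

/-- Compactness of `T_{μ,β} : L^p_a(ω_α) → L^q_a(ω_β)` in terms of bounded sequences that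
converge to `0` locally uniformly. -/
def ToeplitzCompact (μ : Measure ℂ) (p α q β : ℝ) : Prop :=
  ToeplitzMaps μ p α q β ∧
    ∀ f : ℕ → ℂ → ℂ, IsBoundedSeq p α f → LocallyUniformlyNull f →
      Tendsto (fun n => bergmanNorm q β (toeplitz μ β (f n))) atTop (𝓝 0)

/-- Compactness of `T_{μ,β} : L^p_a(ω_α) → L^q_a(ω_β)` in the usual sense of normed spaces: the
image of every bounded sequence has a subsequence that converges in `L^q_a(ω_β)`. -/
def ToeplitzCompactUsual (μ : Measure ℂ) (p α q β : ℝ) : Prop :=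
  ToeplitzMaps μ p α q β ∧
    ∀ f : ℕ → ℂ → ℂ, IsBoundedSeq p α f →
      ∃ φ : ℕ → ℕ, StrictMono φ ∧ ∃ g : ℂ → ℂ, MemBergman q β g ∧
        Tendsto (fun n => bergmanNorm q β (fun z => toeplitz μ β (f (φ n)) z - g z))
          atTop (𝓝 0)

/-- The finite measure `μ` is a vanishing `q`-Carleson measure for `L^p_a(ω_α)`. -/
def IsVanishingCarleson (μ : Measure ℂ) (q p α : ℝ) : Prop :=
  IsFiniteMeasure μ ∧
    ∀ f : ℕ → ℂ → ℂ, IsBoundedSeq p α f → LocallyUniformlyNull f →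
      Tendsto (fun n => ∫⁻ z, ‖f n z‖ₑ ^ q ∂μ) atTop (𝓝 0)

/-- The little logarithmic Bloch space `LB^γ_0`: analytic functions `f` in the disk with
`(1 - |z|²)^γ log(2 / (1 - |z|²)) |f'(z)| → 0` as `|z| → 1⁻`. -/
def MemLittleLogBloch (γ : ℝ) (f : ℂ → ℂ) : Prop :=
  DifferentiableOn ℂ f disk ∧
    Tendsto (fun z : ℂ => (1 - ‖z‖ ^ 2) ^ γ * Real.log (2 / (1 - ‖z‖ ^ 2)) * ‖deriv f z‖)
      (comap (fun z : ℂ => ‖z‖) (𝓝[<] 1)) (𝓝 0)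

end ToeplitzBergman

/-! ### Inequalities for `1 - z w̄` and comparison of the weights -/

namespace ToeplitzBergman
open MeasureTheory Filter Topology ComplexConjugate

/-! Put `s = (2 + α)/p`, so `s > 1`. Everything is reduced to the action of the operator on the
kernels `w ↦ (1 - w ā)^(-(s+1))`, and that action is computed up to a negligible error.

Reduction to kernels. Since `p ≤ 1`, a function in `L^p_a(ω_α)` lies in `L^1_a(ω_(s-2))`
(`exists_bergmanNorm_one_le`), so it is reproduced against the weight `ω_(s-1)` by the kernel of
exponent `s + 1` (`integral_mul_kernel`). Fubini then writes `T f(u)` as the integral of `f(z)`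
times the image of the kernel at `z`, and the triangle inequality in `L^1(ω_β)` gives `‖T f‖ ≤ ∫
|f(z)| N(z) ω_(s-1) dA`, where `N(z)` is the norm of that image (`bergmanNorm_toeplitz_le`). If `(1
- |z|) N(z)` is bounded and tends to `0` at the circle, the operator is compact, because the factor
`1 - |z|` restores the weight `ω_(s-2)`. Conversely `(1 - |a|) N(a)` is the norm of the image of the
normalized kernel, and normalized kernels are bounded in `L^p_a(ω_α)` and locally uniformly null as
`|a| → 1`.

Size of `N(a)`. Replace `(1 - u w̄)^(-(2+β))` by its value at `w = a`. The image becomes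
`kernelMean(a) (1 - u ā)^(-(2+β))`, and the error is handled by Hölder continuity of the kernel in
`L^1(ω_β)` together with the Carleson condition `μ(box at z) = o((1 - |z|)^s)`: it is `o(1/(1 -
|a|))` (`tendsto_kernelImageError`). The exponent `2 + β` is critical for `ω_β`, so by Forelli–Rudin
the `L^1(ω_β)` norm of the frozen kernel is comparable to `log(2/(1 - |a|²))` near the circle. Hence
`(1 - |a|) N(a) → 0` exactly when `(1 - |a|) log(2/(1 - |a|²)) |kernelMean(a)| → 0`
(`tendsto_kernelImageNorm_iff`). With `G = T_(μ,s-2)(1)`, the conjugate of `kernelMean(a)` is `G(a)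
+ a G'(a)/s`, and `G` itself grows too slowly to matter, which turns the condition into membership
of `G` in the little logarithmic Bloch space (`memLittleLogBloch_iff`).

Carleson condition. The vanishing `1/p`-Carleson property is equivalent to the vanishing box
condition of exponent `s`. Compactness forces the box condition: apply the operator to `(1 - |a|)^c
w^k (1 - w ā)^(-(s+c))` with `s + c = 2 + β + k`, differentiate the image `k` times and evaluate at
`a`; the integrand becomes nonnegative and is large on the box (`exists_measure_nearSet_le`).

Usual compactness, `p = 1`. From the sequential form, subtract a locally uniform limit supplied by
Montel's theorem. In the other direction the logarithm helps: the normalized kernels have bounded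
images, so `(1 - |a|) kernelMean(a) → 0`, the images tend to `0` pointwise, hence in norm by
compactness, and the kernel criterion applies (`ToeplitzCompactUsual.compact`). -/

/-- The Bergman-type kernel `(1 - z w̄)^(-b)`. -/
noncomputable def kernel (b : ℝ) (z w : ℂ) : ℂ := (1 - z * conj w) ^ (-(b : ℂ))

/-- Approach to the unit circle from inside the disk. -/
noncomputable abbrev toCircle : Filter ℂ := comap (fun z : ℂ => ‖z‖) (𝓝[<] 1)

lemma mem_disk {z : ℂ} : z ∈ disk ↔ ‖z‖ < 1 := by simp [disk]

lemma isOpen_disk : IsOpen disk := Metric.isOpen_ball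

lemma measurableSet_disk : MeasurableSet disk := isOpen_disk.measurableSet

lemma zero_mem_disk : (0 : ℂ) ∈ disk := by simp [disk]

lemma norm_mul_conj_lt_one {z w : ℂ} (hz : ‖z‖ < 1) (hw : ‖w‖ ≤ 1) : ‖z * conj w‖ < 1 := by
  rw [norm_mul, RCLike.norm_conj]
  nlinarith [norm_nonneg z, norm_nonneg w]

lemma one_sub_mul_conj_mem_slitPlane {z w : ℂ} (hz : ‖z‖ < 1) (hw : ‖w‖ ≤ 1) :
    1 - z * conj w ∈ Complex.slitPlane := by
  have h := Complex.mem_slitPlane_of_norm_lt_one (z := -(z * conj w))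
    (by rw [norm_neg]; exact norm_mul_conj_lt_one hz hw)
  simpa [sub_eq_add_neg] using h

lemma one_sub_mul_conj_ne_zero {z w : ℂ} (hz : ‖z‖ < 1) (hw : ‖w‖ ≤ 1) : 1 - z * conj w ≠ 0 :=
  Complex.slitPlane_ne_zero (one_sub_mul_conj_mem_slitPlane hz hw)

lemma norm_one_sub_mul_conj_comm (z w : ℂ) : ‖1 - z * conj w‖ = ‖1 - w * conj z‖ := by
  rw [← RCLike.norm_conj]; simp [mul_comm]

lemma norm_one_sub_mul_conj_pos {z w : ℂ} (hz : ‖z‖ < 1) (hw : ‖w‖ ≤ 1) :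
    0 < ‖1 - z * conj w‖ := norm_pos_iff.2 (one_sub_mul_conj_ne_zero hz hw)

lemma one_sub_norm_le_norm_one_sub_mul_conj {z w : ℂ} (hw : ‖w‖ ≤ 1) :
    1 - ‖z‖ ≤ ‖1 - z * conj w‖ := by
  have h := norm_sub_norm_le (1 : ℂ) (z * conj w)
  rw [norm_one, norm_mul, RCLike.norm_conj] at h
  nlinarith [norm_nonneg z]

lemma norm_one_sub_mul_conj_le_two {z w : ℂ} (hz : ‖z‖ ≤ 1) (hw : ‖w‖ ≤ 1) :
    ‖1 - z * conj w‖ ≤ 2 := by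
  have h := norm_sub_le (1 : ℂ) (z * conj w)
  rw [norm_one, norm_mul, RCLike.norm_conj] at h
  nlinarith [norm_nonneg z, norm_nonneg w]

/-- The identity behind the pseudohyperbolic metric. Dropping its last term yields `|z - w| ≤ |1 - z
w̄|`, by which increments of the kernel are measured later. -/
lemma norm_one_sub_mul_conj_sq (z w : ℂ) :
    ‖1 - z * conj w‖ ^ 2 = ‖z - w‖ ^ 2 + (1 - ‖z‖ ^ 2) * (1 - ‖w‖ ^ 2) := by
  simp only [← Complex.normSq_eq_norm_sq, Complex.normSq_apply, Complex.sub_re, Complex.sub_im,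
    Complex.mul_re, Complex.mul_im, Complex.conj_re, Complex.conj_im, Complex.one_re,
    Complex.one_im]
  ring

lemma norm_sub_le_norm_one_sub_mul_conj {z w : ℂ} (hz : ‖z‖ ≤ 1) (hw : ‖w‖ ≤ 1) :
    ‖z - w‖ ≤ ‖1 - z * conj w‖ := by
  have h := norm_one_sub_mul_conj_sq z w
  have h1 : 0 ≤ (1 - ‖z‖ ^ 2) * (1 - ‖w‖ ^ 2) := by
    apply mul_nonneg <;> nlinarith [norm_nonneg z, norm_nonneg w]
  exact le_of_sq_le_sq (by linarith) (norm_nonneg _)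

lemma norm_kernel (b : ℝ) (z w : ℂ) : ‖kernel b z w‖ = ‖1 - z * conj w‖ ^ (-b) := by
  rw [kernel, ← Complex.ofReal_neg, Complex.norm_cpow_real]

lemma norm_kernel_comm (b : ℝ) (z w : ℂ) : ‖kernel b z w‖ = ‖kernel b w z‖ := by
  rw [norm_kernel, norm_kernel, norm_one_sub_mul_conj_comm]

lemma conj_kernel (b : ℝ) {z w : ℂ} (hz : ‖z‖ < 1) (hw : ‖w‖ ≤ 1) :
    conj (kernel b z w) = kernel b w z := by
  have h := (one_sub_mul_conj_mem_slitPlane hz hw)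
  have e := Complex.cpow_conj (1 - z * conj w) (-(b : ℂ)) (Complex.slitPlane_arg_ne_pi h)
  rw [map_neg, Complex.conj_ofReal] at e
  rw [kernel, e, Complex.conj_conj, kernel]
  simp [mul_comm]

lemma toeplitzIntegrand_eq (β : ℝ) (f : ℂ → ℂ) (z w : ℂ) :
    toeplitzIntegrand β f z w = f w * kernel (2 + β) z w := by
  rw [toeplitzIntegrand, kernel, Complex.cpow_neg, div_eq_mul_inv]

lemma toeplitz_eq (μ : Measure ℂ) (β : ℝ) (f : ℂ → ℂ) (z : ℂ) :
    toeplitz μ β f z = ∫ w, f w * kernel (2 + β) z w ∂μ := by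
  simp only [toeplitz, toeplitzIntegrand_eq]

@[fun_prop]
lemma measurable_kernel {X : Type*} [MeasurableSpace X] (b : ℝ) {f g : X → ℂ} (hf : Measurable f)
    (hg : Measurable g) : Measurable fun x => kernel b (f x) (g x) := by
  unfold kernel
  have : Measurable fun x => conj (g x) := Complex.continuous_conj.measurable.comp hg
  fun_prop

/-- Serves to express `z ∂_z` of a kernel as a difference of kernels with exponents `b + 1` and `b`.
-/
lemma kernel_eq_mul_kernel_add_one (b : ℝ) {z w : ℂ} (hz : ‖z‖ < 1) (hw : ‖w‖ ≤ 1) :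
    kernel b z w = (1 - z * conj w) * kernel (b + 1) z w := by
  have h := one_sub_mul_conj_ne_zero hz hw
  rw [kernel, kernel, show -(b : ℂ) = -((b + 1 : ℝ) : ℂ) + 1 by push_cast; ring,
    Complex.cpow_add _ _ h, Complex.cpow_one, mul_comm]

lemma norm_kernel_le (b : ℝ) (hb : 0 ≤ b) {z w : ℂ} (hz : ‖z‖ < 1) (hw : ‖w‖ ≤ 1) :
    ‖kernel b z w‖ ≤ (1 - ‖z‖) ^ (-b) := by
  rw [norm_kernel]
  exact Real.rpow_le_rpow_of_nonpos (by linarith) (one_sub_norm_le_norm_one_sub_mul_conj hw)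
    (by linarith)

lemma hasDerivAt_kernel (b : ℝ) {z w : ℂ} (hz : ‖z‖ < 1) (hw : ‖w‖ ≤ 1) :
    HasDerivAt (fun z => kernel b z w) (b * conj w * kernel (b + 1) z w) z := by
  have h1 : HasDerivAt (fun z : ℂ => 1 - z * conj w) (-(1 * conj w)) z :=
    ((hasDerivAt_id z).mul_const _).const_sub 1
  have h := h1.cpow_const (c := -(b : ℂ)) (one_sub_mul_conj_mem_slitPlane hz hw)
  have e : kernel (b + 1) z w = (1 - z * conj w) ^ (-(b : ℂ) - 1) := by
    rw [kernel]; congr 1; push_cast; ring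
  rw [e]
  change HasDerivAt (fun z => (1 - z * conj w) ^ (-(b : ℂ))) _ z
  convert h using 1
  ring

lemma differentiableOn_kernel (b : ℝ) {w : ℂ} (hw : ‖w‖ ≤ 1) :
    DifferentiableOn ℂ (fun z => kernel b z w) disk := fun _ hz =>
  (hasDerivAt_kernel b (mem_disk.1 hz) hw).differentiableAt.differentiableWithinAt

/-- Pairs of points that are close relative to their distance to the unit circle. -/
lemma one_sub_norm_le_of_near {z w : ℂ} (h : ‖z - w‖ < (1 - ‖w‖) / 2) :
    1 - ‖w‖ ≤ 2 * (1 - ‖z‖) := by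
  have := norm_sub_norm_le z w
  linarith

lemma one_sub_norm_ge_of_near {z w : ℂ} (h : ‖z - w‖ < (1 - ‖w‖) / 2) :
    1 - ‖z‖ ≤ 3 / 2 * (1 - ‖w‖) := by
  have := norm_sub_norm_le w z
  rw [norm_sub_rev] at this
  linarith

lemma norm_lt_one_of_near {z w : ℂ} (h : ‖z - w‖ < (1 - ‖w‖) / 2) : ‖w‖ < 1 ∧ ‖z‖ < 1 := by
  have h1 := one_sub_norm_le_of_near h
  have := norm_nonneg (z - w)
  constructor <;> linarith

/-- Moving from `w` to `z` changes `1 - w ā` by at most `|z - w|`, which is less than half of `1 -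
|w| ≤ |1 - w ā|`. So kernels are essentially constant on small discs. -/
lemma norm_one_sub_mul_conj_near {z w a : ℂ} (h : ‖z - w‖ < (1 - ‖w‖) / 2) (ha : ‖a‖ ≤ 1) :
    ‖1 - w * conj a‖ ≤ 2 * ‖1 - z * conj a‖ ∧ ‖1 - z * conj a‖ ≤ 2 * ‖1 - w * conj a‖ := by
  have h1 := one_sub_norm_le_norm_one_sub_mul_conj (z := w) ha
  have h2 : (1 - w * conj a) - (1 - z * conj a) = (z - w) * conj a := by ring
  have h3 : ‖(z - w) * conj a‖ ≤ ‖z - w‖ := by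
    rw [norm_mul, RCLike.norm_conj]; nlinarith [norm_nonneg (z - w)]
  have h4 := norm_sub_norm_le (1 - w * conj a) (1 - z * conj a)
  have h5 := norm_sub_norm_le (1 - z * conj a) (1 - w * conj a)
  rw [norm_sub_rev (1 - z * conj a)] at h5
  rw [h2] at h4 h5
  have := norm_nonneg (z - w)
  constructor <;> linarith

/-- Write `1 - w z̄ = (1 - |z|²) + (z - w) z̄`: the first term contributes `2(1 - |z|)`, the second
`(1 - |w|)/2 ≤ 1 - |z|`. This makes kernels large on boxes. -/
lemma norm_one_sub_mul_conj_le_of_near {z w : ℂ} (h : ‖z - w‖ < (1 - ‖w‖) / 2) :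
    ‖1 - w * conj z‖ ≤ 3 * (1 - ‖z‖) := by
  obtain ⟨hw, hz⟩ := norm_lt_one_of_near h
  have h2 : 1 - w * conj z = ((1 - ‖z‖ ^ 2 : ℝ) : ℂ) + (z - w) * conj z := by
    rw [sub_mul, Complex.mul_conj, Complex.normSq_eq_norm_sq]; push_cast; ring
  have h3 : ‖(z - w) * conj z‖ ≤ ‖z - w‖ := by
    rw [norm_mul, RCLike.norm_conj]; nlinarith [norm_nonneg (z - w)]
  have h4 := norm_add_le ((1 - ‖z‖ ^ 2 : ℝ) : ℂ) ((z - w) * conj z)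
  rw [← h2, Complex.norm_real, Real.norm_of_nonneg (by nlinarith [norm_nonneg z])] at h4
  have := one_sub_norm_le_of_near h
  nlinarith [norm_nonneg z]

/-- A power of a quantity comparable to `y` is comparable to the power of `y`. -/
lemma rpow_le_of_comparable {x y K : ℝ} (t : ℝ) (hK : 1 ≤ K) (hy : 0 < y) (h1 : x ≤ K * y)
    (h2 : y ≤ K * x) : x ^ t ≤ K ^ |t| * y ^ t := by
  have hK0 : 0 < K := by linarith
  have hx : 0 < x := by by_contra h; nlinarith
  rcases le_total 0 t with ht | ht
  · rw [abs_of_nonneg ht, ← Real.mul_rpow hK0.le hy.le]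
    exact Real.rpow_le_rpow hx.le h1 ht
  · rw [abs_of_nonpos ht, Real.rpow_neg hK0.le, ← Real.inv_rpow hK0.le,
      ← Real.mul_rpow (by positivity) hy.le]
    refine Real.rpow_le_rpow_of_nonpos (by positivity) ?_ ht
    rw [inv_mul_le_iff₀ hK0]; exact h2

/-- The measure `(1 - |z|)^σ` times Lebesgue measure of the disk. -/
noncomputable def modelArea (σ : ℝ) : Measure ℂ :=
  (volume.restrict disk).withDensity fun z => ENNReal.ofReal ((1 - ‖z‖) ^ σ)

lemma lintegral_modelArea (σ : ℝ) (F : ℂ → ENNReal) :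
    ∫⁻ z, F z ∂modelArea σ = ∫⁻ z in disk, ENNReal.ofReal ((1 - ‖z‖) ^ σ) * F z := by
  rw [modelArea, lintegral_withDensity_eq_lintegral_mul_non_measurable _ (by fun_prop)
    (by simp)]
  rfl

lemma weightedArea_eq (σ : ℝ) : weightedArea σ = (volume.restrict disk).withDensity
    fun z => ENNReal.ofReal (Real.pi⁻¹ * weight σ z) := by
  rw [weightedArea, diskArea, withDensity_smul_measure, ← withDensity_smul _ (by
    unfold weight; fun_prop)]
  congr 1
  ext z
  rw [Pi.smul_apply, smul_eq_mul, ← ENNReal.ofReal_mul (by positivity)]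

lemma lintegral_weightedArea (σ : ℝ) (F : ℂ → ENNReal) : ∫⁻ z, F z ∂weightedArea σ =
    ∫⁻ z in disk, ENNReal.ofReal (Real.pi⁻¹ * weight σ z) * F z := by
  rw [weightedArea_eq, lintegral_withDensity_eq_lintegral_mul_non_measurable _ (by
    unfold weight; fun_prop) (by simp)]
  rfl

lemma one_sub_sq_comparable {x : ℝ} (hx0 : 0 ≤ x) (hx : x < 1) :
    1 - x ^ 2 ≤ 2 * (1 - x) ∧ 1 - x ≤ 1 - x ^ 2 := by
  constructor <;> nlinarith

/-- The densities are comparable because `1 - |z| ≤ 1 - |z|² ≤ 2(1 - |z|)`. No measurability of the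
integrand is required, since the densities are finite. -/
lemma exists_weightedArea_le (σ : ℝ) (hσ : -1 < σ) : ∃ C : ℝ, 0 < C ∧
    (∀ F : ℂ → ENNReal, ∫⁻ z, F z ∂weightedArea σ ≤ ENNReal.ofReal C * ∫⁻ z, F z ∂modelArea σ) ∧
    ∀ F : ℂ → ENNReal, ∫⁻ z, F z ∂modelArea σ ≤ ENNReal.ofReal C * ∫⁻ z, F z ∂weightedArea σ := by
  have key : ∀ z ∈ disk, Real.pi⁻¹ * weight σ z ≤ (Real.pi⁻¹ * (1 + σ) * 2 ^ |σ|) * (1 - ‖z‖) ^ σ ∧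
      (1 - ‖z‖) ^ σ ≤ (Real.pi * (1 + σ)⁻¹ * 2 ^ |σ|) * (Real.pi⁻¹ * weight σ z) := by
    intro z hz
    rw [mem_disk] at hz
    obtain ⟨h1, h2⟩ := one_sub_sq_comparable (norm_nonneg z) hz
    have h0 : 0 < 1 - ‖z‖ := by linarith
    have hs : 0 < 1 + σ := by linarith
    have e1 := rpow_le_of_comparable σ one_le_two h0 h1 (by linarith)
    have e2 := rpow_le_of_comparable σ one_le_two (by linarith) (by linarith) h1
    have hp := Real.pi_pos
    constructor
    · calc Real.pi⁻¹ * weight σ z = Real.pi⁻¹ * (1 + σ) * (1 - ‖z‖ ^ 2) ^ σ := by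
            rw [weight]; ring
        _ ≤ Real.pi⁻¹ * (1 + σ) * (2 ^ |σ| * (1 - ‖z‖) ^ σ) := by gcongr
        _ = _ := by ring
    · calc (1 - ‖z‖) ^ σ ≤ 2 ^ |σ| * (1 - ‖z‖ ^ 2) ^ σ := e2
        _ = _ := by rw [weight]; field_simp
  set A := Real.pi⁻¹ * (1 + σ) * 2 ^ |σ|
  set B := Real.pi * (1 + σ)⁻¹ * 2 ^ |σ|
  have hs : 0 < 1 + σ := by linarith
  have hA : 0 < A := by positivity
  have hB : 0 < B := by positivity
  refine ⟨A + B, by positivity, fun F => ?_, fun F => ?_⟩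
  · rw [lintegral_weightedArea, lintegral_modelArea, ← lintegral_const_mul' _ _ (by simp)]
    refine setLIntegral_mono' measurableSet_disk fun z hz => ?_
    rw [← mul_assoc, ← ENNReal.ofReal_mul (by positivity)]
    refine mul_le_mul_left (ENNReal.ofReal_le_ofReal ?_) _
    refine (key z hz).1.trans ?_
    have : 0 ≤ (1 - ‖z‖) ^ σ := Real.rpow_nonneg (by linarith [mem_disk.1 hz]) _
    nlinarith
  · rw [lintegral_weightedArea, lintegral_modelArea, ← lintegral_const_mul' _ _ (by simp)]
    refine setLIntegral_mono' measurableSet_disk fun z hz => ?_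
    rw [← mul_assoc, ← ENNReal.ofReal_mul (by positivity)]
    refine mul_le_mul_left (ENNReal.ofReal_le_ofReal ?_) _
    refine (key z hz).2.trans ?_
    have : 0 ≤ Real.pi⁻¹ * weight σ z := by
      unfold weight
      have : 0 ≤ (1 - ‖z‖ ^ 2) := by nlinarith [mem_disk.1 hz, norm_nonneg z]
      positivity
    nlinarith

end ToeplitzBergman

/-! ### Polar coordinates and the Forelli–Rudin integrals -/

namespace ToeplitzBergman
open MeasureTheory Filter Topology ComplexConjugate Set

lemma measurePreserving_rotate {u : ℂ} (hu : ‖u‖ = 1) :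
    MeasurePreserving (fun z : ℂ => u * z) (volume.restrict disk) (volume.restrict disk) := by
  have h := (rotation ⟨u, mem_sphere_zero_iff_norm.2 hu⟩).measurePreserving
  have h2 := h.restrict_preimage measurableSet_disk
  have e : (⇑(rotation ⟨u, mem_sphere_zero_iff_norm.2 hu⟩) : ℂ → ℂ) = fun z => u * z := by
    ext z; rfl
  rw [e] at h2
  have e2 : (fun z : ℂ => u * z) ⁻¹' disk = disk := by
    ext z; simp [mem_disk, hu]
  rwa [e2] at h2

lemma measurableEmbedding_rotate {u : ℂ} (hu : ‖u‖ = 1) :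
    MeasurableEmbedding (fun z : ℂ => u * z) :=
  (measurableEmbedding_const_smul₀ (norm_ne_zero_iff.1 (by rw [hu]; exact one_ne_zero) : u ≠ 0))

lemma lintegral_disk_rotate {u : ℂ} (hu : ‖u‖ = 1) (F : ℂ → ENNReal) :
    ∫⁻ z in disk, F (u * z) = ∫⁻ z in disk, F z :=
  (measurePreserving_rotate hu).lintegral_comp_emb (measurableEmbedding_rotate hu) F

/-- Integration over the disk in polar coordinates. -/
lemma lintegral_disk_polar {F : ℂ → ENNReal} (hF : Measurable F) : ∫⁻ z in disk, F z =
    ∫⁻ r in Ioo (0 : ℝ) 1, ∫⁻ θ in Ioo (-Real.pi) Real.pi,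
      ENNReal.ofReal r * F (r * (Real.cos θ + Real.sin θ * Complex.I)) := by
  have hm : Measurable fun p : ℝ × ℝ => ENNReal.ofReal p.1 *
      F (p.1 * (Real.cos p.2 + Real.sin p.2 * Complex.I)) := by fun_prop
  rw [← lintegral_prod (f := fun p : ℝ × ℝ => ENNReal.ofReal p.1 *
      F (p.1 * (Real.cos p.2 + Real.sin p.2 * Complex.I))) hm.aemeasurable,
    Measure.prod_restrict, ← lintegral_indicator measurableSet_disk,
    ← Complex.lintegral_comp_polarCoord_symm, polarCoord_target,
    ← lintegral_indicator (measurableSet_Ioi.prod measurableSet_Ioo),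
    ← lintegral_indicator (measurableSet_Ioo.prod measurableSet_Ioo)]
  refine lintegral_congr fun p => ?_
  simp only [indicator, mem_prod, mem_Ioi, mem_Ioo, Complex.polarCoord_symm_apply, mem_disk,
    smul_eq_mul]
  have hn : ‖(p.1 : ℂ) * (Real.cos p.2 + Real.sin p.2 * Complex.I)‖ = |p.1| := by
    rw [← Complex.polarCoord_symm_apply, Complex.norm_polarCoord_symm]
  rw [hn]
  by_cases h0 : 0 < p.1
  · simp only [h0, abs_of_pos h0, true_and]
    by_cases h1 : p.1 < 1 <;> simp [h1]
  · simp [h0]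

lemma lintegral_Ioi_add_rpow {y t : ℝ} (hy : 0 < y) (ht : 1 < t) :
    ∫⁻ θ in Ioi (0 : ℝ), ENNReal.ofReal ((y + θ) ^ (-t)) =
      ENNReal.ofReal (y ^ (1 - t) / (t - 1)) := by
  have h1 : ∫⁻ θ in Ioi (0 : ℝ), ENNReal.ofReal ((y + θ) ^ (-t)) =
      ∫⁻ x in Ioi y, ENNReal.ofReal (x ^ (-t)) := by
    have := (measurePreserving_add_left (volume : Measure ℝ) y).setLIntegral_comp_preimage_emb
      (measurableEmbedding_addLeft y) (fun x => ENNReal.ofReal (x ^ (-t))) (Ioi y)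
    rw [← this]
    congr 2
    ext x; simp
  rw [h1, ← ofReal_integral_eq_lintegral_ofReal (integrableOn_Ioi_rpow_of_lt (by linarith) hy),
    integral_Ioi_rpow_of_lt (by linarith) hy]
  · congr 1
    rw [show -t + 1 = -(t - 1) by ring, show 1 - t = -(t - 1) by ring, neg_div_neg_eq]
  · filter_upwards [ae_restrict_mem measurableSet_Ioi] with x hx
    exact Real.rpow_nonneg (hy.le.trans (le_of_lt hx)) _

lemma lintegral_add_abs_rpow_le {y t : ℝ} (hy : 0 < y) (ht : 1 < t) (S : Set ℝ) :
    ∫⁻ θ in S, ENNReal.ofReal ((y + |θ|) ^ (-t)) ≤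
      ENNReal.ofReal (2 / (t - 1) * y ^ (1 - t)) := by
  have h1 : ∫⁻ θ in Ioi (0 : ℝ), ENNReal.ofReal ((y + |θ|) ^ (-t)) =
      ENNReal.ofReal (y ^ (1 - t) / (t - 1)) := by
    rw [← lintegral_Ioi_add_rpow hy ht]
    refine setLIntegral_congr_fun measurableSet_Ioi fun θ hθ => ?_
    simp only [abs_of_pos (mem_Ioi.1 hθ)]
  have h2 : ∫⁻ θ in Iio (0 : ℝ), ENNReal.ofReal ((y + |θ|) ^ (-t)) =
      ENNReal.ofReal (y ^ (1 - t) / (t - 1)) := by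
    rw [← h1]
    have := (Measure.measurePreserving_neg (volume : Measure ℝ)).setLIntegral_comp_preimage_emb
      (MeasurableEquiv.neg ℝ).measurableEmbedding
      (fun θ => ENNReal.ofReal ((y + |θ|) ^ (-t))) (Ioi 0)
    rw [← this]
    simp
  have h3 : ∫⁻ θ in Iic (0 : ℝ), ENNReal.ofReal ((y + |θ|) ^ (-t)) =
      ENNReal.ofReal (y ^ (1 - t) / (t - 1)) := by
    rw [← h2]; exact setLIntegral_congr Iio_ae_eq_Iic.symm
  calc _ ≤ ∫⁻ θ in Iic 0 ∪ Ioi 0, ENNReal.ofReal ((y + |θ|) ^ (-t)) :=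
        lintegral_mono_set (by rw [Iic_union_Ioi]; exact subset_univ _)
    _ ≤ _ := lintegral_union_le _ _ _
    _ = _ := by
      have : 0 ≤ y ^ (1 - t) / (t - 1) := div_nonneg (by positivity) (by linarith)
      rw [h1, h3, ← ENNReal.ofReal_add this this]; congr 1; ring

lemma norm_one_sub_polar_sq (q θ : ℝ) :
    ‖(1 : ℂ) - q * (Real.cos θ + Real.sin θ * Complex.I)‖ ^ 2 =
      (1 - q) ^ 2 + 2 * q * (1 - Real.cos θ) := by
  rw [← Complex.normSq_eq_norm_sq, Complex.normSq_apply]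
  simp only [Complex.sub_re, Complex.sub_im, Complex.mul_re, Complex.mul_im, Complex.add_re,
    Complex.add_im, Complex.one_re, Complex.one_im, Complex.ofReal_re, Complex.ofReal_im,
    Complex.I_re, Complex.I_im]
  linear_combination q ^ 2 * Real.sin_sq_add_cos_sq θ

/-- For `q ≥ 1/2` the term `2q(1 - cos θ) ≥ θ²/5` controls the angle. For `q ≤ 1/2` the term `(1 -
q)²` alone suffices, because `π ≤ 8(1 - q)`; this accounts for the constant 9. -/
lemma norm_one_sub_polar_ge {q θ : ℝ} (hq0 : 0 ≤ q) (hq : q < 1) (hθ : |θ| ≤ Real.pi) :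
    1 - q + |θ| ≤ 9 * ‖(1 : ℂ) - q * (Real.cos θ + Real.sin θ * Complex.I)‖ := by
  have hπ := Real.pi_lt_d2
  have hπ0 := Real.pi_pos
  refine abs_le_of_sq_le_sq' ?_ (by positivity) |>.2
  rw [mul_pow, norm_one_sub_polar_sq]
  have hc := Real.cos_le_one_sub_mul_cos_sq hθ
  have hc1 := Real.cos_le_one θ
  rw [← sq_abs θ] at hc
  rcases le_total (1 / 2) q with h | h
  · have h5 : |θ| ^ 2 / 5 ≤ 1 - Real.cos θ := by
      have : |θ| ^ 2 / 5 ≤ 2 / Real.pi ^ 2 * |θ| ^ 2 := by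
        rw [div_mul_eq_mul_div, div_le_div_iff₀ (by norm_num) (by positivity)]
        have h10 : Real.pi ^ 2 ≤ 10 := by nlinarith
        linarith [mul_le_mul_of_nonneg_left h10 (sq_nonneg |θ|)]
      linarith
    nlinarith [sq_nonneg (1 - q - |θ|), abs_nonneg θ]
  · nlinarith [abs_nonneg θ]

lemma norm_one_sub_polar_le {q θ : ℝ} (hq0 : 0 ≤ q) (hq : q < 1) :
    ‖(1 : ℂ) - q * (Real.cos θ + Real.sin θ * Complex.I)‖ ≤ 1 - q + |θ| := by
  refine abs_le_of_sq_le_sq' ?_ (by positivity [abs_nonneg θ]) |>.2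
  rw [norm_one_sub_polar_sq]
  have := Real.one_sub_sq_div_two_le_cos (x := θ)
  rw [← sq_abs θ] at this
  nlinarith [abs_nonneg θ]

/-- The Forelli–Rudin integral with exponents `σ`, `t` at the point `a`. -/
noncomputable def forelliRudin (σ t : ℝ) (a : ℂ) : ENNReal :=
  ∫⁻ z, ENNReal.ofReal (‖1 - z * conj a‖ ^ (-t)) ∂modelArea σ

/-- Rotation invariance allows `a` to be replaced by `|a|` before passing to polar coordinates. -/
lemma forelliRudin_eq_polar (σ t : ℝ) (a : ℂ) : forelliRudin σ t a =
    ∫⁻ r in Ioo (0 : ℝ) 1, ∫⁻ θ in Ioo (-Real.pi) Real.pi,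
      ENNReal.ofReal (r * (1 - r) ^ σ *
        ‖(1 : ℂ) - ((‖a‖ * r : ℝ) : ℂ) * (Real.cos θ + Real.sin θ * Complex.I)‖ ^ (-t)) := by
  obtain ⟨u, hu, ha⟩ : ∃ u : ℂ, ‖u‖ = 1 ∧ a = u * ‖a‖ := by
    by_cases h : a = 0
    · exact ⟨1, by simp, by simp [h]⟩
    · have : (‖a‖ : ℂ) ≠ 0 := by simpa using h
      exact ⟨a / ‖a‖, by simp [h], by field_simp⟩
  have huu : u * conj u = 1 := by rw [Complex.mul_conj, Complex.normSq_eq_norm_sq, hu]; simp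
  have hc : Continuous fun z : ℂ => conj z := Complex.continuous_conj
  rw [forelliRudin, lintegral_modelArea, ← lintegral_disk_rotate hu, lintegral_disk_polar]
  · refine setLIntegral_congr_fun measurableSet_Ioo fun r hr => lintegral_congr fun θ => ?_
    have hn : ‖(r : ℂ) * (Real.cos θ + Real.sin θ * Complex.I)‖ = r := by
      rw [← Complex.polarCoord_symm_apply (r, θ), Complex.norm_polarCoord_symm, abs_of_pos hr.1]
    have hin : 1 - u * (r * (Real.cos θ + Real.sin θ * Complex.I)) * conj a =
        1 - ((‖a‖ * r : ℝ) : ℂ) * (Real.cos θ + Real.sin θ * Complex.I) := by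
      have hca : conj a = conj u * ‖a‖ := by
        conv_lhs => rw [ha]
        rw [map_mul, Complex.conj_ofReal]
      rw [hca]
      push_cast
      linear_combination -(r * (Complex.cos θ + Complex.sin θ * Complex.I)) * ‖a‖ * huu
    rw [hin, norm_mul, hu, hn, one_mul,
      ← ENNReal.ofReal_mul (Real.rpow_nonneg (by linarith [hr.2]) _),
      ← ENNReal.ofReal_mul hr.1.le, mul_assoc]
  · fun_prop

/-- The denominator is comparable to `y + |θ|` with `y = 1 - |a| r`. Integrating in `θ` gains one
power and leaves `y^(1-t)`, and `y` dominates both `1 - r` and `1 - |a|`. -/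
lemma forelliRudin_le_radial {t : ℝ} (ht : 1 < t) (σ : ℝ) {a : ℂ} (ha : ‖a‖ < 1) :
    forelliRudin σ t a ≤ ENNReal.ofReal (9 ^ t * (2 / (t - 1))) *
      ∫⁻ r in Ioo (0 : ℝ) 1, ENNReal.ofReal ((1 - r) ^ σ * (max (1 - r) (1 - ‖a‖)) ^ (1 - t)) := by
  rw [forelliRudin_eq_polar, ← lintegral_const_mul' _ _ (by simp)]
  refine setLIntegral_mono' measurableSet_Ioo fun r hr => ?_
  have hq0 : 0 ≤ ‖a‖ * r := mul_nonneg (norm_nonneg _) hr.1.le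
  have hq1 : ‖a‖ * r < 1 := by nlinarith [norm_nonneg a, hr.1, hr.2]
  have hy : 0 < 1 - ‖a‖ * r := by linarith
  have hr1 : 0 < 1 - r := by linarith [hr.2]
  have hm : max (1 - r) (1 - ‖a‖) ≤ 1 - ‖a‖ * r := by
    apply max_le <;> nlinarith [norm_nonneg a, hr.1, hr.2]
  have hm0 : 0 < max (1 - r) (1 - ‖a‖) := lt_max_of_lt_left hr1
  calc _ ≤ ∫⁻ θ in Ioo (-Real.pi) Real.pi, ENNReal.ofReal (9 ^ t * (1 - r) ^ σ) *
        ENNReal.ofReal ((1 - ‖a‖ * r + |θ|) ^ (-t)) := by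
        refine setLIntegral_mono' measurableSet_Ioo fun θ hθ => ?_
        rw [← ENNReal.ofReal_mul (by positivity)]
        apply ENNReal.ofReal_le_ofReal
        have hb := norm_one_sub_polar_ge hq0 hq1 (abs_le.2 ⟨hθ.1.le, hθ.2.le⟩)
        have hp : 0 < 1 - ‖a‖ * r + |θ| := by positivity
        have hle : ‖(1 : ℂ) - ((‖a‖ * r : ℝ) : ℂ) * (Real.cos θ + Real.sin θ * Complex.I)‖ ^ (-t)
            ≤ 9 ^ t * (1 - ‖a‖ * r + |θ|) ^ (-t) := by
          have h9 : (9 : ℝ) ^ t = (9⁻¹) ^ (-t) := by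
            rw [Real.rpow_neg (by norm_num), Real.inv_rpow (by norm_num), inv_inv]
          rw [h9, ← Real.mul_rpow (by norm_num) hp.le]
          exact Real.rpow_le_rpow_of_nonpos (by positivity) (by linarith) (by linarith)
        calc _ ≤ 1 * (1 - r) ^ σ * (9 ^ t * (1 - ‖a‖ * r + |θ|) ^ (-t)) := by
              gcongr
              exact hr.2.le
          _ = _ := by ring
    _ ≤ ENNReal.ofReal (9 ^ t * (1 - r) ^ σ) *
        ENNReal.ofReal (2 / (t - 1) * (1 - ‖a‖ * r) ^ (1 - t)) := by
        rw [lintegral_const_mul' _ _ (by simp)]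
        gcongr
        exact lintegral_add_abs_rpow_le hy ht _
    _ ≤ _ := by
        have ht1 : 0 < t - 1 := by linarith
        rw [← ENNReal.ofReal_mul (by positivity), ← ENNReal.ofReal_mul (by positivity)]
        apply ENNReal.ofReal_le_ofReal
        have : (1 - ‖a‖ * r) ^ (1 - t) ≤ (max (1 - r) (1 - ‖a‖)) ^ (1 - t) :=
          Real.rpow_le_rpow_of_nonpos hm0 hm (by linarith)
        calc _ = 9 ^ t * (2 / (t - 1)) * ((1 - r) ^ σ * (1 - ‖a‖ * r) ^ (1 - t)) := by ring
          _ ≤ _ := by gcongr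

lemma lintegral_Ioo_one_sub {G : ℝ → ENNReal} (u v : ℝ) :
    ∫⁻ r in Ioo u v, G (1 - r) = ∫⁻ x in Ioo (1 - v) (1 - u), G x := by
  have := (Measure.measurePreserving_sub_left (volume : Measure ℝ) 1).setLIntegral_comp_preimage_emb
    (MeasurableEquiv.subLeft (1 : ℝ)).measurableEmbedding G (Ioo (1 - v) (1 - u))
  rw [← this]
  congr 2
  simp

lemma lintegral_Ioo_zero_rpow {σ y : ℝ} (hσ : -1 < σ) (hy : 0 < y) :
    ∫⁻ x in Ioo 0 y, ENNReal.ofReal (x ^ σ) = ENNReal.ofReal (y ^ (σ + 1) / (σ + 1)) := by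
  have hi : IntegrableOn (fun x : ℝ => x ^ σ) (Ioo 0 y) :=
    (intervalIntegral.integrableOn_Ioo_rpow_iff hy).2 hσ
  rw [← ofReal_integral_eq_lintegral_ofReal hi, ← integral_Ioc_eq_integral_Ioo,
    ← intervalIntegral.integral_of_le hy.le, integral_rpow (Or.inl hσ)]
  · rw [Real.zero_rpow (by linarith), sub_zero]
  · filter_upwards [ae_restrict_mem measurableSet_Ioo] with x hx
    exact Real.rpow_nonneg hx.1.le _

lemma lintegral_Ioo_inv {y v : ℝ} (hy : 0 < y) (hv : y ≤ v) :
    ∫⁻ x in Ioo y v, ENNReal.ofReal (x ^ (-1 : ℝ)) = ENNReal.ofReal (Real.log (v / y)) := by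
  have hi : IntegrableOn (fun x : ℝ => x ^ (-1 : ℝ)) (Ioo y v) := by
    refine (ContinuousOn.integrableOn_Icc (fun x hx => ?_)).mono_set Ioo_subset_Icc_self
    exact (Real.continuousAt_rpow_const _ _ (Or.inl (by linarith [hx.1]))).continuousWithinAt
  rw [← ofReal_integral_eq_lintegral_ofReal hi, ← integral_Ioc_eq_integral_Ioo,
    ← intervalIntegral.integral_of_le hv]
  · simp only [Real.rpow_neg_one]
    rw [integral_inv_of_pos hy (by linarith)]
  · filter_upwards [ae_restrict_mem measurableSet_Ioo] with x hx
    exact Real.rpow_nonneg (by linarith [hx.1]) _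

/-- Substitute `x = 1 - r` and split at `x = y`, where the maximum changes from `y` to `x`. Only the
second piece distinguishes the power case from the logarithmic case. -/
lemma lintegral_radial_le (σ t : ℝ) (hσ : -1 < σ) {y : ℝ} (hy : 0 < y) :
    ∫⁻ r in Ioo (0 : ℝ) 1, ENNReal.ofReal ((1 - r) ^ σ * (max (1 - r) y) ^ (1 - t)) ≤
      ENNReal.ofReal (y ^ (σ + 2 - t) / (σ + 1)) +
        ∫⁻ x in Ioo y 1, ENNReal.ofReal (x ^ (σ + 1 - t)) := by
  rw [lintegral_Ioo_one_sub (G := fun x => ENNReal.ofReal (x ^ σ * (max x y) ^ (1 - t))),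
    sub_self, sub_zero]
  have hsub : Ioo (0 : ℝ) 1 ⊆ Ioc 0 y ∪ Ioo y 1 := fun x hx => by
    rcases le_or_gt x y with h | h
    · exact Or.inl ⟨hx.1, h⟩
    · exact Or.inr ⟨h, hx.2⟩
  refine (lintegral_mono_set hsub).trans ((lintegral_union_le _ _ _).trans (add_le_add ?_ ?_))
  · rw [setLIntegral_congr Ioo_ae_eq_Ioc.symm]
    calc _ = ∫⁻ x in Ioo 0 y, ENNReal.ofReal (y ^ (1 - t)) * ENNReal.ofReal (x ^ σ) := by
          refine setLIntegral_congr_fun measurableSet_Ioo fun x hx => ?_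
          simp only [max_eq_right hx.2.le]
          rw [← ENNReal.ofReal_mul (by positivity), mul_comm]
      _ = _ := by
          rw [lintegral_const_mul' _ _ (by simp), lintegral_Ioo_zero_rpow hσ hy,
            ← ENNReal.ofReal_mul (by positivity), ← mul_div_assoc, ← Real.rpow_add hy]
          congr 3; ring
      _ ≤ _ := le_rfl
  · refine setLIntegral_mono' measurableSet_Ioo fun x hx => ?_
    have hx0 : 0 < x := hy.trans hx.1
    rw [max_eq_left hx.1.le, ← Real.rpow_add hx0]
    apply le_of_eq; congr 2; ring

/-- **Forelli–Rudin estimate**, the case of a power. -/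
lemma exists_forelliRudin_le (σ t : ℝ) (hσ : -1 < σ) (ht : σ + 2 < t) : ∃ C : ℝ, 0 < C ∧
    ∀ a ∈ disk, forelliRudin σ t a ≤ ENNReal.ofReal (C * (1 - ‖a‖) ^ (σ + 2 - t)) := by
  have h1 : 0 < t - 1 := by linarith
  have h2 : 0 < σ + 1 := by linarith
  have h3 : 0 < t - σ - 2 := by linarith
  refine ⟨9 ^ t * (2 / (t - 1)) * (1 / (σ + 1) + 1 / (t - σ - 2)), by positivity, fun a ha => ?_⟩
  rw [mem_disk] at ha
  have hy : 0 < 1 - ‖a‖ := by linarith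
  refine (forelliRudin_le_radial (by linarith) σ ha).trans ?_
  have hI : ∫⁻ x in Ioo (1 - ‖a‖) 1, ENNReal.ofReal (x ^ (σ + 1 - t)) ≤
      ENNReal.ofReal ((1 - ‖a‖) ^ (σ + 2 - t) / (t - σ - 2)) := by
    calc _ ≤ ∫⁻ x in Ioi (1 - ‖a‖), ENNReal.ofReal (x ^ (σ + 1 - t)) :=
          lintegral_mono_set Ioo_subset_Ioi_self
      _ = _ := by
        rw [← ofReal_integral_eq_lintegral_ofReal
          (integrableOn_Ioi_rpow_of_lt (by linarith) hy), integral_Ioi_rpow_of_lt (by linarith) hy]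
        · rw [show σ + 1 - t + 1 = -(t - σ - 2) by ring, show σ + 2 - t = -(t - σ - 2) by ring,
            neg_div_neg_eq]
        · filter_upwards [ae_restrict_mem measurableSet_Ioi] with x hx
          exact Real.rpow_nonneg (hy.le.trans (le_of_lt hx)) _
  calc _ ≤ ENNReal.ofReal (9 ^ t * (2 / (t - 1))) *
        (ENNReal.ofReal ((1 - ‖a‖) ^ (σ + 2 - t) / (σ + 1)) +
          ENNReal.ofReal ((1 - ‖a‖) ^ (σ + 2 - t) / (t - σ - 2))) := by
        gcongr
        exact (lintegral_radial_le σ t hσ hy).trans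
          (add_le_add le_rfl hI)
    _ = _ := by
        rw [← ENNReal.ofReal_add (by positivity) (by positivity),
          ← ENNReal.ofReal_mul (by positivity)]
        congr 1; ring

/-- **Forelli–Rudin estimate**, upper bound in the logarithmic case. -/
lemma exists_forelliRudin_log_le (σ : ℝ) (hσ : -1 < σ) : ∃ C : ℝ, 0 < C ∧
    ∀ a ∈ disk, forelliRudin σ (σ + 2) a ≤
      ENNReal.ofReal (C * Real.log (2 / (1 - ‖a‖ ^ 2))) := by
  have h2 : 0 < σ + 1 := by linarith
  have hl2 := Real.log_pos one_lt_two
  refine ⟨9 ^ (σ + 2) * (2 / (σ + 1)) * (1 / (σ + 1) / Real.log 2 + 1), by positivity,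
    fun a ha => ?_⟩
  rw [mem_disk] at ha
  have hy : 0 < 1 - ‖a‖ := by linarith
  have hn := norm_nonneg a
  have hy2 : 0 < 1 - ‖a‖ ^ 2 := by nlinarith
  refine (forelliRudin_le_radial (by linarith) σ ha).trans ?_
  have e : σ + 2 - (σ + 2) = 0 := by ring
  have e1 : σ + 1 - (σ + 2) = -1 := by ring
  have e2 : σ + 2 - 1 = σ + 1 := by ring
  have hrad := lintegral_radial_le σ (σ + 2) hσ hy
  rw [e, e1, Real.rpow_zero, lintegral_Ioo_inv hy (by linarith),
    ← ENNReal.ofReal_add (by positivity)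
      (Real.log_nonneg (by rw [le_div_iff₀ hy]; linarith))] at hrad
  have hL1 : Real.log (1 / (1 - ‖a‖)) ≤ Real.log (2 / (1 - ‖a‖ ^ 2)) := by
    apply Real.log_le_log (by positivity)
    rw [div_le_div_iff₀ hy hy2]; nlinarith
  -- The constant contributed by the range `x ≤ y` is absorbed into the logarithm, which never falls
  -- below `log 2`.
  have hL2 : Real.log 2 ≤ Real.log (2 / (1 - ‖a‖ ^ 2)) := by
    apply Real.log_le_log (by norm_num)
    rw [le_div_iff₀ hy2]; nlinarith
  rw [e2]
  calc _ ≤ _ := mul_le_mul_right hrad _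
    _ ≤ _ := by
      rw [← ENNReal.ofReal_mul (by positivity)]
      apply ENNReal.ofReal_le_ofReal
      rw [mul_assoc (9 ^ (σ + 2) * (2 / (σ + 1)))]
      gcongr
      have : 1 / (σ + 1) ≤ 1 / (σ + 1) / Real.log 2 * Real.log (2 / (1 - ‖a‖ ^ 2)) := by
        rw [div_mul_eq_mul_div, le_div_iff₀ hl2]; gcongr
      linarith

/-- **Forelli–Rudin estimate**, lower bound in the logarithmic case. -/
lemma exists_le_forelliRudin_log (σ : ℝ) (hσ : -1 < σ) : ∃ c : ℝ, 0 < c ∧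
    ∀ a : ℂ, 7 / 8 ≤ ‖a‖ → ‖a‖ < 1 →
      ENNReal.ofReal (c * Real.log (2 / (1 - ‖a‖ ^ 2))) ≤ forelliRudin σ (σ + 2) a := by
  refine ⟨2⁻¹ * 3 ^ (-(σ + 2)) / 2, by positivity, fun a ha7 ha => ?_⟩
  have hy : 0 < 1 - ‖a‖ := by linarith
  have hn := norm_nonneg a
  have hπ := Real.pi_gt_three
  rw [forelliRudin_eq_polar]
  -- Keep only the arc `0 < θ < 1 - r`. There the denominator is at most `3(1 - r)`, since `r < |a|`
  -- gives `1 - |a| r ≤ 2(1 - r)`; the length of the arc leaves `(1 - r)^(-1)`.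
  have step : ∀ r ∈ Ioo (1 / 2) ‖a‖, ENNReal.ofReal (2⁻¹ * 3 ^ (-(σ + 2)) * (1 - r) ^ (-1 : ℝ)) ≤
      ∫⁻ θ in Ioo (-Real.pi) Real.pi, ENNReal.ofReal (r * (1 - r) ^ σ *
        ‖(1 : ℂ) - ((‖a‖ * r : ℝ) : ℂ) * (Real.cos θ + Real.sin θ * Complex.I)‖ ^ (-(σ + 2))) := by
    intro r hr
    have hr0 : 0 < r := by linarith [hr.1]
    have hr1 : 0 < 1 - r := by linarith [hr.2]
    have hq0 : 0 ≤ ‖a‖ * r := by positivity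
    have hq1 : ‖a‖ * r < 1 := by nlinarith
    calc _ = ∫⁻ θ in Ioo 0 (1 - r),
          ENNReal.ofReal (2⁻¹ * (1 - r) ^ σ * (3 * (1 - r)) ^ (-(σ + 2))) := by
          rw [setLIntegral_const, Real.volume_Ioo, ← ENNReal.ofReal_mul (by positivity),
            Real.mul_rpow (by norm_num) hr1.le]
          congr 1
          have : (1 - r) ^ (-1 : ℝ) = (1 - r) ^ σ * (1 - r) ^ (-(σ + 2)) * (1 - r) := by
            conv_rhs => rw [← Real.rpow_add hr1]; rw [← Real.rpow_add_one hr1.ne']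
            congr 1; ring
          rw [this]; ring
      _ ≤ ∫⁻ θ in Ioo 0 (1 - r), ENNReal.ofReal (r * (1 - r) ^ σ *
        ‖(1 : ℂ) - ((‖a‖ * r : ℝ) : ℂ) * (Real.cos θ + Real.sin θ * Complex.I)‖ ^ (-(σ + 2))) := by
          refine setLIntegral_mono' measurableSet_Ioo fun θ hθ => ENNReal.ofReal_le_ofReal ?_
          have h1 := norm_one_sub_polar_le (θ := θ) hq0 hq1
          have h2 := norm_one_sub_polar_ge (θ := θ) hq0 hq1
            (by rw [abs_of_pos hθ.1]; linarith [hθ.2])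
          rw [abs_of_pos hθ.1] at h1 h2
          gcongr ?_ * ?_ * ?_
          · linarith [hr.1]
          · apply Real.rpow_le_rpow_of_nonpos
            · linarith [hθ.1]
            · refine h1.trans ?_
              nlinarith [hθ.2, hr.2]
            · linarith
      _ ≤ _ := lintegral_mono_set (Ioo_subset_Ioo (by linarith) (by linarith))
  calc _ ≤ ENNReal.ofReal (2⁻¹ * 3 ^ (-(σ + 2)) * Real.log ((1 / 2) / (1 - ‖a‖))) := by
        apply ENNReal.ofReal_le_ofReal
        rw [div_mul_eq_mul_div, mul_div_assoc]
        gcongr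
        have hy2 : 0 < 1 - ‖a‖ ^ 2 := by nlinarith
        -- The threshold 7/8 ensures `2/(1 - |a|²) ≤ ((1/2)/(1 - |a|))²`, so the logarithm of the
        -- base is at least half of the required one.
        have hpow := Real.log_pow (x := 1 / 2 / (1 - ‖a‖)) (n := 2)
        push_cast at hpow
        rw [div_le_iff₀ two_pos, mul_comm, ← hpow]
        apply Real.log_le_log (by positivity)
        rw [div_pow, div_le_div_iff₀ hy2 (by positivity)]
        nlinarith
    _ = ∫⁻ r in Ioo (1 / 2) ‖a‖, ENNReal.ofReal (2⁻¹ * 3 ^ (-(σ + 2)) * (1 - r) ^ (-1 : ℝ)) := by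
        rw [lintegral_Ioo_one_sub
          (G := fun x => ENNReal.ofReal (2⁻¹ * 3 ^ (-(σ + 2)) * x ^ (-1 : ℝ)))]
        simp_rw [ENNReal.ofReal_mul (show (0 : ℝ) ≤ 2⁻¹ * 3 ^ (-(σ + 2)) by positivity)]
        rw [lintegral_const_mul' _ _ ENNReal.ofReal_ne_top, show (1 : ℝ) - 1 / 2 = 1 / 2 by norm_num,
          lintegral_Ioo_inv hy (by linarith)]
    _ ≤ _ := setLIntegral_mono' measurableSet_Ioo step
    _ ≤ _ := lintegral_mono_set (Ioo_subset_Ioo (by norm_num) ha.le)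

end ToeplitzBergman

/-! ### Taylor coefficients, radial moments and the reproducing formula -/

namespace ToeplitzBergman
open MeasureTheory Filter Topology ComplexConjugate Set

lemma norm_exp_I (θ : ℝ) : ‖Complex.exp (θ * Complex.I)‖ = 1 := Complex.norm_exp_ofReal_mul_I θ

/-- The Taylor coefficients at the origin. -/
noncomputable def taylorCoeff (f : ℂ → ℂ) (n : ℕ) : ℂ := (n.factorial : ℂ)⁻¹ * iteratedDeriv n f 0

lemma hasSum_taylorCoeff {f : ℂ → ℂ} (hf : DifferentiableOn ℂ f disk) {z : ℂ} (hz : z ∈ disk) :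
    HasSum (fun n => taylorCoeff f n * z ^ n) (f z) := by
  have := Complex.hasSum_taylorSeries_on_ball (c := 0) (r := 1) hf hz
  convert! this using 2 with n
  simp only [taylorCoeff, sub_zero, smul_eq_mul]; ring

lemma integral_exp_int_mul (k : ℤ) : ∫ θ in (0 : ℝ)..2 * Real.pi,
    Complex.exp (k * (θ * Complex.I)) = if k = 0 then 2 * Real.pi else 0 := by
  split_ifs with hk
  · simp [hk]
  · have hc : (k : ℂ) * Complex.I ≠ 0 := by simp [hk]
    have := integral_exp_mul_complex (a := 0) (b := 2 * Real.pi) hc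
    have e : ∀ θ : ℝ, (k : ℂ) * (θ * Complex.I) = k * Complex.I * θ := fun θ => by ring
    simp only [e]
    rw [this]
    have h1 : Complex.exp (k * Complex.I * (2 * Real.pi : ℝ)) = 1 := by
      rw [Complex.exp_eq_one_iff]; exact ⟨k, by push_cast; ring⟩
    rw [h1]; simp

/-- The Fourier coefficients of an analytic function on a circle centered at the origin. -/
lemma integral_circle_mul_exp {f : ℂ → ℂ} (hf : DifferentiableOn ℂ f disk) {z : ℂ} (hz : z ∈ disk)
    (n : ℕ) : ∫ θ in (0 : ℝ)..2 * Real.pi, f (Complex.exp (θ * Complex.I) * z) *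
      Complex.exp (-(n * (θ * Complex.I))) = 2 * Real.pi * (taylorCoeff f n * z ^ n) := by
  have hmem : ∀ θ : ℝ, Complex.exp (θ * Complex.I) * z ∈ disk := fun θ => by
    rw [mem_disk, norm_mul, norm_exp_I, one_mul]; exact mem_disk.1 hz
  set F : ℕ → ℝ → ℂ := fun m θ => taylorCoeff f m * z ^ m *
    Complex.exp (((m : ℤ) - n : ℤ) * (θ * Complex.I)) with hF
  have hsum : ∀ θ : ℝ, HasSum (fun m => F m θ) (f (Complex.exp (θ * Complex.I) * z) *
      Complex.exp (-(n * (θ * Complex.I)))) := fun θ => by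
    convert! (hasSum_taylorCoeff hf (hmem θ)).mul_right _ using 2 with m
    rw [hF, mul_pow, ← Complex.exp_nat_mul]
    push_cast
    rw [sub_mul, sub_eq_add_neg, Complex.exp_add]
    ring
  have hnorm : ∀ m θ, ‖F m θ‖ = ‖taylorCoeff f m * z ^ m‖ := fun m θ => by
    have : (((m : ℤ) - n : ℤ) : ℂ) * (θ * Complex.I) =
        (((m : ℤ) - n : ℤ) * θ : ℝ) * Complex.I := by push_cast; ring
    rw [hF]; simp only
    rw [norm_mul, this, Complex.norm_exp_ofReal_mul_I, mul_one]
  have h := intervalIntegral.hasSum_integral_of_dominated_convergence (μ := volume) (a := 0)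
    (b := 2 * Real.pi) (F := F) (f := fun θ : ℝ => f (Complex.exp (θ * Complex.I) * z) *
      Complex.exp (-(n * (θ * Complex.I))))
    (fun m _ => ‖taylorCoeff f m * z ^ m‖)
    (fun m => by rw [hF]; fun_prop)
    (fun m => Eventually.of_forall fun θ _ => (hnorm m θ).le)
    (Eventually.of_forall fun θ _ => (hasSum_taylorCoeff hf hz).summable.norm)
    (by simp) (Eventually.of_forall fun θ _ => hsum θ)
  refine h.unique ?_
  have e : ∀ m : ℕ, ∫ θ in (0 : ℝ)..2 * Real.pi, F m θ =
      if m = n then 2 * Real.pi * (taylorCoeff f n * z ^ n) else 0 := fun m => by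
    rw [hF]; simp only
    rw [intervalIntegral.integral_const_mul, integral_exp_int_mul]
    by_cases hm : m = n
    · simp [hm]; ring
    · have : (m : ℤ) - n ≠ 0 := by omega
      simp [hm, this]
  simp only [e]
  exact hasSum_ite_eq n _

/-- Moments of an analytic function with respect to a rotation invariant measure on the disk. -/
lemma integral_mul_conj_pow {ν : Measure ℂ} [SFinite ν] (hν : ν diskᶜ = 0)
    (hrot : ∀ u : ℂ, ‖u‖ = 1 → MeasurePreserving (fun z => u * z) ν ν) {f : ℂ → ℂ}
    (hf : DifferentiableOn ℂ f disk) (hi : Integrable f ν) (n : ℕ) :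
    ∫ z, f z * conj z ^ n ∂ν = taylorCoeff f n * ∫ z, ((‖z‖ ^ (2 * n) : ℝ) : ℂ) ∂ν := by
  have hae : ∀ᵐ z ∂ν, z ∈ disk := by rw [ae_iff]; exact hν
  have hc : Continuous fun z : ℂ => conj z := Complex.continuous_conj
  -- The values of `f` off the disk are arbitrary, so it is cut off there to obtain a Borel function
  -- suitable for Fubini.
  set g : ℂ → ℂ := disk.indicator fun z => f z * conj z ^ n with hg
  have hgm : Measurable g := by
    have hfm : Measurable (disk.indicator f) := by
      classical
      rw [← piecewise_eq_indicator]
      exact hf.continuousOn.measurable_piecewise continuousOn_const measurableSet_disk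
    have : g = fun z => disk.indicator f z * conj z ^ n := by
      ext z; rw [hg]; by_cases hz : z ∈ disk <;> simp [hz]
    rw [this]
    fun_prop
  have hgi : Integrable g ν := by
    refine hi.mono hgm.aestronglyMeasurable (hae.mono fun z hz => ?_)
    rw [hg, indicator_of_mem hz, norm_mul, norm_pow, RCLike.norm_conj]
    exact mul_le_of_le_one_right (norm_nonneg _) (pow_le_one₀ (norm_nonneg _) (mem_disk.1 hz).le)
  have hgf : ∫ z, f z * conj z ^ n ∂ν = ∫ z, g z ∂ν :=
    integral_congr_ae (hae.mono fun z hz => by rw [hg, indicator_of_mem hz])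
  -- Average the integral over all rotations, which does not change it, and exchange the integrals:
  -- for fixed `z` the average over the circle is a Fourier coefficient and isolates the `n`-th
  -- Taylor term.
  have hconst : ∀ θ : ℝ, ∫ z, g (Complex.exp (θ * Complex.I) * z) ∂ν = ∫ z, g z ∂ν := fun θ =>
    (hrot _ (norm_exp_I θ)).integral_comp (measurableEmbedding_rotate (norm_exp_I θ)) g
  have hconst' : ∀ θ : ℝ, ∫ z, ‖g (Complex.exp (θ * Complex.I) * z)‖ ∂ν = ∫ z, ‖g z‖ ∂ν := fun θ =>
    (hrot _ (norm_exp_I θ)).integral_comp (measurableEmbedding_rotate (norm_exp_I θ))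
      fun z => ‖g z‖
  have hprod : Integrable (Function.uncurry fun (θ : ℝ) (z : ℂ) =>
      g (Complex.exp (θ * Complex.I) * z)) ((volume.restrict (Ioc 0 (2 * Real.pi))).prod ν) := by
    have hm : Measurable (Function.uncurry fun (θ : ℝ) (z : ℂ) =>
      g (Complex.exp (θ * Complex.I) * z)) := hgm.comp (by fun_prop)
    rw [integrable_prod_iff hm.aestronglyMeasurable]
    refine ⟨Eventually.of_forall fun θ => ?_, ?_⟩
    · exact (hrot _ (norm_exp_I θ)).integrable_comp_of_integrable hgi
    · simp only [Function.uncurry, hconst']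
      exact integrable_const _
  have hswap := integral_integral_swap hprod
  have hleft : ∫ θ in Ioc 0 (2 * Real.pi), ∫ z, g (Complex.exp (θ * Complex.I) * z) ∂ν =
      2 * Real.pi * ∫ z, g z ∂ν := by
    simp only [hconst]
    rw [integral_const]
    simp [Real.pi_pos.le]
  have hright : ∫ z, (∫ θ in Ioc 0 (2 * Real.pi), g (Complex.exp (θ * Complex.I) * z)) ∂ν =
      ∫ z, (2 * Real.pi * taylorCoeff f n) * ((‖z‖ ^ (2 * n) : ℝ) : ℂ) ∂ν := by
    refine integral_congr_ae (hae.mono fun z hz => ?_)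
    simp only
    rw [← intervalIntegral.integral_of_le (by positivity)]
    have e : ∀ θ : ℝ, g (Complex.exp (θ * Complex.I) * z) = conj z ^ n *
        (f (Complex.exp (θ * Complex.I) * z) * Complex.exp (-(n * (θ * Complex.I)))) := fun θ => by
      have hmem : Complex.exp (θ * Complex.I) * z ∈ disk := by
        rw [mem_disk, norm_mul, norm_exp_I, one_mul]; exact mem_disk.1 hz
      have hce : conj (Complex.exp (θ * Complex.I)) = Complex.exp (-(θ * Complex.I)) := by
        rw [← Complex.exp_conj]; simp
      rw [hg, indicator_of_mem hmem, map_mul, mul_pow, hce, ← Complex.exp_nat_mul]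
      rw [mul_neg]; ring
    simp only [e]
    rw [intervalIntegral.integral_const_mul, integral_circle_mul_exp hf hz,
      show ((‖z‖ ^ (2 * n) : ℝ) : ℂ) = (z * conj z) ^ n by
        rw [Complex.mul_conj, Complex.normSq_eq_norm_sq, pow_mul]; push_cast; rfl, mul_pow]
    ring
  rw [hleft, hright, integral_const_mul, ← hgf] at hswap
  have hpi : (2 * Real.pi : ℂ) ≠ 0 := by simp [Real.pi_ne_zero]
  exact mul_left_cancel₀ hpi (by rw [hswap]; ring)

lemma measure_weightedArea_compl (σ : ℝ) : weightedArea σ diskᶜ = 0 := by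
  rw [weightedArea_eq]
  exact withDensity_absolutelyContinuous _ _ (by simp [Measure.restrict_apply isOpen_disk.measurableSet.compl])

lemma measurePreserving_rotate_weightedArea (σ : ℝ) {u : ℂ} (hu : ‖u‖ = 1) :
    MeasurePreserving (fun z => u * z) (weightedArea σ) (weightedArea σ) := by
  refine ⟨by fun_prop, ?_⟩
  ext s hs
  rw [Measure.map_apply (by fun_prop) hs, ← lintegral_indicator_one hs,
    ← lintegral_indicator_one (hs.preimage (by fun_prop)), lintegral_weightedArea,
    lintegral_weightedArea, ← lintegral_disk_rotate hu fun z => _ * s.indicator 1 z]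
  refine lintegral_congr fun z => ?_
  have : weight σ (u * z) = weight σ z := by simp [weight, hu]
  rw [this]
  rfl

/-- `∫_0^1 r^(2n+1) (1-r²)^η dr`. -/
noncomputable def radialMoment (η : ℝ) (n : ℕ) : ℝ :=
  ∫ r in (0 : ℝ)..1, r ^ (2 * n + 1) * (1 - r ^ 2) ^ η

/-- For `η < 0` the integrand is unbounded at 1. It is integrable for `n = 0` as the nonnegative
derivative of a continuous function, and the factor `r^(2n)` is harmless. -/
lemma intervalIntegrable_radialMoment {η : ℝ} (hη : -1 < η) (n : ℕ) :
    IntervalIntegrable (fun r : ℝ => r ^ (2 * n + 1) * (1 - r ^ 2) ^ η) volume 0 1 := by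
  have hcont : Continuous fun r : ℝ => -((1 - r ^ 2) ^ (η + 1) / (2 * (η + 1))) := by
    have : Continuous fun r : ℝ => (1 - r ^ 2) ^ (η + 1) :=
      (by fun_prop : Continuous fun r : ℝ => 1 - r ^ 2).rpow_const fun _ => Or.inr (by linarith)
    fun_prop
  have h0 : IntervalIntegrable (fun r : ℝ => r * (1 - r ^ 2) ^ η) volume 0 1 := by
    rw [intervalIntegrable_iff_integrableOn_Ioc_of_le zero_le_one]
    refine intervalIntegral.integrableOn_deriv_of_nonneg (hcont.continuousOn)
      (fun r hr => ?_) (fun r hr => ?_)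
    · have hp : 1 - r ^ 2 ≠ 0 := by nlinarith [hr.1, hr.2]
      have h1 : HasDerivAt (fun r : ℝ => 1 - r ^ 2) (-(2 * r)) r := by
        simpa using (hasDerivAt_pow 2 r).const_sub 1
      have h2 := ((h1.rpow_const (p := η + 1) (Or.inl hp)).div_const (2 * (η + 1))).neg
      convert! h2 using 1
      rw [add_sub_cancel_right]
      have : η + 1 ≠ 0 := by linarith
      field_simp
    · have : 0 ≤ 1 - r ^ 2 := by nlinarith [hr.1, hr.2]
      exact mul_nonneg hr.1.le (Real.rpow_nonneg this _)
  have h2 := h0.continuousOn_mul (f := fun r : ℝ => r * (1 - r ^ 2) ^ η)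
    (g := fun r : ℝ => r ^ (2 * n)) (by fun_prop)
  convert! h2 using 2 with r
  ring

lemma radialMoment_zero {η : ℝ} (hη : -1 < η) : radialMoment η 0 = 1 / (2 * (η + 1)) := by
  have hcont : Continuous fun r : ℝ => -((1 - r ^ 2) ^ (η + 1) / (2 * (η + 1))) := by
    have : Continuous fun r : ℝ => (1 - r ^ 2) ^ (η + 1) :=
      (by fun_prop : Continuous fun r : ℝ => 1 - r ^ 2).rpow_const fun _ => Or.inr (by linarith)
    fun_prop
  have := intervalIntegral.integral_eq_sub_of_hasDerivAt_of_le zero_le_one hcont.continuousOn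
    (f' := fun r => r ^ (2 * 0 + 1) * (1 - r ^ 2) ^ η) (fun r hr => ?_)
    (intervalIntegrable_radialMoment hη 0)
  · rw [radialMoment, this]
    have : η + 1 ≠ 0 := by linarith
    simp [Real.zero_rpow this]
  · have hp : 1 - r ^ 2 ≠ 0 := by nlinarith [hr.1, hr.2]
    have h1 : HasDerivAt (fun r : ℝ => 1 - r ^ 2) (-(2 * r)) r := by
      simpa using (hasDerivAt_pow 2 r).const_sub 1
    have h2 := ((h1.rpow_const (p := η + 1) (Or.inl hp)).div_const (2 * (η + 1))).neg
    convert! h2 using 1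
    rw [add_sub_cancel_right]
    have : η + 1 ≠ 0 := by linarith
    field_simp
    simp

/-- Integrate the derivative of `r^(2n+2) (1 - r²)^(η+1)`, a function that vanishes at both
endpoints. -/
lemma radialMoment_succ {η : ℝ} (hη : -1 < η) (n : ℕ) :
    (n + (η + 2)) * radialMoment η (n + 1) = (n + 1) * radialMoment η n := by
  have hcont : Continuous fun r : ℝ => r ^ (2 * n + 2) * (1 - r ^ 2) ^ (η + 1) := by
    have : Continuous fun r : ℝ => (1 - r ^ 2) ^ (η + 1) :=
      (by fun_prop : Continuous fun r : ℝ => 1 - r ^ 2).rpow_const fun _ => Or.inr (by linarith)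
    fun_prop
  have hA := (intervalIntegrable_radialMoment hη n).const_mul (2 * (n + 1) : ℝ)
  have hB := (intervalIntegrable_radialMoment hη (n + 1)).const_mul (2 * (n + (η + 2)))
  have := intervalIntegral.integral_eq_sub_of_hasDerivAt_of_le zero_le_one hcont.continuousOn
    (f' := fun r => 2 * (n + 1) * (r ^ (2 * n + 1) * (1 - r ^ 2) ^ η) -
      2 * (n + (η + 2)) * (r ^ (2 * (n + 1) + 1) * (1 - r ^ 2) ^ η)) (fun r hr => ?_) (hA.sub hB)
  · rw [intervalIntegral.integral_sub hA hB, intervalIntegral.integral_const_mul,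
      intervalIntegral.integral_const_mul] at this
    have h0 : η + 1 ≠ 0 := by linarith
    simp only [one_pow, sub_self, Real.zero_rpow h0, mul_zero, ne_eq, Nat.add_eq_zero_iff,
      OfNat.ofNat_ne_zero, and_false, not_false_eq_true, zero_pow, zero_mul] at this
    change 2 * (n + 1) * radialMoment η n - 2 * (n + (η + 2)) * radialMoment η (n + 1) = 0 at this
    linarith
  · have hp : 0 < 1 - r ^ 2 := by nlinarith [hr.1, hr.2]
    have h1 : HasDerivAt (fun r : ℝ => 1 - r ^ 2) (-(2 * r)) r := by
      simpa using (hasDerivAt_pow 2 r).const_sub 1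
    have h2 := (hasDerivAt_pow (2 * n + 2) r).mul (h1.rpow_const (p := η + 1) (Or.inl hp.ne'))
    convert! h2 using 1
    rw [add_sub_cancel_right, Real.rpow_add_one hp.ne']
    push_cast
    ring

lemma integral_norm_pow_weightedArea (η : ℝ) (hη : -1 < η) (n : ℕ) :
    ∫ z, ‖z‖ ^ (2 * n) ∂weightedArea η = 2 * (η + 1) * radialMoment η n := by
  rw [weightedArea_eq, integral_withDensity_eq_integral_toReal_smul
    (by unfold weight; fun_prop) (by simp), ← integral_indicator measurableSet_disk]
  have e : (disk.indicator fun z : ℂ =>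
      (ENNReal.ofReal (Real.pi⁻¹ * weight η z)).toReal • ‖z‖ ^ (2 * n)) = fun z : ℂ =>
      (fun r : ℝ => (Iio (1 : ℝ)).indicator
        (fun r => Real.pi⁻¹ * ((1 + η) * (1 - r ^ 2) ^ η) * r ^ (2 * n)) r) ‖z‖ := by
    ext z
    by_cases hz : z ∈ disk
    · have hz' := mem_disk.1 hz
      have hw : 0 ≤ Real.pi⁻¹ * weight η z := by
        unfold weight
        have : 0 ≤ (1 - ‖z‖ ^ 2) := by nlinarith [norm_nonneg z]
        have : 0 ≤ 1 + η := by linarith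
        positivity
      simp only
      rw [indicator_of_mem hz, indicator_of_mem (mem_Iio.2 hz'), ENNReal.toReal_ofReal hw,
        weight, smul_eq_mul]
    · have hz' := mt mem_disk.2 hz
      simp only
      rw [indicator_of_notMem hz, indicator_of_notMem (by simpa using hz')]
  rw [e, integral_fun_norm_addHaar, Complex.finrank_real_complex]
  have hb : (volume : Measure ℂ).real (Metric.ball 0 1) = Real.pi := by
    simp [Measure.real, Complex.volume_ball]
  rw [hb, radialMoment, intervalIntegral.integral_of_le zero_le_one, integral_Ioc_eq_integral_Ioo,
    ← integral_const_mul, ← integral_indicator measurableSet_Ioo,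
    ← integral_indicator measurableSet_Ioi, nsmul_eq_mul, smul_eq_mul, ← integral_const_mul,
    ← integral_const_mul]
  congr 1
  ext r
  by_cases h0 : 0 < r
  · by_cases h1 : r < 1
    · simp [indicator, h0, h1]
      have := Real.pi_pos
      field_simp
      ring
    · simp [indicator, h0, h1]
  · simp [indicator, h0]

/-- The Taylor coefficients of `x ↦ (1 - x)^(-b)`. -/
noncomputable def kernelCoeff (b : ℝ) (n : ℕ) : ℂ := Ring.choose ((b : ℂ) + n - 1) n

lemma kernelCoeff_zero (b : ℝ) : kernelCoeff b 0 = 1 := by simp [kernelCoeff]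

lemma kernelCoeff_succ (b : ℝ) (n : ℕ) :
    (n + 1) * kernelCoeff b (n + 1) = (b + n) * kernelCoeff b n := by
  simp only [kernelCoeff, ← Ring.multichoose_eq]
  have h1 := Ring.factorial_nsmul_multichoose_eq_ascPochhammer (b : ℂ) n
  have h2 := Ring.factorial_nsmul_multichoose_eq_ascPochhammer (b : ℂ) (n + 1)
  rw [Polynomial.ascPochhammer_smeval_eq_eval] at h1 h2
  rw [ascPochhammer_succ_eval, ← h1, Nat.factorial_succ] at h2
  simp only [nsmul_eq_mul] at h2
  push_cast at h2
  have : (n.factorial : ℂ) ≠ 0 := by exact_mod_cast n.factorial_ne_zero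
  apply mul_left_cancel₀ this
  linear_combination h2

lemma hasSum_kernelCoeff (b : ℝ) {x : ℂ} (hx : ‖x‖ < 1) :
    HasSum (fun n => kernelCoeff b n * x ^ n) ((1 - x) ^ (-(b : ℂ))) := by
  have h := (Complex.one_div_one_sub_cpow_hasFPowerSeriesOnBall_zero (b : ℂ)).hasSum
    (y := x) (by simpa [Metric.mem_eball, edist_zero_right, ← ofReal_norm] using hx)
  simp only [zero_add, one_div, ← Complex.cpow_neg] at h
  convert! h using 2 with n
  simp [kernelCoeff, FormalMultilinearSeries.ofScalars]

/-- The kernel coefficients and the moments obey reciprocal recurrences and agree at `n = 0`. This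
is why the kernel of exponent `η + 2`, with no further constant, reproduces against the normalized
weight. -/
lemma kernelCoeff_mul_moment (η : ℝ) (hη : -1 < η) (n : ℕ) :
    kernelCoeff (η + 2) n * ((2 * (η + 1) * radialMoment η n : ℝ) : ℂ) = 1 := by
  induction n with
  | zero =>
    have : η + 1 ≠ 0 := by linarith
    rw [kernelCoeff_zero, radialMoment_zero hη, one_mul]
    rw [mul_one_div_cancel (by simpa using this)]; simp
  | succ n ih =>
    have h1 := kernelCoeff_succ (η + 2) n
    have h2 : ((n : ℂ) + (η + 2)) * (radialMoment η (n + 1) : ℂ) =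
        (n + 1) * (radialMoment η n : ℂ) := by exact_mod_cast radialMoment_succ hη n
    have h3 : (n : ℂ) + (η + 2) ≠ 0 := by
      have : (n : ℝ) + (η + 2) ≠ 0 := by
        have := n.cast_nonneg (α := ℝ)
        linarith
      exact_mod_cast this
    have h4 : (n : ℂ) + 1 ≠ 0 := by exact_mod_cast n.succ_ne_zero
    push_cast at h1 ih ⊢
    apply mul_left_cancel₀ h3
    apply mul_left_cancel₀ h4
    linear_combination (2 * ((η : ℂ) + 1) * ((n : ℂ) + (η + 2)) * radialMoment η (n + 1)) * h1 + (2 * (η + 1) * (η + 2 + n) * kernelCoeff (η + 2) n) * h2 + (n + 1) * (n + (η + 2)) * ih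

/-- **Reproducing formula** of the weighted Bergman space. -/
theorem integral_mul_kernel {η : ℝ} (hη : -1 < η) {f : ℂ → ℂ} (hf : DifferentiableOn ℂ f disk)
    (hi : Integrable f (weightedArea η)) {w : ℂ} (hw : w ∈ disk) :
    ∫ z, f z * kernel (η + 2) w z ∂weightedArea η = f w := by
  have : SFinite (weightedArea η) := by rw [weightedArea_eq]; infer_instance
  have hae : ∀ᵐ z ∂weightedArea η, z ∈ disk := by rw [ae_iff]; exact measure_weightedArea_compl η
  have hc : Continuous fun z : ℂ => conj z := Complex.continuous_conj
  -- Expand the kernel in powers of `w z̄`. For fixed `w` the series converges absolutely and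
  -- uniformly in `z`, so it may be integrated term by term, and each term gives back one Taylor
  -- term of `f` at `w`.
  set F : ℕ → ℂ → ℂ := fun n z => kernelCoeff (η + 2) n * w ^ n * (f z * conj z ^ n) with hF
  have hw' := mem_disk.1 hw
  have hbd : ∀ n, ∀ᵐ z ∂weightedArea η, ‖F n z‖ ≤ ‖kernelCoeff (η + 2) n * w ^ n‖ * ‖f z‖ := fun n =>
    hae.mono fun z hz => by
      rw [hF]; simp only
      rw [norm_mul, norm_mul (f z), norm_pow, RCLike.norm_conj]
      gcongr
      exact mul_le_of_le_one_right (norm_nonneg _)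
        (pow_le_one₀ (norm_nonneg _) (mem_disk.1 hz).le)
  have hFi : ∀ n, Integrable (F n) (weightedArea η) := fun n =>
    (hi.norm.const_mul _).mono' ((hi.aestronglyMeasurable.mul (by fun_prop)).const_mul _) (hbd n)
  have hsummable : Summable fun n => ‖kernelCoeff (η + 2) n * w ^ n‖ :=
    (hasSum_kernelCoeff (η + 2) hw').summable.norm
  have hS : Summable fun n => ∫ z, ‖F n z‖ ∂weightedArea η := by
    refine Summable.of_nonneg_of_le (fun n => integral_nonneg fun _ => norm_nonneg _) (fun n => ?_)
      (hsummable.mul_right (∫ z, ‖f z‖ ∂weightedArea η))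
    rw [← integral_const_mul]
    exact integral_mono_ae (hFi n).norm (hi.norm.const_mul _) (hbd n)
  have h := hasSum_integral_of_summable_integral_norm hFi hS
  have hmom : ∀ n, ∫ z, F n z ∂weightedArea η = taylorCoeff f n * w ^ n := fun n => by
    rw [hF]; simp only
    rw [integral_const_mul, integral_mul_conj_pow (measure_weightedArea_compl η)
      (fun u hu => measurePreserving_rotate_weightedArea η hu) hf hi, integral_complex_ofReal,
      integral_norm_pow_weightedArea η hη]
    linear_combination (taylorCoeff f n * w ^ n) * kernelCoeff_mul_moment η hη n
  simp only [hmom] at h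
  rw [← h.unique (hasSum_taylorCoeff hf hw)]
  refine integral_congr_ae (hae.mono fun z hz => ?_)
  have hx : ‖w * conj z‖ < 1 := norm_mul_conj_lt_one hw' (mem_disk.1 hz).le
  have hs := ((hasSum_kernelCoeff (η + 2) hx).mul_left (f z)).tsum_eq
  simp only
  rw [kernel, ← hs]
  refine tsum_congr fun n => ?_
  rw [hF, mul_pow]; ring

end ToeplitzBergman

/-! ### Mean value inequalities, pointwise growth and the embedding into `L^1` -/

namespace ToeplitzBergman
open MeasureTheory Filter Topology ComplexConjugate Set

lemma aemeasurable_of_differentiableOn {f : ℂ → ℂ} (hf : DifferentiableOn ℂ f disk) {ν : Measure ℂ}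
    (hν : ν diskᶜ = 0) : AEStronglyMeasurable f ν := by
  have h := (hf.continuousOn.aestronglyMeasurable (μ := ν) measurableSet_disk)
  rwa [Measure.restrict_eq_self_of_ae_mem (by rw [ae_iff]; exact hν)] at h

/-- The area mean value inequality at the center of the disk. -/
lemma pi_mul_enorm_le_lintegral_disk {f : ℂ → ℂ} (hf : DifferentiableOn ℂ f disk) :
    ENNReal.ofReal Real.pi * ‖f 0‖ₑ ≤ ∫⁻ z in disk, ‖f z‖ₑ := by
  have hν : (volume.restrict disk) diskᶜ = 0 := by
    simp [Measure.restrict_apply measurableSet_disk.compl]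
  by_cases hfin : ∫⁻ z in disk, ‖f z‖ₑ = ⊤
  · rw [hfin]; exact le_top
  have hi : Integrable f (volume.restrict disk) :=
    ⟨aemeasurable_of_differentiableOn hf hν, Ne.lt_top hfin⟩
  have h := integral_mul_conj_pow hν (fun u hu => measurePreserving_rotate hu) hf hi 0
  have hv : (volume : Measure ℂ).real disk = Real.pi := by
    simp [disk, Measure.real, Complex.volume_ball]
  simp only [pow_zero, mul_one, mul_zero, Complex.ofReal_one, integral_const,
    MeasurableSet.univ, measureReal_restrict_apply, univ_inter, hv, taylorCoeff,
    Nat.factorial_zero, Nat.cast_one, inv_one, iteratedDeriv_zero, one_mul] at h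
  have e : ENNReal.ofReal Real.pi * ‖f 0‖ₑ = ‖∫ z in disk, f z‖ₑ := by
    rw [h, enorm_mul, mul_comm]
    congr 1
    rw [← ofReal_norm]; simp [abs_of_pos Real.pi_pos]
  rw [e]
  exact enorm_integral_le_lintegral_enorm _

lemma lintegral_ball_eq {c : ℂ} {d : ℝ} (hd : 0 < d) (F : ℂ → ENNReal) :
    ∫⁻ z in Metric.ball c d, F z = ENNReal.ofReal (d ^ 2) * ∫⁻ z in disk, F (c + d * z) := by
  have h1 : MeasurableEmbedding fun z : ℂ => (d : ℝ) • z :=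
    measurableEmbedding_const_smul₀ hd.ne'
  have h2 := Measure.map_addHaar_smul (volume : Measure ℂ) hd.ne'
  have h3 : ∫⁻ z in Metric.ball c d, F z = ∫⁻ z in Metric.ball 0 d, F (c + z) := by
    have := (measurePreserving_add_left (volume : Measure ℂ) c).setLIntegral_comp_preimage_emb
      (measurableEmbedding_addLeft c) F (Metric.ball c d)
    rw [← this]
    congr 2
    ext z; simp
  have h4 : ∫⁻ z in disk, F (c + d * z) =
      ENNReal.ofReal ((d ^ 2)⁻¹) * ∫⁻ z in Metric.ball 0 d, F (c + z) := by
    rw [← lintegral_indicator measurableSet_disk, ← lintegral_indicator measurableSet_ball]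
    have h5 := h1.lintegral_map (μ := volume) ((Metric.ball 0 d).indicator fun z => F (c + z))
    rw [h2, lintegral_smul_measure, Complex.finrank_real_complex, abs_of_pos (by positivity)] at h5
    rw [smul_eq_mul] at h5
    rw [h5]
    refine lintegral_congr fun z => ?_
    by_cases hz : z ∈ disk
    · have hz' : d • z ∈ Metric.ball (0 : ℂ) d := by
        rw [mem_ball_zero_iff, norm_smul, Real.norm_of_nonneg hd.le]
        nlinarith [mem_disk.1 hz]
      rw [indicator_of_mem hz, indicator_of_mem hz', Complex.real_smul]
    · have hz' : d • z ∉ Metric.ball (0 : ℂ) d := by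
        rw [mem_ball_zero_iff, norm_smul, Real.norm_of_nonneg hd.le]
        rw [mem_disk] at hz
        nlinarith
      rw [indicator_of_notMem hz, indicator_of_notMem hz']
  rw [h3, h4, ← mul_assoc, ← ENNReal.ofReal_mul (by positivity), mul_inv_cancel₀ (by positivity),
    ENNReal.ofReal_one, one_mul]

lemma differentiableOn_comp_affine {f : ℂ → ℂ} {c : ℂ} {d : ℝ} (hd : 0 < d)
    (hf : DifferentiableOn ℂ f (Metric.ball c d)) :
    DifferentiableOn ℂ (fun z => f (c + d * z)) disk := by
  refine hf.comp (by fun_prop) fun z hz => ?_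
  rw [mem_ball_iff_norm, add_sub_cancel_left, norm_mul, Complex.norm_real,
    Real.norm_of_nonneg hd.le]
  nlinarith [mem_disk.1 hz]

lemma mul_enorm_le_lintegral_ball {f : ℂ → ℂ} {c : ℂ} {d : ℝ} (hd : 0 < d)
    (hf : DifferentiableOn ℂ f (Metric.ball c d)) :
    ENNReal.ofReal (Real.pi * d ^ 2) * ‖f c‖ₑ ≤ ∫⁻ z in Metric.ball c d, ‖f z‖ₑ := by
  rw [lintegral_ball_eq hd, mul_comm Real.pi, ENNReal.ofReal_mul (by positivity), mul_assoc]
  gcongr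
  simpa using pi_mul_enorm_le_lintegral_disk (differentiableOn_comp_affine hd hf)

/-- The area sub-mean value inequality for `|f|^p`, `0 < p ≤ 1`, at the center of the disk. -/
lemma exists_enorm_rpow_le_lintegral_disk {p : ℝ} (hp : 0 < p) (hp1 : p ≤ 1) : ∃ C : NNReal,
    ∀ f : ℂ → ℂ, DifferentiableOn ℂ f disk →
      ‖f 0‖ₑ ^ p ≤ C * ∫⁻ z in disk, ‖f z‖ₑ ^ p := by
  set K : ℝ := 2 ^ (2 / p) with hK
  have hK0 : 0 < K := by positivity
  have hpi := Real.pi_pos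
  refine ⟨(16 / Real.pi * K ^ (1 - p)).toNNReal, fun f hf => ?_⟩
  rw [ENNReal.ofNNReal_toNNReal]
  by_cases hfin : ∫⁻ z in disk, ‖f z‖ₑ ^ p = ⊤
  · rw [hfin, ENNReal.mul_top]
    · exact le_top
    · rw [ne_eq, ENNReal.ofReal_eq_zero, not_le]; positivity
  set J := (∫⁻ z in disk, ‖f z‖ₑ ^ p).toReal with hJ
  have hJ' : ∫⁻ z in disk, ‖f z‖ₑ ^ p = ENNReal.ofReal J := (ENNReal.ofReal_toReal hfin).symm
  have hsub : Metric.closedBall (0 : ℂ) (1 / 2) ⊆ disk := fun z hz => by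
    rw [mem_disk]; rw [mem_closedBall_zero_iff] at hz; linarith
  have hcont : ContinuousOn (fun z : ℂ => (1 / 2 - ‖z‖) ^ (2 / p) * ‖f z‖)
      (Metric.closedBall 0 (1 / 2)) := by
    refine ContinuousOn.mul ?_ (hf.continuousOn.mono hsub).norm
    exact ((by fun_prop : Continuous fun z : ℂ => 1 / 2 - ‖z‖).rpow_const
      fun _ => Or.inr (by positivity)).continuousOn
  -- Subharmonicity of `|f|^p` is replaced by a maximum argument. The `p`-th power of the weight is
  -- the squared distance to the circle of radius 1/2, matching the area factor in the mean value
  -- inequality.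
  obtain ⟨z₀, hz₀, hmax⟩ := (isCompact_closedBall (0 : ℂ) (1 / 2)).exists_isMaxOn
    ⟨0, by simp⟩ hcont
  have hmax' : ∀ z : ℂ, ‖z‖ ≤ 1 / 2 → (1 / 2 - ‖z‖) ^ (2 / p) * ‖f z‖ ≤
    (1 / 2 - ‖z₀‖) ^ (2 / p) * ‖f z₀‖ := fun z hz => hmax (by simpa using hz)
  rw [mem_closedBall_zero_iff] at hz₀
  have h0 := hmax' 0 (by simp)
  rw [norm_zero, sub_zero] at h0
  set d := 1 / 2 - ‖z₀‖ with hd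
  have hd0 : 0 ≤ d := by linarith
  set M := ‖f z₀‖
  have hpow2 : ∀ x : ℝ, 0 ≤ x → (x ^ (2 / p)) ^ p = x ^ 2 := fun x hx => by
    rw [← Real.rpow_mul hx, div_mul_cancel₀ _ hp.ne']; norm_num
  have h1 : (1 / 4) * ‖f 0‖ ^ p ≤ d ^ 2 * M ^ p := by
    have := Real.rpow_le_rpow (by positivity) h0 hp.le
    rw [Real.mul_rpow (by positivity) (norm_nonneg _), Real.mul_rpow (by positivity)
      (norm_nonneg _), hpow2 _ (by norm_num), hpow2 _ hd0] at this
    linarith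
  have h2 : d ^ 2 * M ^ p ≤ 4 / Real.pi * K ^ (1 - p) * J := by
    rcases hd0.eq_or_lt with hd00 | hd1
    · rw [← hd00]; simp; positivity
    rcases (norm_nonneg (f z₀)).eq_or_lt with hM0 | hM0
    · have : M = 0 := hM0.symm
      rw [this, Real.zero_rpow hp.ne', mul_zero]; positivity
    have hM : 0 < M := hM0
    have hball : ∀ z ∈ Metric.ball z₀ (d / 2), ‖z‖ < 1 / 2 - d / 2 := fun z hz => by
      rw [mem_ball_iff_norm] at hz
      have := norm_sub_norm_le z z₀
      linarith
    have hsub2 : Metric.ball z₀ (d / 2) ⊆ disk := fun z hz => by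
      rw [mem_disk]; linarith [hball z hz]
    -- On this disc the distance factor drops at most by one half, so maximality at `z₀` costs only
    -- `K = 2^(2/p)`.
    have hbd : ∀ z ∈ Metric.ball z₀ (d / 2), ‖f z‖ ≤ K * M := fun z hz => by
      have hz1 := hball z hz
      have := hmax' z (by linarith)
      have hle : (d / 2) ^ (2 / p) ≤ (1 / 2 - ‖z‖) ^ (2 / p) :=
        Real.rpow_le_rpow (by positivity) (by linarith) (by positivity)
      have h3 : (d / 2) ^ (2 / p) * ‖f z‖ ≤ d ^ (2 / p) * M :=
        (mul_le_mul_of_nonneg_right hle (norm_nonneg _)).trans this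
      rw [Real.div_rpow hd0 (by norm_num), div_mul_eq_mul_div, div_le_iff₀ hK0] at h3
      have hdp : 0 < d ^ (2 / p) := by positivity
      refine le_of_mul_le_mul_left ?_ hdp
      linarith
    have hmv := mul_enorm_le_lintegral_ball (half_pos hd1) (hf.mono hsub2)
    -- Write `|f| = |f|^(1-p) |f|^p` and bound the first factor by `(K M)^(1-p)`; dividing the mean
    -- value inequality by `M^(1-p)` then leaves `M^p`.
    have hint : ∫⁻ z in Metric.ball z₀ (d / 2), ‖f z‖ₑ ≤
        ENNReal.ofReal ((K * M) ^ (1 - p)) * ENNReal.ofReal J := by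
      rw [← hJ']
      calc _ ≤ ∫⁻ z in Metric.ball z₀ (d / 2),
            ENNReal.ofReal ((K * M) ^ (1 - p)) * ‖f z‖ₑ ^ p := by
            refine setLIntegral_mono' measurableSet_ball fun z hz => ?_
            have e : ‖f z‖ₑ = ‖f z‖ₑ ^ (1 - p) * ‖f z‖ₑ ^ p := by
              rw [← ENNReal.rpow_add_of_nonneg _ _ (by linarith) hp.le]; simp
            conv_lhs => rw [e]
            gcongr
            rw [← ENNReal.ofReal_rpow_of_nonneg (by positivity) (by linarith)]
            refine ENNReal.rpow_le_rpow ?_ (by linarith)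
            rw [← ofReal_norm]
            exact ENNReal.ofReal_le_ofReal (hbd z hz)
        _ = ENNReal.ofReal ((K * M) ^ (1 - p)) * ∫⁻ z in Metric.ball z₀ (d / 2), ‖f z‖ₑ ^ p :=
            lintegral_const_mul' _ _ (by simp)
        _ ≤ _ := by gcongr
    have hfin2 := hmv.trans hint
    rw [← ofReal_norm, ← ENNReal.ofReal_mul (by positivity), ← ENNReal.ofReal_mul (by positivity),
      ENNReal.ofReal_le_ofReal_iff (by positivity), Real.mul_rpow hK0.le hM.le] at hfin2
    have hMp : M = M ^ (1 - p) * M ^ p := by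
      rw [← Real.rpow_add hM]; simp
    have hM1 : 0 < M ^ (1 - p) := by positivity
    refine le_of_mul_le_mul_left ?_ hM1
    have : M ^ (1 - p) * (d ^ 2 * M ^ p) = d ^ 2 * M := by
      conv_rhs => rw [hMp]
      ring
    rw [this]
    have h5 : Real.pi * (d / 2) ^ 2 * M ≤ K ^ (1 - p) * M ^ (1 - p) * J := hfin2
    calc d ^ 2 * M = 4 / Real.pi * (Real.pi * (d / 2) ^ 2 * M) := by field_simp; ring
      _ ≤ 4 / Real.pi * (K ^ (1 - p) * M ^ (1 - p) * J) := by gcongr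
      _ = _ := by ring
  rw [hJ', ← ENNReal.ofReal_mul (by positivity), ← ofReal_norm,
    ENNReal.ofReal_rpow_of_nonneg (norm_nonneg _) hp.le]
  apply ENNReal.ofReal_le_ofReal
  calc _ ≤ 4 * (d ^ 2 * M ^ p) := by linarith
    _ ≤ 4 * (4 / Real.pi * K ^ (1 - p) * J) := by gcongr
    _ = _ := by ring

lemma exists_enorm_rpow_le_lintegral_ball {p : ℝ} (hp : 0 < p) (hp1 : p ≤ 1) : ∃ C : NNReal,
    ∀ (f : ℂ → ℂ) (c : ℂ) (d : ℝ), 0 < d → DifferentiableOn ℂ f (Metric.ball c d) →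
      ENNReal.ofReal (d ^ 2) * ‖f c‖ₑ ^ p ≤ C * ∫⁻ z in Metric.ball c d, ‖f z‖ₑ ^ p := by
  obtain ⟨C, hC⟩ := exists_enorm_rpow_le_lintegral_disk hp hp1
  refine ⟨C, fun f c d hd hf => ?_⟩
  rw [lintegral_ball_eq hd, mul_left_comm]
  gcongr
  simpa using hC _ (differentiableOn_comp_affine hd hf)

lemma bergmanNorm_rpow {p : ℝ} (hp : 0 < p) (α : ℝ) (f : ℂ → ℂ) :
    bergmanNorm p α f ^ p = ∫⁻ z, ‖f z‖ₑ ^ p ∂weightedArea α := by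
  rw [bergmanNorm, eLpNorm_eq_lintegral_rpow_enorm_toReal (by simpa using hp) (by simp),
    ENNReal.toReal_ofReal hp.le, ← ENNReal.rpow_mul, one_div, inv_mul_cancel₀ hp.ne',
    ENNReal.rpow_one]

lemma bergmanNorm_one (α : ℝ) (f : ℂ → ℂ) :
    bergmanNorm 1 α f = ∫⁻ z, ‖f z‖ₑ ∂weightedArea α := by
  rw [bergmanNorm, ENNReal.ofReal_one, eLpNorm_one_eq_lintegral_enorm]

/-- Pointwise growth of functions in the Bergman space. -/
lemma exists_enorm_mul_le_bergmanNorm {p α : ℝ} (hp : 0 < p) (hp1 : p ≤ 1) (hα : -1 < α) :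
    ∃ C : NNReal, ∀ f : ℂ → ℂ, DifferentiableOn ℂ f disk → ∀ z ∈ disk,
      ‖f z‖ₑ * ENNReal.ofReal ((1 - ‖z‖) ^ ((2 + α) / p)) ≤ C * bergmanNorm p α f := by
  obtain ⟨C₁, h₁⟩ := exists_enorm_rpow_le_lintegral_ball hp hp1
  obtain ⟨C₂, hC₂, -, h₂⟩ := exists_weightedArea_le α hα
  set D : ENNReal := C₁ * ENNReal.ofReal (4 * 2 ^ |α|) * ENNReal.ofReal C₂ with hD
  have hDtop : D ^ (1 / p) ≠ ⊤ := by
    apply ENNReal.rpow_ne_top_of_nonneg (by positivity)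
    simp [hD, ENNReal.mul_eq_top]
  refine ⟨(D ^ (1 / p)).toNNReal, fun f hf z hz => ?_⟩
  rw [ENNReal.coe_toNNReal hDtop]
  rw [mem_disk] at hz
  have h1z : 0 < 1 - ‖z‖ := by linarith
  set d := (1 - ‖z‖) / 2 with hd
  have hd0 : 0 < d := by positivity
  have hball : ∀ w ∈ Metric.ball z d, ‖w‖ < 1 ∧ 1 - ‖w‖ ≤ 2 * (1 - ‖z‖) ∧
      1 - ‖z‖ ≤ 2 * (1 - ‖w‖) := fun w hw => by
    rw [mem_ball_iff_norm] at hw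
    have h3 := norm_sub_norm_le w z
    have h4 := norm_sub_norm_le z w
    rw [norm_sub_rev] at h4
    refine ⟨by linarith, by linarith, by linarith⟩
  have hsub : Metric.ball z d ⊆ disk := fun w hw => mem_disk.2 (hball w hw).1
  have key : ENNReal.ofReal ((1 - ‖z‖) ^ (2 + α)) * ‖f z‖ₑ ^ p ≤
      D * ∫⁻ w, ‖f w‖ₑ ^ p ∂weightedArea α := by
    have e1 : ENNReal.ofReal ((1 - ‖z‖) ^ (2 + α)) =
        ENNReal.ofReal (4 * (1 - ‖z‖) ^ α) * ENNReal.ofReal (d ^ 2) := by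
      rw [← ENNReal.ofReal_mul (by positivity), Real.rpow_add h1z, hd]
      congr 1
      norm_num; ring
    calc _ = ENNReal.ofReal (4 * (1 - ‖z‖) ^ α) * (ENNReal.ofReal (d ^ 2) * ‖f z‖ₑ ^ p) := by
          rw [e1, mul_assoc]
      _ ≤ ENNReal.ofReal (4 * (1 - ‖z‖) ^ α) * (C₁ * ∫⁻ w in Metric.ball z d, ‖f w‖ₑ ^ p) := by
          exact mul_le_mul_right (h₁ f z d hd0 (hf.mono hsub)) _
      _ = C₁ * ∫⁻ w in Metric.ball z d, ENNReal.ofReal (4 * (1 - ‖z‖) ^ α) * ‖f w‖ₑ ^ p := by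
          rw [lintegral_const_mul' _ _ ENNReal.ofReal_ne_top]; ring
      _ ≤ C₁ * ∫⁻ w in Metric.ball z d, ENNReal.ofReal (4 * 2 ^ |α|) *
            (ENNReal.ofReal ((1 - ‖w‖) ^ α) * ‖f w‖ₑ ^ p) := by
          refine mul_le_mul_right (setLIntegral_mono' measurableSet_ball fun w hw => ?_) _
          obtain ⟨hw1, hw2, hw3⟩ := hball w hw
          rw [← mul_assoc, ← ENNReal.ofReal_mul (by positivity)]
          gcongr ENNReal.ofReal ?_ * _
          rw [mul_assoc]
          gcongr
          exact rpow_le_of_comparable α one_le_two (by linarith) hw3 hw2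
      _ ≤ C₁ * (ENNReal.ofReal (4 * 2 ^ |α|) * ∫⁻ w, ‖f w‖ₑ ^ p ∂modelArea α) := by
          rw [lintegral_const_mul' _ _ ENNReal.ofReal_ne_top, lintegral_modelArea]
          gcongr
      _ ≤ C₁ * (ENNReal.ofReal (4 * 2 ^ |α|) *
            (ENNReal.ofReal C₂ * ∫⁻ w, ‖f w‖ₑ ^ p ∂weightedArea α)) := by
          gcongr; exact h₂ _
      _ = _ := by rw [hD]; ring
  have h5 := ENNReal.rpow_le_rpow key (z := 1 / p) (by positivity)
  rw [← bergmanNorm_rpow hp, ENNReal.mul_rpow_of_nonneg _ _ (by positivity),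
    ENNReal.mul_rpow_of_nonneg _ _ (by positivity), ← ENNReal.rpow_mul, ← ENNReal.rpow_mul,
    mul_one_div_cancel hp.ne', ENNReal.rpow_one, ENNReal.rpow_one,
    ENNReal.ofReal_rpow_of_nonneg (by positivity) (by positivity), ← Real.rpow_mul h1z.le,
    mul_one_div] at h5
  rwa [mul_comm]

/-- The embedding `L^p_a(ω_α) ⊆ L^1_a(ω_γ)` with `γ = (2 + α)/p - 2`, for `p ≤ 1`. -/
lemma exists_bergmanNorm_one_le {p α : ℝ} (hp : 0 < p) (hp1 : p ≤ 1) (hα : -1 < α) :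
    ∃ C : NNReal, ∀ f : ℂ → ℂ, MemBergman p α f →
      bergmanNorm 1 ((2 + α) / p - 2) f ≤ C * bergmanNorm p α f := by
  set s := (2 + α) / p with hs
  have hs1 : 1 < s := by rw [hs, lt_div_iff₀ hp]; linarith
  have hsp : s * p = 2 + α := div_mul_cancel₀ _ hp.ne'
  obtain ⟨C₁, h₁⟩ := exists_enorm_mul_le_bergmanNorm hp hp1 hα
  obtain ⟨C₂, hC₂, -, h₂⟩ := exists_weightedArea_le α hα
  obtain ⟨C₃, hC₃, h₃, -⟩ := exists_weightedArea_le (s - 2) (by linarith)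
  set D : ENNReal := ENNReal.ofReal C₃ * (C₁ : ENNReal) ^ (1 - p) * ENNReal.ofReal C₂ with hD
  have hDtop : D ≠ ⊤ := by
    have : (C₁ : ENNReal) ^ (1 - p) ≠ ⊤ := ENNReal.rpow_ne_top_of_nonneg (by linarith) (by simp)
    simp [hD, ENNReal.mul_eq_top, this]
  refine ⟨D.toNNReal, fun f ⟨hf, hfin⟩ => ?_⟩
  rw [ENNReal.coe_toNNReal hDtop, bergmanNorm_one]
  set B := bergmanNorm p α f
  have hcB : ((C₁ : ENNReal) * B) ^ (1 - p) ≠ ⊤ :=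
    ENNReal.rpow_ne_top_of_nonneg (by linarith) (ENNReal.mul_ne_top (by simp) hfin.ne)
  calc _ ≤ ENNReal.ofReal C₃ * ∫⁻ z, ‖f z‖ₑ ∂modelArea (s - 2) := h₃ _
    _ ≤ ENNReal.ofReal C₃ * ((C₁ * B) ^ (1 - p) * ∫⁻ z, ‖f z‖ₑ ^ p ∂modelArea α) := by
        gcongr
        rw [lintegral_modelArea, lintegral_modelArea, ← lintegral_const_mul' _ _ hcB]
        refine setLIntegral_mono' measurableSet_disk fun z hz => ?_
        have hz0 : 0 < 1 - ‖z‖ := by linarith [mem_disk.1 hz]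
        have h4 := ENNReal.rpow_le_rpow (h₁ f hf z hz) (z := 1 - p) (by linarith)
        rw [ENNReal.mul_rpow_of_nonneg _ _ (by linarith),
          ENNReal.ofReal_rpow_of_nonneg (by positivity) (by linarith), ← Real.rpow_mul hz0.le] at h4
        have e : ‖f z‖ₑ = ‖f z‖ₑ ^ (1 - p) * ‖f z‖ₑ ^ p := by
          rw [← ENNReal.rpow_add_of_nonneg _ _ (by linarith) hp.le]; simp
        -- The exponent splits as `s - 2 = s(1 - p) + α` because `s p = 2 + α`; the first part is
        -- consumed by the growth bound for `|f|^(1-p)`.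
        have e2 : ENNReal.ofReal ((1 - ‖z‖) ^ (s - 2)) =
            ENNReal.ofReal ((1 - ‖z‖) ^ (s * (1 - p))) * ENNReal.ofReal ((1 - ‖z‖) ^ α) := by
          rw [← ENNReal.ofReal_mul (by positivity), ← Real.rpow_add hz0]
          congr 2; linarith
        calc _ = (‖f z‖ₑ ^ (1 - p) * ENNReal.ofReal ((1 - ‖z‖) ^ (s * (1 - p)))) *
              (ENNReal.ofReal ((1 - ‖z‖) ^ α) * ‖f z‖ₑ ^ p) := by
              conv_lhs => rw [e, e2]
              ring
          _ ≤ _ := by gcongr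
    _ ≤ ENNReal.ofReal C₃ * ((C₁ * B) ^ (1 - p) * (ENNReal.ofReal C₂ * B ^ p)) := by
        gcongr; rw [bergmanNorm_rpow hp]; exact h₂ _
    _ = D * (B ^ (1 - p) * B ^ p) := by
        rw [ENNReal.mul_rpow_of_nonneg _ _ (by linarith), hD]; ring
    _ = D * B := by
        rw [← ENNReal.rpow_add_of_nonneg _ _ (by linarith) hp.le]; simp

end ToeplitzBergman

/-! ### Carleson boxes and kernel integrals against `μ` -/

namespace ToeplitzBergman
open MeasureTheory Filter Topology ComplexConjugate Set

lemma toCircle_hasBasis : (toCircle).HasBasis (fun R : ℝ => R < 1) fun R => {z | R < ‖z‖ ∧ ‖z‖ < 1} :=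
  (nhdsLT_basis (1 : ℝ)).comap _

lemma eventually_toCircle {P : ℂ → Prop} :
    (∀ᶠ z in toCircle, P z) ↔ ∃ R < 1, ∀ z : ℂ, R < ‖z‖ → ‖z‖ < 1 → P z := by
  rw [toCircle_hasBasis.eventually_iff]
  simp only [mem_ofPred_eq, and_imp]

lemma eventually_mem_disk : ∀ᶠ z in toCircle, z ∈ disk :=
  eventually_toCircle.2 ⟨0, one_pos, fun _ _ h => mem_disk.2 h⟩

lemma tendsto_norm_toCircle : Tendsto (fun z : ℂ => ‖z‖) toCircle (𝓝 1) :=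
  tendsto_comap.mono_right nhdsWithin_le_nhds

lemma tendsto_one_sub_norm_rpow {κ : ℝ} (hκ : 0 < κ) :
    Tendsto (fun a : ℂ => (1 - ‖a‖) ^ κ) toCircle (𝓝 0) := by
  have h : Tendsto (fun a : ℂ => 1 - ‖a‖) toCircle (𝓝 (1 - 1)) :=
    tendsto_const_nhds.sub tendsto_norm_toCircle
  have := h.rpow_const (p := κ) (Or.inr hκ.le)
  rwa [sub_self, Real.zero_rpow hκ.ne'] at this

lemma tendsto_ofReal_one_sub_norm_rpow {κ : ℝ} (hκ : 0 < κ) :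
    Tendsto (fun a : ℂ => ENNReal.ofReal ((1 - ‖a‖) ^ κ)) toCircle (𝓝 0) := by
  simpa using ENNReal.tendsto_ofReal (tendsto_one_sub_norm_rpow hκ)

/-- The points `w` to which `z` is close, relative to the distance of `w` to the unit circle. -/
def nearSet (z : ℂ) : Set ℂ := {w | ‖z - w‖ < (1 - ‖w‖) / 2}

lemma measurableSet_nearSet (z : ℂ) : MeasurableSet (nearSet z) :=
  measurableSet_lt (by fun_prop) (by fun_prop)

/-- The integral of `(1 - |w|)^(-δ) |1 - w ā|^(-t)`. -/
noncomputable def carlesonIntegral (μ : Measure ℂ) (δ t : ℝ) (a : ℂ) : ENNReal :=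
  ∫⁻ w, ENNReal.ofReal ((1 - ‖w‖) ^ (-δ) * ‖1 - w * conj a‖ ^ (-t)) ∂μ

lemma measurable_carleson_integrand (δ t : ℝ) (a : ℂ) : Measurable fun w : ℂ =>
    ENNReal.ofReal ((1 - ‖w‖) ^ (-δ) * ‖1 - w * conj a‖ ^ (-t)) := by fun_prop

/-- The integrand at `w` is comparable to its average over the disc of all `z` near `w`. Tonelli
turns the average into the box mass `μ (nearSet z)`, and the area of the disc accounts for the
additional exponent `-2`. -/
lemma exists_carlesonIntegral_le_lintegral (δ t : ℝ) : ∃ C : ℝ, 0 < C ∧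
    ∀ (μ : Measure ℂ) [SFinite μ], μ diskᶜ = 0 → ∀ a ∈ disk, carlesonIntegral μ δ t a ≤
      ENNReal.ofReal C * ∫⁻ z in disk,
        ENNReal.ofReal ((1 - ‖z‖) ^ (-2 - δ) * ‖1 - z * conj a‖ ^ (-t)) * μ (nearSet z) := by
  have hpi := Real.pi_pos
  set C := 4 / Real.pi * (2 ^ |(-2 - δ)| * 2 ^ |(-t)|) with hC
  refine ⟨C, by positivity, fun μ _ hμ a ha => ?_⟩
  have ha' := mem_disk.1 ha
  set H : ℂ → ENNReal := fun z =>
    ENNReal.ofReal ((1 - ‖z‖) ^ (-2 - δ) * ‖1 - z * conj a‖ ^ (-t)) with hH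
  have hHm : Measurable H := by rw [hH]; fun_prop
  have hset : MeasurableSet {q : ℂ × ℂ | ‖q.2 - q.1‖ < (1 - ‖q.1‖) / 2} :=
    measurableSet_lt (by fun_prop) (by fun_prop)
  have hpt : ∀ w ∈ disk, ENNReal.ofReal ((1 - ‖w‖) ^ (-δ) * ‖1 - w * conj a‖ ^ (-t)) ≤
      ENNReal.ofReal C * ∫⁻ z in disk, H z * (nearSet z).indicator 1 w := by
    intro w hw
    have hw' := mem_disk.1 hw
    have hw0 : 0 < 1 - ‖w‖ := by linarith
    -- Nearness is measured by the distance of `w`, not of `z`, to the circle, so for fixed `w` the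
    -- admissible `z` form exactly this disc. Its area is `π(1 - |w|)²/4`, whence the factor `4/π`.
    set B := Metric.ball w ((1 - ‖w‖) / 2) with hB
    have hnear : ∀ z ∈ B, ‖z - w‖ < (1 - ‖w‖) / 2 := fun z hz => mem_ball_iff_norm.1 hz
    have hBsub : B ⊆ disk := fun z hz => mem_disk.2 (norm_lt_one_of_near (hnear z hz)).2
    have hvol : volume B = ENNReal.ofReal (Real.pi * ((1 - ‖w‖) / 2) ^ 2) := by
      rw [hB, Complex.volume_ball, mul_comm Real.pi, ENNReal.ofReal_mul (by positivity),
        ENNReal.ofReal_pow (by positivity)]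
      congr 1
      rw [← NNReal.coe_real_pi, ENNReal.ofReal_coe_nnreal]
    have hint : ENNReal.ofReal ((1 - ‖w‖) ^ (-δ) * ‖1 - w * conj a‖ ^ (-t)) =
        ∫⁻ _ in B, ENNReal.ofReal (4 / Real.pi * ((1 - ‖w‖) ^ (-2 - δ) *
          ‖1 - w * conj a‖ ^ (-t))) := by
      rw [setLIntegral_const, hvol, ← ENNReal.ofReal_mul (by positivity)]
      congr 1
      have : (1 - ‖w‖) ^ (-δ) = (1 - ‖w‖) ^ (-2 - δ) * (1 - ‖w‖) ^ 2 := by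
        rw [← Real.rpow_natCast, ← Real.rpow_add hw0]
        congr 1; push_cast; ring
      rw [this]
      field_simp
      ring
    rw [hint]
    calc _ ≤ ∫⁻ z in B, ENNReal.ofReal C * (H z * (nearSet z).indicator 1 w) := by
          refine setLIntegral_mono' measurableSet_ball fun z hz => ?_
          have hn := hnear z hz
          have hz1 := (norm_lt_one_of_near hn).2
          rw [indicator_of_mem (show w ∈ nearSet z from hn), Pi.one_apply, mul_one, hH, hC,
            ← ENNReal.ofReal_mul (by positivity)]
          apply ENNReal.ofReal_le_ofReal
          have e1 := rpow_le_of_comparable (-2 - δ) one_le_two (by linarith : 0 < 1 - ‖z‖)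
            (one_sub_norm_le_of_near hn) (by linarith [one_sub_norm_ge_of_near hn])
          have e2 := rpow_le_of_comparable (-t) one_le_two (norm_one_sub_mul_conj_pos hz1 ha'.le)
            (norm_one_sub_mul_conj_near hn ha'.le).1 (norm_one_sub_mul_conj_near hn ha'.le).2
          calc _ ≤ 4 / Real.pi * ((2 ^ |(-2 - δ)| * (1 - ‖z‖) ^ (-2 - δ)) *
                (2 ^ |(-t)| * ‖1 - z * conj a‖ ^ (-t))) := by gcongr
            _ = _ := by ring
      _ ≤ ∫⁻ z in disk, ENNReal.ofReal C * (H z * (nearSet z).indicator 1 w) :=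
          lintegral_mono_set hBsub
      _ = _ := lintegral_const_mul' _ _ ENNReal.ofReal_ne_top
  have hae : ∀ᵐ w ∂μ, w ∈ disk := by rw [ae_iff]; exact hμ
  have hjm : Measurable (Function.uncurry fun w z : ℂ => H z * (nearSet z).indicator 1 w) := by
    have e : (Function.uncurry fun w z : ℂ => H z * (nearSet z).indicator 1 w) =
        fun q : ℂ × ℂ => H q.2 *
          {q : ℂ × ℂ | ‖q.2 - q.1‖ < (1 - ‖q.1‖) / 2}.indicator (1 : ℂ × ℂ → ENNReal) q := by
      ext q; rfl
    rw [e]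
    exact (hHm.comp measurable_snd).mul (measurable_one.indicator hset)
  calc carlesonIntegral μ δ t a
      ≤ ∫⁻ w, (ENNReal.ofReal C * ∫⁻ z in disk, H z * (nearSet z).indicator 1 w) ∂μ :=
        lintegral_mono_ae (hae.mono hpt)
    _ = ENNReal.ofReal C * ∫⁻ w, (∫⁻ z in disk, H z * (nearSet z).indicator 1 w) ∂μ :=
        lintegral_const_mul' _ _ ENNReal.ofReal_ne_top
    _ = ENNReal.ofReal C * ∫⁻ z in disk, (∫⁻ w, H z * (nearSet z).indicator 1 w ∂μ) := by
        rw [lintegral_lintegral_swap hjm.aemeasurable]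
    _ = _ := by
        congr 1
        refine lintegral_congr fun z => ?_
        rw [lintegral_const_mul' _ _ ENNReal.ofReal_ne_top,
          lintegral_indicator_one (measurableSet_nearSet z)]

/-- Kernel integrals against a measure satisfying a Carleson condition. -/
lemma exists_carlesonIntegral_le {s δ t : ℝ} (hδ : δ < s - 1) (ht : s - δ < t) : ∃ C : ℝ, 0 < C ∧
    ∀ (μ : Measure ℂ) [SFinite μ], μ diskᶜ = 0 → ∀ A : ℝ, 0 ≤ A →
      (∀ z ∈ disk, μ (nearSet z) ≤ ENNReal.ofReal (A * (1 - ‖z‖) ^ s)) → ∀ a ∈ disk,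
        carlesonIntegral μ δ t a ≤ ENNReal.ofReal (C * A * (1 - ‖a‖) ^ (s - δ - t)) := by
  obtain ⟨C₁, hC₁, h₁⟩ := exists_carlesonIntegral_le_lintegral δ t
  -- The box bound `(1 - |z|)^s` changes the weight exponent to `s - 2 - δ`. The assumptions on `δ`
  -- and `t` are precisely integrability of this weight and supercriticality of `t`.
  obtain ⟨C₂, hC₂, h₂⟩ := exists_forelliRudin_le (s - 2 - δ) t (by linarith) (by linarith)
  refine ⟨C₁ * C₂, by positivity, fun μ _ hμ A hA hcar a ha => ?_⟩
  calc _ ≤ _ := h₁ μ hμ a ha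
    _ ≤ ENNReal.ofReal C₁ * (ENNReal.ofReal A * forelliRudin (s - 2 - δ) t a) := by
        refine mul_le_mul_right ?_ _
        rw [forelliRudin, lintegral_modelArea, ← lintegral_const_mul' _ _ ENNReal.ofReal_ne_top]
        refine setLIntegral_mono' measurableSet_disk fun z hz => ?_
        have hz0 : 0 < 1 - ‖z‖ := by linarith [mem_disk.1 hz]
        refine (mul_le_mul_right (hcar z hz) _).trans (le_of_eq ?_)
        rw [← ENNReal.ofReal_mul (by positivity), ← ENNReal.ofReal_mul (by positivity),
          ← ENNReal.ofReal_mul hA]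
        congr 1
        rw [show s - 2 - δ = (-2 - δ) + s by ring, Real.rpow_add hz0]
        ring
    _ ≤ ENNReal.ofReal C₁ * (ENNReal.ofReal A *
          ENNReal.ofReal (C₂ * (1 - ‖a‖) ^ (s - 2 - δ + 2 - t))) := by gcongr; exact h₂ a ha
    _ = _ := by
        rw [← ENNReal.ofReal_mul hA, ← ENNReal.ofReal_mul hC₁.le]
        congr 1
        rw [show s - 2 - δ + 2 - t = s - δ - t by ring]; ring

/-- The vanishing Carleson condition of exponent `s`. -/
def VanishingBox (μ : Measure ℂ) (s : ℝ) : Prop :=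
  Tendsto (fun z => μ (nearSet z) * ENNReal.ofReal ((1 - ‖z‖) ^ (-s))) toCircle (𝓝 0)

/-- The Carleson condition of exponent `s`. -/
def BoundedBox (μ : Measure ℂ) (s : ℝ) : Prop :=
  ∃ A : ℝ, 0 ≤ A ∧ ∀ z ∈ disk, μ (nearSet z) ≤ ENNReal.ofReal (A * (1 - ‖z‖) ^ s)

lemma measure_nearSet_le_iff {μ : Measure ℂ} {s A : ℝ} (hA : 0 ≤ A) {z : ℂ} (hz : z ∈ disk) :
    μ (nearSet z) * ENNReal.ofReal ((1 - ‖z‖) ^ (-s)) ≤ ENNReal.ofReal A ↔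
      μ (nearSet z) ≤ ENNReal.ofReal (A * (1 - ‖z‖) ^ s) := by
  have hz0 : 0 < 1 - ‖z‖ := by linarith [mem_disk.1 hz]
  rw [Real.rpow_neg hz0.le, ENNReal.ofReal_inv_of_pos (by positivity), ← div_eq_mul_inv,
    ENNReal.div_le_iff (by simp; positivity) (by simp), ← ENNReal.ofReal_mul hA]

/-- A finite measure that satisfies a Carleson condition near the circle satisfies it. -/
lemma boundedBox_of_eventually {μ : Measure ℂ} [IsFiniteMeasure μ] {s A : ℝ} (hs : 0 ≤ s)
    (hA : 0 ≤ A) (h : ∀ᶠ z in toCircle, μ (nearSet z) ≤ ENNReal.ofReal (A * (1 - ‖z‖) ^ s)) :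
    BoundedBox μ s := by
  obtain ⟨R, hR, h⟩ := eventually_toCircle.1 h
  have hR0 : 0 < 1 - R := by linarith
  refine ⟨A + μ.real univ * (1 - R) ^ (-s), by positivity, fun z hz => ?_⟩
  have hz1 := mem_disk.1 hz
  have hz0 : 0 < 1 - ‖z‖ := by linarith
  rcases lt_or_ge R ‖z‖ with hz2 | hz2
  · refine (h z hz2 hz1).trans (ENNReal.ofReal_le_ofReal ?_)
    gcongr
    exact le_add_of_nonneg_right (by positivity)
  · calc μ (nearSet z) ≤ μ univ := measure_mono (subset_univ _)
      _ = ENNReal.ofReal (μ.real univ * 1) := by simp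
      _ ≤ ENNReal.ofReal (μ.real univ * ((1 - R) ^ (-s) * (1 - ‖z‖) ^ s)) := by
          apply ENNReal.ofReal_le_ofReal
          gcongr
          rw [Real.rpow_neg hR0.le, ← div_eq_inv_mul, one_le_div (by positivity)]
          exact Real.rpow_le_rpow hR0.le (by linarith) hs
      _ ≤ _ := by
          apply ENNReal.ofReal_le_ofReal
          rw [← mul_assoc]
          gcongr
          exact le_add_of_nonneg_left hA

lemma VanishingBox.boundedBox {μ : Measure ℂ} [IsFiniteMeasure μ] {s : ℝ} (hs : 0 ≤ s)
    (h : VanishingBox μ s) : BoundedBox μ s := by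
  refine boundedBox_of_eventually hs zero_le_one ?_
  filter_upwards [ENNReal.tendsto_nhds_zero.1 h (ENNReal.ofReal 1) (by simp), eventually_mem_disk]
    with z hz hzd
  exact (measure_nearSet_le_iff zero_le_one hzd).1 hz

/-- Kernel integrals against a measure satisfying a vanishing Carleson condition. -/
lemma VanishingBox.tendsto_carlesonIntegral {μ : Measure ℂ} [IsFiniteMeasure μ] {s δ t : ℝ}
    (h : VanishingBox μ s) (hμ : μ diskᶜ = 0) (hδ0 : 0 ≤ δ) (hδ : δ < s - 1) (ht : s - δ < t) :
    Tendsto (fun a => ENNReal.ofReal ((1 - ‖a‖) ^ (t + δ - s)) * carlesonIntegral μ δ t a)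
      toCircle (𝓝 0) := by
  obtain ⟨C, hC, hK⟩ := exists_carlesonIntegral_le hδ ht
  rw [ENNReal.tendsto_nhds_zero]
  intro ε hε
  rcases eq_or_ne ε ⊤ with rfl | hεt
  · exact Eventually.of_forall fun _ => le_top
  set e := ε.toReal with he
  have he0 : 0 < e := ENNReal.toReal_pos hε.ne' hεt
  have hεe : ε = ENNReal.ofReal (e / 2) + ENNReal.ofReal (e / 2) := by
    rw [← ENNReal.ofReal_add (by positivity) (by positivity), add_halves, ENNReal.ofReal_toReal hεt]
  set A := e / (2 * C) with hA
  have hA0 : 0 < A := by positivity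
  obtain ⟨R₀, hR₀, hbox⟩ := eventually_toCircle.1
    (ENNReal.tendsto_nhds_zero.1 h (ENNReal.ofReal A) (by simpa using hA0))
  -- If `|w| > R` and `w` lies in the box of `z`, then `1 - |z| ≤ (3/2)(1 - |w|) < 1 - R₀`. Hence
  -- the restricted measure satisfies the small box bound at every point of the disk.
  set R := 1 - 2 / 3 * (1 - R₀) with hR
  have hR1 : 0 < 1 - R := by rw [hR]; linarith
  set S := {w : ℂ | R < ‖w‖} with hS
  have hSm : MeasurableSet S := measurableSet_lt (by fun_prop) (by fun_prop)
  have hrest : ∀ z ∈ disk, (μ.restrict S) (nearSet z) ≤ ENNReal.ofReal (A * (1 - ‖z‖) ^ s) := by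
    intro z hz
    rcases lt_or_ge R₀ ‖z‖ with hz2 | hz2
    · exact (Measure.restrict_apply_le _ _).trans
        ((measure_nearSet_le_iff hA0.le hz).1 (hbox z hz2 (mem_disk.1 hz)))
    · rw [Measure.restrict_apply (measurableSet_nearSet z)]
      have : nearSet z ∩ S = ∅ := by
        ext w
        simp only [mem_inter_iff, mem_empty_iff_false, iff_false, not_and]
        intro hw hwS
        have h1 := one_sub_norm_ge_of_near (show ‖z - w‖ < (1 - ‖w‖) / 2 from hw)
        have h2 : R < ‖w‖ := hwS
        linarith
      rw [this]; simp
  have hμS : (μ.restrict S) diskᶜ = 0 := le_antisymm ((Measure.restrict_apply_le _ _).trans hμ.le) bot_le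
  -- On `|w| ≤ R` the integrand is bounded uniformly in `a` and `μ` is finite, so the prefactor,
  -- whose exponent is positive, annihilates this part.
  have hlim : Tendsto (fun a : ℂ => ENNReal.ofReal ((1 - ‖a‖) ^ (t + δ - s)) *
      (ENNReal.ofReal ((1 - R) ^ (-δ) * (1 - R) ^ (-t)) * μ univ)) toCircle (𝓝 0) := by
    have := ENNReal.Tendsto.mul_const (b := ENNReal.ofReal ((1 - R) ^ (-δ) * (1 - R) ^ (-t)) * μ univ)
      (tendsto_ofReal_one_sub_norm_rpow (κ := t + δ - s) (by linarith))
      (Or.inr (ENNReal.mul_ne_top (by simp) (by simp)))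
    rwa [zero_mul] at this
  filter_upwards [eventually_mem_disk, ENNReal.tendsto_nhds_zero.1 hlim (ENNReal.ofReal (e / 2))
    (by simpa using he0)] with a ha ha2
  have ha1 := mem_disk.1 ha
  have ha0 : 0 < 1 - ‖a‖ := by linarith
  have hsplit : carlesonIntegral μ δ t a ≤ carlesonIntegral (μ.restrict S) δ t a +
      ENNReal.ofReal ((1 - R) ^ (-δ) * (1 - R) ^ (-t)) * μ univ := by
    rw [carlesonIntegral, ← lintegral_add_compl _ hSm]
    refine add_le_add le_rfl ?_
    have hae : ∀ᵐ w ∂μ.restrict Sᶜ, w ∈ disk :=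
      ae_restrict_of_ae (by rw [ae_iff]; exact hμ)
    calc _ ≤ ∫⁻ _ in Sᶜ, ENNReal.ofReal ((1 - R) ^ (-δ) * (1 - R) ^ (-t)) ∂μ := by
          refine lintegral_mono_ae ?_
          filter_upwards [hae, ae_restrict_mem hSm.compl] with w hw hwS
          have hw1 : ‖w‖ ≤ R := not_lt.1 hwS
          have hw2 := mem_disk.1 hw
          apply ENNReal.ofReal_le_ofReal
          gcongr ?_ * ?_
          · exact Real.rpow_le_rpow_of_nonpos hR1 (by linarith) (by linarith)
          · exact Real.rpow_le_rpow_of_nonpos hR1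
              (by linarith [one_sub_norm_le_norm_one_sub_mul_conj (z := w) ha1.le]) (by linarith)
      _ ≤ _ := by
          rw [lintegral_const]
          gcongr
          exact Measure.restrict_le_self
  calc _ ≤ ENNReal.ofReal ((1 - ‖a‖) ^ (t + δ - s)) *
        (ENNReal.ofReal (C * A * (1 - ‖a‖) ^ (s - δ - t)) +
          ENNReal.ofReal ((1 - R) ^ (-δ) * (1 - R) ^ (-t)) * μ univ) := by
        gcongr
        exact hsplit.trans (add_le_add (hK _ hμS A hA0.le hrest a ha) le_rfl)
    _ ≤ ε := by
        rw [mul_add, hεe]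
        refine add_le_add (le_of_eq ?_) ha2
        rw [← ENNReal.ofReal_mul (by positivity)]
        congr 1
        rw [show s - δ - t = -(t + δ - s) by ring, Real.rpow_neg ha0.le, hA]
        have : (1 - ‖a‖) ^ (t + δ - s) ≠ 0 := by positivity
        field_simp

end ToeplitzBergman

/-! ### Kernel integrals as analytic functions, change of weight and null sequences -/

namespace ToeplitzBergman
open MeasureTheory Filter Topology ComplexConjugate Set

section

variable {μ : Measure ℂ}

lemma ae_mem_disk (hμ : μ diskᶜ = 0) : ∀ᵐ w ∂μ, w ∈ disk := by rw [ae_iff]; exact hμ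

instance (σ : ℝ) : SFinite (weightedArea σ) := by rw [weightedArea_eq]; infer_instance

lemma aestronglyMeasurable_kernel (b : ℝ) (z : ℂ) : AEStronglyMeasurable (fun w => kernel b z w) μ :=
  (measurable_kernel b measurable_const measurable_id).aestronglyMeasurable

lemma integrable_mul_kernel (hμ : μ diskᶜ = 0) {φ : ℂ → ℂ} (hφ : Integrable φ μ) {b : ℝ}
    (hb : 0 ≤ b) {z : ℂ} (hz : z ∈ disk) : Integrable (fun w => φ w * kernel b z w) μ :=
  (hφ.norm.const_mul ((1 - ‖z‖) ^ (-b))).mono'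
    (hφ.aestronglyMeasurable.mul (aestronglyMeasurable_kernel b z))
    ((ae_mem_disk hμ).mono fun w hw => by
      rw [norm_mul, mul_comm]
      gcongr
      exact norm_kernel_le b hb (mem_disk.1 hz) (mem_disk.1 hw).le)

/-- Differentiation of kernel integrals. -/
lemma hasDerivAt_integral_kernel (hμ : μ diskᶜ = 0) {φ : ℂ → ℂ} (hφ : Integrable φ μ) {b : ℝ}
    (hb : 0 ≤ b) {z : ℂ} (hz : z ∈ disk) :
    HasDerivAt (fun z => ∫ w, φ w * kernel b z w ∂μ)
      (∫ w, φ w * (b * conj w * kernel (b + 1) z w) ∂μ) z := by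
  have hz' := mem_disk.1 hz
  have hc : Continuous fun z : ℂ => conj z := Complex.continuous_conj
  set r := (1 - ‖z‖) / 2 with hr
  have hr0 : 0 < r := by rw [hr]; linarith
  have hball : ∀ x ∈ Metric.ball z r, ‖x‖ < 1 - r := fun x hx => by
    have h1 := mem_ball_iff_norm.1 hx
    have h2 := norm_sub_norm_le x z
    linarith
  refine (hasDerivAt_integral_of_dominated_loc_of_deriv_le (s := Metric.ball z r)
    (bound := fun w => b * r ^ (-(b + 1)) * ‖φ w‖)
    (F' := fun x w => φ w * (b * conj w * kernel (b + 1) x w)) (Metric.ball_mem_nhds z hr0)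
    (Eventually.of_forall fun x => hφ.aestronglyMeasurable.mul (aestronglyMeasurable_kernel b x))
    (integrable_mul_kernel hμ hφ hb hz) ?_ ?_ (hφ.norm.const_mul _) ?_).2
  · refine hφ.aestronglyMeasurable.mul (Measurable.aestronglyMeasurable ?_)
    fun_prop
  · filter_upwards [ae_mem_disk hμ] with w hw x hx
    have hw' := mem_disk.1 hw
    have hx' := hball x hx
    rw [norm_mul, mul_comm, norm_mul, norm_mul, RCLike.norm_conj, Complex.norm_real,
      Real.norm_of_nonneg hb]
    gcongr ?_ * ‖φ w‖
    have hk := norm_kernel_le (b + 1) (by linarith) (by linarith : ‖x‖ < 1) hw'.le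
    have hk2 : (1 - ‖x‖) ^ (-(b + 1)) ≤ r ^ (-(b + 1)) :=
      Real.rpow_le_rpow_of_nonpos hr0 (by linarith) (by linarith)
    calc b * ‖w‖ * ‖kernel (b + 1) x w‖ ≤ b * 1 * r ^ (-(b + 1)) := by
          gcongr
          exact hk.trans hk2
      _ = _ := by ring
  · filter_upwards [ae_mem_disk hμ] with w hw x hx
    exact (hasDerivAt_kernel b (by linarith [hball x hx]) (mem_disk.1 hw).le).const_mul _

lemma differentiableOn_integral_kernel (hμ : μ diskᶜ = 0) {φ : ℂ → ℂ} (hφ : Integrable φ μ)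
    {b : ℝ} (hb : 0 ≤ b) : DifferentiableOn ℂ (fun z => ∫ w, φ w * kernel b z w ∂μ) disk :=
  fun _ hz => (hasDerivAt_integral_kernel hμ hφ hb hz).differentiableAt.differentiableWithinAt

end

lemma lintegral_weightedArea_add_one {γ : ℝ} (hγ : -1 < γ) (F : ℂ → ENNReal) :
    ∫⁻ z, F z ∂weightedArea (γ + 1) =
      ∫⁻ z, ENNReal.ofReal ((2 + γ) / (1 + γ) * (1 - ‖z‖ ^ 2)) * F z ∂weightedArea γ := by
  rw [lintegral_weightedArea, lintegral_weightedArea]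
  refine setLIntegral_congr_fun measurableSet_disk fun z hz => ?_
  have hz' := mem_disk.1 hz
  have h0 : 0 < 1 - ‖z‖ ^ 2 := by nlinarith [norm_nonneg z]
  have h1 : 0 < 1 + γ := by linarith
  have h2 : 0 ≤ Real.pi⁻¹ * weight γ z := by
    unfold weight; have := Real.pi_pos; positivity
  rw [← mul_assoc, ← ENNReal.ofReal_mul h2, weight, weight, Real.rpow_add_one h0.ne']
  congr 2
  field_simp
  ring

/-- Read off from the Forelli–Rudin bound at `a = 0`, where the integrand is 1; any supercritical
exponent would do. -/
lemma weightedArea_univ_lt_top {σ : ℝ} (hσ : -1 < σ) : weightedArea σ univ < ⊤ := by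
  obtain ⟨C, hC, h1, -⟩ := exists_weightedArea_le σ hσ
  obtain ⟨C', hC', h2⟩ := exists_forelliRudin_le σ (σ + 3) hσ (by linarith)
  rw [← lintegral_one]
  refine (h1 _).trans_lt (ENNReal.mul_lt_top (by simp) ?_)
  have := h2 0 zero_mem_disk
  simp only [forelliRudin, map_zero, mul_zero, sub_zero, norm_one, Real.one_rpow,
    ENNReal.ofReal_one] at this
  exact this.trans_lt ENNReal.ofReal_lt_top

/-- The extra power of `1 - |z|²` in the weight absorbs a multiplier that blows up like `1/(1 -
|z|)`, as kernel integrals do. -/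
lemma lintegral_mul_weightedArea_add_one_le {γ : ℝ} (hγ : -1 < γ) (f : ℂ → ℂ) {M : ℂ → ENNReal}
    {A : ENNReal} (hA : ∀ z ∈ disk, ENNReal.ofReal (1 - ‖z‖) * M z ≤ A) (hAt : A ≠ ⊤) :
    ∫⁻ z, ‖f z‖ₑ * M z ∂weightedArea (γ + 1) ≤
      ENNReal.ofReal (2 * ((2 + γ) / (1 + γ))) * A * bergmanNorm 1 γ f := by
  rw [lintegral_weightedArea_add_one hγ, bergmanNorm_one,
    ← lintegral_const_mul' _ _ (ENNReal.mul_ne_top ENNReal.ofReal_ne_top hAt)]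
  have h1 : 0 < 1 + γ := by linarith
  have h2 : 0 < 2 + γ := by linarith
  refine lintegral_mono_ae ((ae_mem_disk (measure_weightedArea_compl γ)).mono fun z hz => ?_)
  have hz' := mem_disk.1 hz
  have hz0 : 0 ≤ 1 - ‖z‖ := by linarith
  calc _ ≤ ENNReal.ofReal (2 * ((2 + γ) / (1 + γ)) * (1 - ‖z‖)) * (‖f z‖ₑ * M z) := by
        gcongr ENNReal.ofReal ?_ * _
        rw [mul_comm 2, mul_assoc]
        gcongr
        exact (one_sub_sq_comparable (norm_nonneg z) hz').1
    _ = ENNReal.ofReal (2 * ((2 + γ) / (1 + γ))) * (ENNReal.ofReal (1 - ‖z‖) * M z) * ‖f z‖ₑ := by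
        rw [ENNReal.ofReal_mul (by positivity)]; ring
    _ ≤ _ := by gcongr; exact hA z hz

lemma MemBergman.integrable_add_one {γ : ℝ} (hγ : -1 < γ) {f : ℂ → ℂ} (hf : MemBergman 1 γ f) :
    Integrable f (weightedArea (γ + 1)) := by
  refine ⟨aemeasurable_of_differentiableOn hf.1 (measure_weightedArea_compl _), ?_⟩
  have := lintegral_mul_weightedArea_add_one_le hγ f (M := 1) (A := 1)
    (fun z _ => by simp) (by simp)
  simp only [Pi.one_apply, mul_one] at this
  exact this.trans_lt (ENNReal.mul_lt_top ENNReal.ofReal_lt_top hf.2)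

/-- The reproducing formula in a Bergman space with a smaller weight. -/
lemma MemBergman.integral_mul_kernel {γ : ℝ} (hγ : -1 < γ) {f : ℂ → ℂ} (hf : MemBergman 1 γ f)
    {w : ℂ} (hw : w ∈ disk) : ∫ z, f z * kernel (γ + 3) w z ∂weightedArea (γ + 1) = f w := by
  have := ToeplitzBergman.integral_mul_kernel (η := γ + 1) (by linarith) hf.1
    (hf.integrable_add_one hγ) hw
  rwa [show γ + 1 + 2 = γ + 3 by ring] at this

/-- Insert the reproducing formula for `f(w)`, take absolute values inside and apply Tonelli. The
measure `μ` then enters only through kernel integrals. -/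
lemma lintegral_mul_le_lintegral_kernel {γ : ℝ} (hγ : -1 < γ) {f : ℂ → ℂ} (hf : MemBergman 1 γ f)
    {μ : Measure ℂ} [SFinite μ] (hμ : μ diskᶜ = 0) {φ : ℂ → ENNReal} (hφ : Measurable φ) :
    ∫⁻ w, ‖f w‖ₑ * φ w ∂μ ≤
      ∫⁻ z, ‖f z‖ₑ * (∫⁻ w, φ w * ‖kernel (γ + 3) w z‖ₑ ∂μ) ∂weightedArea (γ + 1) := by
  have hfm : AEMeasurable (fun z => ‖f z‖ₑ) (weightedArea (γ + 1)) :=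
    (aemeasurable_of_differentiableOn hf.1 (measure_weightedArea_compl _)).enorm
  have hk : Measurable fun q : ℂ × ℂ => φ q.1 * ‖kernel (γ + 3) q.1 q.2‖ₑ :=
    (hφ.comp measurable_fst).mul (measurable_kernel _ measurable_fst measurable_snd).enorm
  calc _ ≤ ∫⁻ w, (∫⁻ z, ‖f z‖ₑ * (φ w * ‖kernel (γ + 3) w z‖ₑ) ∂weightedArea (γ + 1)) ∂μ := by
        refine lintegral_mono_ae ((ae_mem_disk hμ).mono fun w hw => ?_)
        have h := enorm_integral_le_lintegral_enorm (μ := weightedArea (γ + 1))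
          fun z => f z * kernel (γ + 3) w z
        rw [hf.integral_mul_kernel hγ hw] at h
        have hkw : Measurable fun z => ‖kernel (γ + 3) w z‖ₑ :=
          (measurable_kernel _ measurable_const measurable_id).enorm
        calc ‖f w‖ₑ * φ w ≤ φ w * ∫⁻ z, ‖f z * kernel (γ + 3) w z‖ₑ ∂weightedArea (γ + 1) := by
              rw [mul_comm]; gcongr
          _ = ∫⁻ z, φ w * ‖f z * kernel (γ + 3) w z‖ₑ ∂weightedArea (γ + 1) := by
              rw [lintegral_const_mul'' _ (by simp only [enorm_mul]; exact hfm.mul hkw.aemeasurable)]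
          _ = _ := by
              refine lintegral_congr fun z => ?_
              rw [enorm_mul]; ring
    _ = ∫⁻ z, (∫⁻ w, ‖f z‖ₑ * (φ w * ‖kernel (γ + 3) w z‖ₑ) ∂μ) ∂weightedArea (γ + 1) :=
        lintegral_lintegral_swap (hfm.comp_snd.mul hk.aemeasurable)
    _ = _ := by
        refine lintegral_congr fun z => ?_
        rw [lintegral_const_mul]
        exact hk.comp (measurable_id.prodMk measurable_const)

/-- Near the circle `G` is small and the norms are bounded; on the remaining compact disc `G` is
bounded, `f n` is uniformly small, and the area measure is finite. -/
lemma tendsto_lintegral_mul_of_null {γ : ℝ} (hγ : -1 < γ) {f : ℕ → ℂ → ℂ}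
    (hb : IsBoundedSeq 1 γ f) (hn : LocallyUniformlyNull f) {G : ℂ → ENNReal} {A : ENNReal}
    (hA : ∀ z ∈ disk, G z ≤ A) (hAt : A ≠ ⊤) (hG : Tendsto G toCircle (𝓝 0)) :
    Tendsto (fun n => ∫⁻ z, ‖f n z‖ₑ * G z ∂weightedArea γ) atTop (𝓝 0) := by
  obtain ⟨hmem, B, hB⟩ := hb
  have hfin := weightedArea_univ_lt_top hγ
  rw [ENNReal.tendsto_nhds_zero]
  intro ε hε
  obtain ⟨ε₁, hε₁, hε₁B⟩ : ∃ ε₁ : NNReal, 0 < ε₁ ∧ (ε₁ : ENNReal) * B ≤ ε / 2 := by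
    have h := ENNReal.exists_nnreal_pos_mul_lt (a := B) (b := ε / 2) (by simp)
      (ENNReal.half_pos hε.ne').ne'
    obtain ⟨n, hn, h⟩ := h
    exact ⟨n, hn, h.le⟩
  obtain ⟨ε₂, hε₂, hε₂B⟩ : ∃ ε₂ : NNReal, 0 < ε₂ ∧ (ε₂ : ENNReal) * (A * weightedArea γ univ) ≤ ε / 2 := by
    have h := ENNReal.exists_nnreal_pos_mul_lt (a := A * weightedArea γ univ) (b := ε / 2)
      (ENNReal.mul_ne_top hAt hfin.ne) (ENNReal.half_pos hε.ne').ne'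
    obtain ⟨n, hn, h⟩ := h
    exact ⟨n, hn, h.le⟩
  obtain ⟨R, hR, hGR⟩ := eventually_toCircle.1
    (ENNReal.tendsto_nhds_zero.1 hG ε₁ (by simpa using hε₁))
  have hK := hn (Metric.closedBall 0 R) (fun z hz => mem_disk.2 (by
    rw [mem_closedBall_zero_iff] at hz; linarith)) (isCompact_closedBall 0 R)
  rw [Metric.tendstoUniformlyOn_iff] at hK
  filter_upwards [hK ε₂ (by simpa using hε₂)] with n hn
  calc ∫⁻ z, ‖f n z‖ₑ * G z ∂weightedArea γ
      ≤ ∫⁻ z, ε₁ * ‖f n z‖ₑ + ε₂ * A ∂weightedArea γ := by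
        refine lintegral_mono_ae ((ae_mem_disk (measure_weightedArea_compl γ)).mono fun z hz => ?_)
        rcases lt_or_ge R ‖z‖ with h | h
        · calc _ ≤ ‖f n z‖ₑ * ε₁ := by gcongr; exact hGR z h (mem_disk.1 hz)
            _ ≤ _ := by rw [mul_comm]; exact le_self_add
        · have h1 := hn z (by simpa using h)
          rw [dist_zero_left] at h1
          have h2 : ‖f n z‖ₑ ≤ ε₂ := by
            rw [← ofReal_norm, ENNReal.ofReal_le_iff_le_toReal (by simp)]; exact h1.le
          calc _ ≤ (ε₂ : ENNReal) * A := by gcongr; exact hA z hz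
            _ ≤ _ := le_add_self
    _ = ε₁ * bergmanNorm 1 γ (f n) + ε₂ * (A * weightedArea γ univ) := by
        rw [lintegral_add_right _ measurable_const, lintegral_const_mul' _ _ (by simp),
          lintegral_const, bergmanNorm_one, mul_assoc]
    _ ≤ ε / 2 + ε / 2 := add_le_add ((mul_le_mul_right (hB n) _).trans hε₁B) hε₂B
    _ = ε := ENNReal.add_halves ε

lemma tendsto_lintegral_add_one_of_null {γ : ℝ} (hγ : -1 < γ) {f : ℕ → ℂ → ℂ}
    (hb : IsBoundedSeq 1 γ f) (hn : LocallyUniformlyNull f) {M : ℂ → ENNReal} {A : ENNReal}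
    (hA : ∀ z ∈ disk, ENNReal.ofReal (1 - ‖z‖) * M z ≤ A) (hAt : A ≠ ⊤)
    (hM : Tendsto (fun z => ENNReal.ofReal (1 - ‖z‖) * M z) toCircle (𝓝 0)) :
    Tendsto (fun n => ∫⁻ z, ‖f n z‖ₑ * M z ∂weightedArea (γ + 1)) atTop (𝓝 0) := by
  have h1 : 0 < 1 + γ := by linarith
  have h2 : 0 < 2 + γ := by linarith
  have hle : ∀ z ∈ disk, ENNReal.ofReal ((2 + γ) / (1 + γ) * (1 - ‖z‖ ^ 2)) * M z ≤
      ENNReal.ofReal (2 * ((2 + γ) / (1 + γ))) * (ENNReal.ofReal (1 - ‖z‖) * M z) := fun z hz => by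
    rw [← mul_assoc, ← ENNReal.ofReal_mul (by positivity)]
    gcongr ENNReal.ofReal ?_ * _
    rw [mul_comm 2, mul_assoc]
    gcongr
    exact (one_sub_sq_comparable (norm_nonneg z) (mem_disk.1 hz)).1
  have h0 : Tendsto (fun z => ENNReal.ofReal (2 * ((2 + γ) / (1 + γ))) *
      (ENNReal.ofReal (1 - ‖z‖) * M z)) toCircle (𝓝 0) := by
    have := ENNReal.Tendsto.const_mul (a := ENNReal.ofReal (2 * ((2 + γ) / (1 + γ)))) hM
      (Or.inr ENNReal.ofReal_ne_top)
    rwa [mul_zero] at this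
  have := tendsto_lintegral_mul_of_null hγ hb hn
    (G := fun z => ENNReal.ofReal ((2 + γ) / (1 + γ) * (1 - ‖z‖ ^ 2)) * M z)
    (A := ENNReal.ofReal (2 * ((2 + γ) / (1 + γ))) * A)
    (fun z hz => (hle z hz).trans (by gcongr; exact hA z hz)) (ENNReal.mul_ne_top ENNReal.ofReal_ne_top hAt)
    (tendsto_of_tendsto_of_tendsto_of_le_of_le' tendsto_const_nhds h0
      (Eventually.of_forall fun _ => zero_le) (eventually_mem_disk.mono hle))
  simp only [lintegral_weightedArea_add_one hγ]
  refine this.congr fun n => lintegral_congr fun z => by ring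

end ToeplitzBergman

/-! ### Hölder continuity of the kernel, pointwise and in `L^1(ω_β)` -/

namespace ToeplitzBergman
open MeasureTheory Filter Topology ComplexConjugate Set

/-- If `|A - B| ≥ |A|/2`, the triangle inequality is enough. Otherwise the segment stays in the
right half-plane, away from the branch cut, with modulus at least `|A|/2`, so the mean value
inequality applies, and `|A - B|^(1-δ) ≤ |A|^(1-δ)` lowers the power of the increment to `δ`. -/
lemma norm_cpow_neg_sub_le_of_norm_le {b δ : ℝ} (hb : 0 < b) (hδ0 : 0 < δ) (hδ1 : δ < 1) {A B : ℂ}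
    (hA : 0 < A.re) (hB : 0 < B.re) (hAB : ‖A‖ ≤ ‖B‖) :
    ‖A ^ (-(b : ℂ)) - B ^ (-(b : ℂ))‖ ≤
      (4 + b * 2 ^ (b + 1)) * (‖A - B‖ ^ δ * ‖A‖ ^ (-(b + δ))) := by
  have hA0 : 0 < ‖A‖ := norm_pos_iff.2 fun h => by simp [h] at hA
  have hB0 : 0 < ‖B‖ := hA0.trans_le hAB
  have hnorm : ∀ (x : ℂ) (c : ℝ), ‖x ^ (-(c : ℂ))‖ = ‖x‖ ^ (-c) := fun x c => by
    rw [← Complex.ofReal_neg, Complex.norm_cpow_real]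
  rcases le_or_gt (‖A‖ / 2) ‖A - B‖ with h | h
  · have h1 : ‖B‖ ^ (-b) ≤ ‖A‖ ^ (-b) := Real.rpow_le_rpow_of_nonpos hA0 hAB (by linarith)
    have h2 : ‖A‖ ^ (-b) = ‖A‖ ^ δ * ‖A‖ ^ (-(b + δ)) := by
      rw [← Real.rpow_add hA0]; congr 1; ring
    have h3 : ‖A‖ ^ δ ≤ 2 * ‖A - B‖ ^ δ := by
      calc ‖A‖ ^ δ ≤ (2 * ‖A - B‖) ^ δ := Real.rpow_le_rpow hA0.le (by linarith) hδ0.le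
        _ = 2 ^ δ * ‖A - B‖ ^ δ := Real.mul_rpow (by norm_num) (norm_nonneg _)
        _ ≤ 2 ^ (1 : ℝ) * ‖A - B‖ ^ δ := by
            gcongr
            exact one_le_two
        _ = _ := by rw [Real.rpow_one]
    calc _ ≤ ‖A‖ ^ (-b) + ‖B‖ ^ (-b) := by
          rw [← hnorm, ← hnorm]; exact norm_sub_le _ _
      _ ≤ 2 * (‖A‖ ^ δ * ‖A‖ ^ (-(b + δ))) := by rw [← h2]; linarith
      _ ≤ 2 * (2 * ‖A - B‖ ^ δ * ‖A‖ ^ (-(b + δ))) := by gcongr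
      _ = 4 * (‖A - B‖ ^ δ * ‖A‖ ^ (-(b + δ))) := by ring
      _ ≤ _ := by
        gcongr
        exact le_add_of_nonneg_right (by positivity)
  · have hseg : ∀ x ∈ segment ℝ A B, 0 < x.re ∧ ‖A‖ / 2 ≤ ‖x‖ := by
      intro x hx
      constructor
      · have hconv : Convex ℝ {z : ℂ | 0 < z.re} := convex_halfSpace_re_gt 0
        exact hconv.segment_subset hA hB hx
      · have h1 : ‖x - A‖ ≤ ‖B - A‖ := norm_sub_le_of_mem_segment hx
        have h2 := norm_sub_norm_le A x
        rw [norm_sub_rev] at h1 h2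
        rw [norm_sub_rev B A] at h1
        rw [norm_sub_rev x A] at h2
        linarith
    have hder : ∀ x ∈ segment ℝ A B, HasDerivWithinAt (fun x : ℂ => x ^ (-(b : ℂ)))
        (-(b : ℂ) * x ^ (-(b : ℂ) - 1)) (segment ℝ A B) x := fun x hx => by
      have := (hasDerivAt_id x).cpow_const (c := -(b : ℂ)) (Or.inl (hseg x hx).1)
      simpa using this.hasDerivWithinAt
    have hbound : ∀ x ∈ segment ℝ A B, ‖-(b : ℂ) * x ^ (-(b : ℂ) - 1)‖ ≤
        b * (2 ^ (b + 1) * ‖A‖ ^ (-(b + 1))) := fun x hx => by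
      have e : (-(b : ℂ) - 1) = -((b + 1 : ℝ) : ℂ) := by push_cast; ring
      rw [norm_mul, norm_neg, Complex.norm_real, Real.norm_of_nonneg hb.le, e, hnorm]
      gcongr
      calc ‖x‖ ^ (-(b + 1)) ≤ (‖A‖ / 2) ^ (-(b + 1)) :=
            Real.rpow_le_rpow_of_nonpos (by positivity) (hseg x hx).2 (by linarith)
        _ = _ := by
            rw [Real.div_rpow hA0.le (by norm_num), Real.rpow_neg (by norm_num : (0:ℝ) ≤ 2),
              div_inv_eq_mul, mul_comm]
    have hmv := (convex_segment A B).norm_image_sub_le_of_norm_hasDerivWithin_le hder hbound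
      (right_mem_segment ℝ A B) (left_mem_segment ℝ A B)
    have hd : ‖A - B‖ ≤ ‖A - B‖ ^ δ * ‖A‖ ^ (1 - δ) := by
      rcases (norm_nonneg (A - B)).eq_or_lt with h0 | h0
      · rw [← h0]; positivity
      · calc ‖A - B‖ = ‖A - B‖ ^ δ * ‖A - B‖ ^ (1 - δ) := by
              rw [← Real.rpow_add h0]; simp
          _ ≤ _ := by
              gcongr
              linarith
    calc _ ≤ b * (2 ^ (b + 1) * ‖A‖ ^ (-(b + 1))) * ‖A - B‖ := hmv
      _ ≤ b * (2 ^ (b + 1) * ‖A‖ ^ (-(b + 1))) * (‖A - B‖ ^ δ * ‖A‖ ^ (1 - δ)) := by gcongr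
      _ = b * 2 ^ (b + 1) * (‖A - B‖ ^ δ * ‖A‖ ^ (-(b + δ))) := by
          have : ‖A‖ ^ (-(b + δ)) = ‖A‖ ^ (-(b + 1)) * ‖A‖ ^ (1 - δ) := by
            rw [← Real.rpow_add hA0]; congr 1; ring
          rw [this]; ring
      _ ≤ _ := by
        gcongr
        linarith

lemma norm_cpow_neg_sub_le {b δ : ℝ} (hb : 0 < b) (hδ0 : 0 < δ) (hδ1 : δ < 1) {A B : ℂ}
    (hA : 0 < A.re) (hB : 0 < B.re) : ‖A ^ (-(b : ℂ)) - B ^ (-(b : ℂ))‖ ≤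
      (4 + b * 2 ^ (b + 1)) * (‖A - B‖ ^ δ * (‖A‖ ^ (-(b + δ)) + ‖B‖ ^ (-(b + δ)))) := by
  rcases le_total ‖A‖ ‖B‖ with h | h
  · refine (norm_cpow_neg_sub_le_of_norm_le hb hδ0 hδ1 hA hB h).trans ?_
    gcongr
    exact le_add_of_nonneg_right (by positivity)
  · rw [norm_sub_rev, norm_sub_rev A B]
    refine (norm_cpow_neg_sub_le_of_norm_le hb hδ0 hδ1 hB hA h).trans ?_
    gcongr
    exact le_add_of_nonneg_left (by positivity)

lemma one_sub_mul_conj_re_pos {z w : ℂ} (hz : ‖z‖ < 1) (hw : ‖w‖ ≤ 1) : 0 < (1 - z * conj w).re := by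
  have := (Complex.re_le_norm (z * conj w)).trans_lt (norm_mul_conj_lt_one hz hw)
  rw [Complex.sub_re, Complex.one_re]; linarith

lemma norm_kernel_sub_le {b δ : ℝ} (hb : 0 < b) (hδ0 : 0 < δ) (hδ1 : δ < 1) {u w a : ℂ}
    (hu : u ∈ disk) (hw : w ∈ disk) (ha : a ∈ disk) : ‖kernel b u w - kernel b u a‖ ≤
      (4 + b * 2 ^ (b + 1)) * (‖1 - w * conj a‖ ^ δ *
        (‖1 - u * conj w‖ ^ (-(b + δ)) + ‖1 - u * conj a‖ ^ (-(b + δ)))) := by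
  have hu' := mem_disk.1 hu
  have hw' := mem_disk.1 hw
  have ha' := mem_disk.1 ha
  refine (norm_cpow_neg_sub_le hb hδ0 hδ1 (one_sub_mul_conj_re_pos hu' hw'.le)
    (one_sub_mul_conj_re_pos hu' ha'.le)).trans ?_
  gcongr
  have e : 1 - u * conj w - (1 - u * conj a) = -(u * conj (w - a)) := by
    rw [map_sub]; ring
  rw [e, norm_neg, norm_mul, RCLike.norm_conj]
  exact (mul_le_of_le_one_left (norm_nonneg _) hu'.le).trans
    (norm_sub_le_norm_one_sub_mul_conj hw'.le ha'.le)

lemma enorm_kernel (b : ℝ) (z w : ℂ) :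
    ‖kernel b z w‖ₑ = ENNReal.ofReal (‖1 - z * conj w‖ ^ (-b)) := by
  rw [← ofReal_norm, norm_kernel]

lemma exists_lintegral_kernel_le {β t : ℝ} (hβ : -1 < β) (ht : β + 2 < t) : ∃ C : ℝ, 0 < C ∧
    ∀ a ∈ disk, ∫⁻ u, ENNReal.ofReal (‖1 - u * conj a‖ ^ (-t)) ∂weightedArea β ≤
      ENNReal.ofReal (C * (1 - ‖a‖) ^ (β + 2 - t)) := by
  obtain ⟨C₁, hC₁, h₁, -⟩ := exists_weightedArea_le β hβ
  obtain ⟨C₂, hC₂, h₂⟩ := exists_forelliRudin_le β t hβ ht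
  refine ⟨C₁ * C₂, by positivity, fun a ha => (h₁ _).trans ?_⟩
  rw [mul_assoc, ENNReal.ofReal_mul hC₁.le]
  gcongr
  exact h₂ a ha

lemma exists_lintegral_kernel_log_le {β : ℝ} (hβ : -1 < β) : ∃ C : ℝ, 0 < C ∧
    ∀ a ∈ disk, ∫⁻ u, ‖kernel (2 + β) u a‖ₑ ∂weightedArea β ≤
      ENNReal.ofReal (C * Real.log (2 / (1 - ‖a‖ ^ 2))) := by
  obtain ⟨C₁, hC₁, h₁, -⟩ := exists_weightedArea_le β hβ
  obtain ⟨C₂, hC₂, h₂⟩ := exists_forelliRudin_log_le β hβ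
  refine ⟨C₁ * C₂, by positivity, fun a ha => (h₁ _).trans ?_⟩
  rw [mul_assoc, ENNReal.ofReal_mul hC₁.le]
  gcongr
  refine le_trans (le_of_eq ?_) (h₂ a ha)
  simp only [enorm_kernel, forelliRudin, add_comm]

lemma exists_le_lintegral_kernel_log {β : ℝ} (hβ : -1 < β) : ∃ c : ℝ, 0 < c ∧
    ∀ a : ℂ, 7 / 8 ≤ ‖a‖ → ‖a‖ < 1 → ENNReal.ofReal (Real.log (2 / (1 - ‖a‖ ^ 2))) ≤
      ENNReal.ofReal c * ∫⁻ u, ‖kernel (2 + β) u a‖ₑ ∂weightedArea β := by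
  obtain ⟨C₁, hC₁, -, h₁⟩ := exists_weightedArea_le β hβ
  obtain ⟨c, hc, h₂⟩ := exists_le_forelliRudin_log β hβ
  refine ⟨c⁻¹ * C₁, by positivity, fun a ha ha1 => ?_⟩
  have h3 := (h₂ a ha ha1).trans (h₁ _)
  have e : ENNReal.ofReal (Real.log (2 / (1 - ‖a‖ ^ 2))) =
      ENNReal.ofReal c⁻¹ * ENNReal.ofReal (c * Real.log (2 / (1 - ‖a‖ ^ 2))) := by
    rw [← ENNReal.ofReal_mul (by positivity), inv_mul_cancel_left₀ hc.ne']
  rw [e, ENNReal.ofReal_mul (show (0 : ℝ) ≤ c⁻¹ by positivity) (q := C₁), mul_assoc]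
  gcongr
  refine h3.trans (le_of_eq ?_)
  simp only [enorm_kernel, add_comm]

/-- `L^1` continuity of the kernel in its second argument. -/
lemma exists_lintegral_kernel_sub_le {β δ : ℝ} (hβ : -1 < β) (hδ0 : 0 < δ) (hδ1 : δ < 1) :
    ∃ C : ℝ, 0 < C ∧ ∀ w ∈ disk, ∀ a ∈ disk,
      ∫⁻ u, ‖kernel (2 + β) u w - kernel (2 + β) u a‖ₑ ∂weightedArea β ≤
        ENNReal.ofReal (C * (‖1 - w * conj a‖ ^ δ * ((1 - ‖w‖) ^ (-δ) + (1 - ‖a‖) ^ (-δ)))) := by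
  -- The increment raises the exponent from the critical `2 + β` to `2 + β + δ`. The integrals are
  -- therefore powers and no logarithm appears in the error.
  obtain ⟨C, hC, h⟩ := exists_lintegral_kernel_le (t := 2 + β + δ) hβ (by linarith)
  have hb : 0 < 2 + β := by linarith
  set K := 4 + (2 + β) * 2 ^ (2 + β + 1)
  have hK : 0 < K := by positivity
  refine ⟨K * C, by positivity, fun w hw a ha => ?_⟩
  have hw0 : 0 < 1 - ‖w‖ := by linarith [mem_disk.1 hw]
  have ha0 : 0 < 1 - ‖a‖ := by linarith [mem_disk.1 ha]
  have hcc : Continuous fun z : ℂ => conj z := Complex.continuous_conj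
  calc _ ≤ ∫⁻ u, ENNReal.ofReal (K * ‖1 - w * conj a‖ ^ δ) *
        (ENNReal.ofReal (‖1 - u * conj w‖ ^ (-(2 + β + δ))) +
          ENNReal.ofReal (‖1 - u * conj a‖ ^ (-(2 + β + δ)))) ∂weightedArea β := by
        refine lintegral_mono_ae ((ae_mem_disk (measure_weightedArea_compl β)).mono fun u hu => ?_)
        rw [← ofReal_norm, ← ENNReal.ofReal_add (by positivity) (by positivity),
          ← ENNReal.ofReal_mul (by positivity), mul_assoc]
        exact ENNReal.ofReal_le_ofReal (norm_kernel_sub_le hb hδ0 hδ1 hu hw ha)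
    _ = ENNReal.ofReal (K * ‖1 - w * conj a‖ ^ δ) *
        (∫⁻ u, ENNReal.ofReal (‖1 - u * conj w‖ ^ (-(2 + β + δ))) ∂weightedArea β +
          ∫⁻ u, ENNReal.ofReal (‖1 - u * conj a‖ ^ (-(2 + β + δ))) ∂weightedArea β) := by
        rw [lintegral_const_mul' _ _ ENNReal.ofReal_ne_top, lintegral_add_left (by fun_prop)]
    _ ≤ ENNReal.ofReal (K * ‖1 - w * conj a‖ ^ δ) *
        (ENNReal.ofReal (C * (1 - ‖w‖) ^ (β + 2 - (2 + β + δ))) +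
          ENNReal.ofReal (C * (1 - ‖a‖) ^ (β + 2 - (2 + β + δ)))) := by
        gcongr
        · exact h w hw
        · exact h a ha
    _ = _ := by
        rw [← ENNReal.ofReal_add (by positivity) (by positivity),
          ← ENNReal.ofReal_mul (by positivity), show β + 2 - (2 + β + δ) = -δ by ring]
        congr 1; ring

/-! ### Images of kernels and their approximation by multiples of kernels -/

section

variable (μ : Measure ℂ) (β s : ℝ)

/-- The image under the Toeplitz operator of the kernel `w ↦ (1 - w ā)^(-(s+1))`. -/
noncomputable def kernelImage (a u : ℂ) : ℂ := ∫ w, kernel (s + 1) w a * kernel (2 + β) u w ∂μ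

/-- The `L^1(ω_β)` norm of `kernelImage`. -/
noncomputable def kernelImageNorm (a : ℂ) : ENNReal :=
  ∫⁻ u, ‖kernelImage μ β s a u‖ₑ ∂weightedArea β

/-- The integral of `w ↦ (1 - w ā)^(-(s+1))`. -/
noncomputable def kernelMean (a : ℂ) : ℂ := ∫ w, kernel (s + 1) w a ∂μ

variable {μ β s}

lemma stronglyMeasurable_kernelImage [SFinite μ] :
    StronglyMeasurable fun p : ℂ × ℂ => kernelImage μ β s p.1 p.2 := by
  unfold kernelImage
  refine StronglyMeasurable.integral_prod_right (f := fun (p : ℂ × ℂ) (w : ℂ) =>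
    kernel (s + 1) w p.1 * kernel (2 + β) p.2 w) (Measurable.stronglyMeasurable ?_)
  exact (measurable_kernel (s + 1) measurable_snd measurable_fst.fst).mul
    (measurable_kernel (2 + β) measurable_fst.snd measurable_snd)

lemma measurable_kernelImage_right [SFinite μ] (a : ℂ) :
    Measurable fun u => kernelImage μ β s a u := by
  have h : Measurable (Function.uncurry (kernelImage μ β s)) :=
    (stronglyMeasurable_kernelImage (μ := μ) (β := β) (s := s)).measurable
  exact h.of_uncurry_left (x := a)

lemma integrable_kernel_left [IsFiniteMeasure μ] (hμ : μ diskᶜ = 0) {b : ℝ} (hb : 0 ≤ b) {a : ℂ}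
    (ha : a ∈ disk) : Integrable (fun w => kernel b w a) μ :=
  (integrable_const ((1 - ‖a‖) ^ (-b))).mono'
    (measurable_kernel b measurable_id measurable_const).aestronglyMeasurable
    ((ae_mem_disk hμ).mono fun w hw => by
      rw [norm_kernel_comm]; exact norm_kernel_le b hb (mem_disk.1 ha) (mem_disk.1 hw).le)

lemma kernelImage_sub_eq [IsFiniteMeasure μ] (hμ : μ diskᶜ = 0) (hβ : -1 < β) (hs : 1 < s)
    {a u : ℂ} (ha : a ∈ disk) (hu : u ∈ disk) :
    kernelImage μ β s a u - kernelMean μ s a * kernel (2 + β) u a =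
      ∫ w, kernel (s + 1) w a * (kernel (2 + β) u w - kernel (2 + β) u a) ∂μ := by
  have hi := integrable_kernel_left hμ (b := s + 1) (by linarith) ha
  rw [kernelImage, kernelMean, ← integral_mul_const, ← integral_sub
    (integrable_mul_kernel hμ hi (by linarith) hu) (hi.mul_const _)]
  simp only [mul_sub]

/-- The kernel image is close to a multiple of the kernel. -/
lemma exists_lintegral_kernelImage_sub_le (hβ : -1 < β) (hs : 1 < s) {δ : ℝ} (hδ0 : 0 < δ)
    (hδ1 : δ < 1) : ∃ C : ℝ, 0 < C ∧ ∀ (μ : Measure ℂ) [IsFiniteMeasure μ], μ diskᶜ = 0 →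
      ∀ a ∈ disk,
      ∫⁻ u, ‖kernelImage μ β s a u - kernelMean μ s a * kernel (2 + β) u a‖ₑ ∂weightedArea β ≤
        ENNReal.ofReal C * (carlesonIntegral μ δ (s + 1 - δ) a +
          ENNReal.ofReal ((1 - ‖a‖) ^ (-δ)) * carlesonIntegral μ 0 (s + 1 - δ) a) := by
  obtain ⟨C, hC, h⟩ := exists_lintegral_kernel_sub_le hβ hδ0 hδ1
  refine ⟨C, hC, fun μ _ hμ a ha => ?_⟩
  have ha0 : 0 < 1 - ‖a‖ := by linarith [mem_disk.1 ha]
  have hpt : ∀ u ∈ disk, ‖kernelImage μ β s a u - kernelMean μ s a * kernel (2 + β) u a‖ₑ ≤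
      ∫⁻ w, ‖kernel (s + 1) w a‖ₑ * ‖kernel (2 + β) u w - kernel (2 + β) u a‖ₑ ∂μ := by
    intro u hu
    rw [kernelImage_sub_eq hμ hβ hs ha hu]
    refine (enorm_integral_le_lintegral_enorm _).trans (le_of_eq ?_)
    simp only [enorm_mul]
  calc _ ≤ ∫⁻ u, (∫⁻ w, ‖kernel (s + 1) w a‖ₑ *
        ‖kernel (2 + β) u w - kernel (2 + β) u a‖ₑ ∂μ) ∂weightedArea β :=
        lintegral_mono_ae ((ae_mem_disk (measure_weightedArea_compl β)).mono hpt)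
    _ = ∫⁻ w, (∫⁻ u, ‖kernel (s + 1) w a‖ₑ *
        ‖kernel (2 + β) u w - kernel (2 + β) u a‖ₑ ∂weightedArea β) ∂μ := by
        refine lintegral_lintegral_swap (Measurable.aemeasurable ?_)
        exact (measurable_kernel _ measurable_snd measurable_const).enorm.mul
          ((measurable_kernel _ measurable_fst measurable_snd).sub
            (measurable_kernel _ measurable_fst measurable_const)).enorm
    -- The inner integral is the `L^1` modulus of continuity; its factor `|1 - w ā|^δ` lowers the
    -- kernel exponent from `s + 1` to `s + 1 - δ`.
    _ ≤ ∫⁻ w, ENNReal.ofReal C * (ENNReal.ofReal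
          ((1 - ‖w‖) ^ (-δ) * ‖1 - w * conj a‖ ^ (-(s + 1 - δ))) + ENNReal.ofReal ((1 - ‖a‖) ^ (-δ)) *
          ENNReal.ofReal ((1 - ‖w‖) ^ (-(0 : ℝ)) * ‖1 - w * conj a‖ ^ (-(s + 1 - δ)))) ∂μ := by
        refine lintegral_mono_ae ((ae_mem_disk hμ).mono fun w hw => ?_)
        have hw0 : 0 < 1 - ‖w‖ := by linarith [mem_disk.1 hw]
        have hp : 0 < ‖1 - w * conj a‖ :=
          norm_one_sub_mul_conj_pos (mem_disk.1 hw) (mem_disk.1 ha).le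
        rw [lintegral_const_mul _ (by fun_prop)]
        refine (mul_le_mul_right (h w hw a ha) _).trans (le_of_eq ?_)
        rw [enorm_kernel, ← ENNReal.ofReal_mul (by positivity), ← ENNReal.ofReal_mul (by positivity),
          ← ENNReal.ofReal_add (by positivity) (by positivity), ← ENNReal.ofReal_mul hC.le]
        congr 1
        rw [show -(s + 1 - δ) = -(s + 1) + δ by ring, Real.rpow_add hp, neg_zero, Real.rpow_zero]
        ring
    _ = _ := by
        rw [lintegral_const_mul' _ _ ENNReal.ofReal_ne_top,
          lintegral_add_left (measurable_carleson_integrand _ _ _),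
          lintegral_const_mul' _ _ ENNReal.ofReal_ne_top]
        rfl

/-- The error term in the approximation of the kernel image. -/
noncomputable def kernelImageError (μ : Measure ℂ) (β s : ℝ) (a : ℂ) : ENNReal :=
  ∫⁻ u, ‖kernelImage μ β s a u - kernelMean μ s a * kernel (2 + β) u a‖ₑ ∂weightedArea β

lemma exists_kernelImageError_le [IsFiniteMeasure μ] (hμ : μ diskᶜ = 0) (hβ : -1 < β) (hs : 1 < s)
    (hbox : BoundedBox μ s) : ∃ C : NNReal, ∀ a ∈ disk,
      ENNReal.ofReal (1 - ‖a‖) * kernelImageError μ β s a ≤ C := by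
  obtain ⟨A, hA, hcar⟩ := hbox
  -- Two constraints must hold: `δ < s - 1` for the integral with the weight `(1 - |w|)^(-δ)`, and
  -- `δ < 1` so that `s + 1 - δ` exceeds `s` in the unweighted one.
  set δ := min (1 / 2) ((s - 1) / 2) with hδ
  have hδ0 : 0 < δ := lt_min (by norm_num) (by linarith)
  have hδ1 : δ ≤ 1 / 2 := min_le_left _ _
  have hδ2 : δ ≤ (s - 1) / 2 := min_le_right _ _
  obtain ⟨C, hC, h⟩ := exists_lintegral_kernelImage_sub_le hβ hs hδ0 (by linarith)
  obtain ⟨C₁, hC₁, h₁⟩ := exists_carlesonIntegral_le (s := s) (δ := δ) (t := s + 1 - δ)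
    (by linarith) (by linarith)
  obtain ⟨C₂, hC₂, h₂⟩ := exists_carlesonIntegral_le (s := s) (δ := 0) (t := s + 1 - δ)
    (by linarith) (by linarith)
  refine ⟨(C * (C₁ * A + C₂ * A)).toNNReal, fun a ha => ?_⟩
  have ha0 : 0 < 1 - ‖a‖ := by linarith [mem_disk.1 ha]
  calc _ ≤ ENNReal.ofReal (1 - ‖a‖) * (ENNReal.ofReal C *
        (ENNReal.ofReal (C₁ * A * (1 - ‖a‖) ^ (s - δ - (s + 1 - δ))) +
        ENNReal.ofReal ((1 - ‖a‖) ^ (-δ)) *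
          ENNReal.ofReal (C₂ * A * (1 - ‖a‖) ^ (s - 0 - (s + 1 - δ))))) := by
        refine mul_le_mul_right ((h μ hμ a ha).trans (mul_le_mul_right (add_le_add ?_ ?_) _)) _
        · exact h₁ μ hμ A hA hcar a ha
        · exact mul_le_mul_right (h₂ μ hμ A hA hcar a ha) _
    _ = _ := by
        rw [← ENNReal.ofReal_mul (by positivity), ← ENNReal.ofReal_add (by positivity)
          (by positivity), ← ENNReal.ofReal_mul hC.le, ← ENNReal.ofReal_mul ha0.le,
          ENNReal.ofNNReal_toNNReal]
        congr 1
        have e1 : (1 - ‖a‖) ^ (s - δ - (s + 1 - δ)) = (1 - ‖a‖)⁻¹ := by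
          rw [← Real.rpow_neg_one]; congr 1; ring
        have e2 : (1 - ‖a‖) ^ (-δ) * (1 - ‖a‖) ^ (s - 0 - (s + 1 - δ)) = (1 - ‖a‖)⁻¹ := by
          rw [← Real.rpow_neg_one, ← Real.rpow_add ha0]; congr 1; ring
        calc _ = C * (C₁ * A * ((1 - ‖a‖) * (1 - ‖a‖) ^ (s - δ - (s + 1 - δ))) +
              C₂ * A * ((1 - ‖a‖) * ((1 - ‖a‖) ^ (-δ) * (1 - ‖a‖) ^ (s - 0 - (s + 1 - δ))))) := by
              ring
          _ = _ := by rw [e1, e2, mul_inv_cancel₀ ha0.ne']; ring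

lemma tendsto_kernelImageError [IsFiniteMeasure μ] (hμ : μ diskᶜ = 0) (hβ : -1 < β) (hs : 1 < s)
    (hbox : VanishingBox μ s) :
    Tendsto (fun a => ENNReal.ofReal (1 - ‖a‖) * kernelImageError μ β s a) toCircle (𝓝 0) := by
  set δ := min (1 / 2) ((s - 1) / 2) with hδ
  have hδ0 : 0 < δ := lt_min (by norm_num) (by linarith)
  have hδ1 : δ ≤ 1 / 2 := min_le_left _ _
  have hδ2 : δ ≤ (s - 1) / 2 := min_le_right _ _
  obtain ⟨C, hC, h⟩ := exists_lintegral_kernelImage_sub_le hβ hs hδ0 (by linarith)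
  have h₁ := hbox.tendsto_carlesonIntegral hμ (δ := δ) (t := s + 1 - δ) hδ0.le
    (by linarith) (by linarith)
  have h₂ := hbox.tendsto_carlesonIntegral hμ (δ := 0) (t := s + 1 - δ) le_rfl
    (by linarith) (by linarith)
  have h₃ := ENNReal.Tendsto.const_mul (a := ENNReal.ofReal C) (h₁.add h₂)
    (Or.inr ENNReal.ofReal_ne_top)
  rw [show ENNReal.ofReal C * (0 + 0) = 0 by simp] at h₃
  refine tendsto_of_tendsto_of_tendsto_of_le_of_le' tendsto_const_nhds h₃
    (Eventually.of_forall fun _ => zero_le) (eventually_mem_disk.mono fun a ha => ?_)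
  have ha0 : 0 < 1 - ‖a‖ := by linarith [mem_disk.1 ha]
  refine (mul_le_mul_right (h μ hμ a ha) _).trans (le_of_eq ?_)
  have e1 : (1 - ‖a‖) ^ (s + 1 - δ + δ - s) = 1 - ‖a‖ := by
    conv_rhs => rw [← Real.rpow_one (1 - ‖a‖)]
    congr 1; ring
  have e2 : (1 - ‖a‖) ^ (s + 1 - δ + 0 - s) = (1 - ‖a‖) * (1 - ‖a‖) ^ (-δ) := by
    rw [← Real.rpow_one_add' ha0.le (by linarith)]; congr 1; ring
  rw [e1, e2, ENNReal.ofReal_mul ha0.le]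
  ring

/-- Together with the reverse inequality that follows, this shows that up to the error the norm of
the image is the kernel mean times the norm of a single kernel. -/
lemma kernelImageNorm_le (a : ℂ) : kernelImageNorm μ β s a ≤ kernelImageError μ β s a +
    ‖kernelMean μ s a‖ₑ * ∫⁻ u, ‖kernel (2 + β) u a‖ₑ ∂weightedArea β := by
  rw [kernelImageNorm, kernelImageError, ← lintegral_const_mul _ (by fun_prop),
    ← lintegral_add_right _ (by fun_prop)]
  refine lintegral_mono fun u => ?_
  rw [← enorm_mul]
  simpa using enorm_add_le (kernelImage μ β s a u - kernelMean μ s a * kernel (2 + β) u a)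
    (kernelMean μ s a * kernel (2 + β) u a)

lemma enorm_kernelMean_mul_le [SFinite μ] (a : ℂ) :
    ‖kernelMean μ s a‖ₑ * ∫⁻ u, ‖kernel (2 + β) u a‖ₑ ∂weightedArea β ≤
      kernelImageError μ β s a + kernelImageNorm μ β s a := by
  rw [kernelImageNorm, kernelImageError, ← lintegral_const_mul _ (by fun_prop),
    ← lintegral_add_right _ (measurable_kernelImage_right a).enorm]
  refine lintegral_mono fun u => ?_
  rw [← enorm_mul, ← enorm_neg (kernelMean μ s a * kernel (2 + β) u a)]
  have := enorm_add_le (kernelImage μ β s a u - kernelMean μ s a * kernel (2 + β) u a)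
    (-kernelImage μ β s a u)
  rw [enorm_neg (kernelImage μ β s a u)] at this
  refine le_trans (le_of_eq ?_) this
  congr 1; ring

end

end ToeplitzBergman

/-! ### The Toeplitz operator expressed through kernel images -/

namespace ToeplitzBergman
open MeasureTheory Filter Topology ComplexConjugate Set

lemma MemBergman.one_of_le_one {p α : ℝ} (hp : 0 < p) (hp1 : p ≤ 1) (hα : -1 < α) {f : ℂ → ℂ}
    (hf : MemBergman p α f) : MemBergman 1 ((2 + α) / p - 2) f := by
  obtain ⟨C, hC⟩ := exists_bergmanNorm_one_le hp hp1 hα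
  exact ⟨hf.1, (hC f hf).trans_lt (ENNReal.mul_lt_top ENNReal.coe_lt_top hf.2)⟩

lemma IsBoundedSeq.one_of_le_one {p α : ℝ} (hp : 0 < p) (hp1 : p ≤ 1) (hα : -1 < α)
    {f : ℕ → ℂ → ℂ} (hf : IsBoundedSeq p α f) : IsBoundedSeq 1 ((2 + α) / p - 2) f := by
  obtain ⟨C, hC⟩ := exists_bergmanNorm_one_le hp hp1 hα
  obtain ⟨hm, B, hB⟩ := hf
  refine ⟨fun n => (hm n).one_of_le_one hp hp1 hα, C * B, fun n => (hC _ (hm n)).trans ?_⟩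
  rw [ENNReal.coe_mul]
  exact mul_le_mul_right (hB n) _

section

variable {μ : Measure ℂ} {β s : ℝ} {f : ℂ → ℂ}

lemma exists_lintegral_kernel_le_of_boundedBox [SFinite μ] (hμ : μ diskᶜ = 0) (hs : 1 < s)
    (hbox : BoundedBox μ s) : ∃ C : NNReal, ∀ z ∈ disk,
      ENNReal.ofReal (1 - ‖z‖) * ∫⁻ w, ‖kernel (s + 1) w z‖ₑ ∂μ ≤ C := by
  obtain ⟨A, hA, h⟩ := hbox
  obtain ⟨C, hC, hK⟩ := exists_carlesonIntegral_le (s := s) (δ := 0) (t := s + 1)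
    (by linarith) (by linarith)
  refine ⟨(C * A).toNNReal, fun z hz => ?_⟩
  have hz0 : 0 < 1 - ‖z‖ := by linarith [mem_disk.1 hz]
  have := hK μ hμ A hA h z hz
  simp only [carlesonIntegral, neg_zero, Real.rpow_zero, one_mul] at this
  simp only [enorm_kernel]
  refine (mul_le_mul_right this _).trans (le_of_eq ?_)
  rw [← ENNReal.ofReal_mul hz0.le, show s - 0 - (s + 1) = -1 by ring, Real.rpow_neg_one,
    ENNReal.ofNNReal_toNNReal]
  congr 1
  field_simp

/-- This finiteness justifies both the absolute convergence of the Toeplitz integrals and the use of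
Fubini. -/
lemma lintegral_mul_lintegral_kernel_lt_top [SFinite μ] (hμ : μ diskᶜ = 0) (hs : 1 < s)
    (hbox : BoundedBox μ s) (hf : MemBergman 1 (s - 2) f) :
    ∫⁻ z, ‖f z‖ₑ * (∫⁻ w, ‖kernel (s + 1) w z‖ₑ ∂μ) ∂weightedArea (s - 1) < ⊤ := by
  obtain ⟨C, hC⟩ := exists_lintegral_kernel_le_of_boundedBox hμ hs hbox
  have := lintegral_mul_weightedArea_add_one_le (γ := s - 2) (by linarith) f hC
    ENNReal.coe_ne_top
  rw [show s - 2 + 1 = s - 1 by ring] at this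
  exact this.trans_lt (ENNReal.mul_lt_top
    (ENNReal.mul_lt_top ENNReal.ofReal_lt_top ENNReal.coe_lt_top) hf.2)

lemma MemBergman.integrable_of_boundedBox [SFinite μ] (hμ : μ diskᶜ = 0) (hs : 1 < s)
    (hbox : BoundedBox μ s) (hf : MemBergman 1 (s - 2) f) : Integrable f μ := by
  refine ⟨aemeasurable_of_differentiableOn hf.1 hμ, ?_⟩
  have := lintegral_mul_le_lintegral_kernel (γ := s - 2) (by linarith) hf hμ (φ := fun _ => 1)
    measurable_const
  simp only [mul_one, one_mul, show s - 2 + 1 = s - 1 by ring,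
    show s - 2 + 3 = s + 1 by ring] at this
  exact this.trans_lt (lintegral_mul_lintegral_kernel_lt_top hμ hs hbox hf)

/-- The Toeplitz operator through its values on kernels. -/
lemma toeplitz_eq_integral_kernelImage [SFinite μ] (hμ : μ diskᶜ = 0) (hβ : -1 < β) (hs : 1 < s)
    (hbox : BoundedBox μ s) (hf : MemBergman 1 (s - 2) f) {u : ℂ} (hu : u ∈ disk) :
    toeplitz μ β f u = ∫ z, f z * kernelImage μ β s z u ∂weightedArea (s - 1) := by
  have hfm := aemeasurable_of_differentiableOn hf.1 (measure_weightedArea_compl (s - 1))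
  have hk : Measurable fun q : ℂ × ℂ => kernel (s + 1) q.1 q.2 * kernel (2 + β) u q.1 :=
    (measurable_kernel _ measurable_fst measurable_snd).mul
      (measurable_kernel _ measurable_const measurable_fst)
  have hint : Integrable (Function.uncurry fun w z =>
      f z * (kernel (s + 1) w z * kernel (2 + β) u w)) (μ.prod (weightedArea (s - 1))) := by
    have hm : AEStronglyMeasurable (Function.uncurry fun w z =>
        f z * (kernel (s + 1) w z * kernel (2 + β) u w)) (μ.prod (weightedArea (s - 1))) :=
      (hfm.comp_snd (μ := μ)).mul hk.aestronglyMeasurable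
    refine ⟨hm, ?_⟩
    rw [HasFiniteIntegral, lintegral_prod_symm _ hm.enorm]
    have hle : ∀ z, ∫⁻ w, ‖f z * (kernel (s + 1) w z * kernel (2 + β) u w)‖ₑ ∂μ ≤
        ENNReal.ofReal ((1 - ‖u‖) ^ (-(2 + β))) *
          (‖f z‖ₑ * ∫⁻ w, ‖kernel (s + 1) w z‖ₑ ∂μ) := fun z => by
      rw [← lintegral_const_mul' _ _ enorm_ne_top,
        ← lintegral_const_mul' _ _ ENNReal.ofReal_ne_top]
      refine lintegral_mono_ae ((ae_mem_disk hμ).mono fun w hw => ?_)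
      simp only [enorm_mul]
      have : ‖kernel (2 + β) u w‖ₑ ≤ ENNReal.ofReal ((1 - ‖u‖) ^ (-(2 + β))) := by
        rw [← ofReal_norm]
        exact ENNReal.ofReal_le_ofReal
          (norm_kernel_le _ (by linarith) (mem_disk.1 hu) (mem_disk.1 hw).le)
      calc _ = ‖kernel (2 + β) u w‖ₑ * (‖f z‖ₑ * ‖kernel (s + 1) w z‖ₑ) := by ring
        _ ≤ _ := mul_le_mul_left this _
    refine (lintegral_mono hle).trans_lt ?_
    rw [lintegral_const_mul' _ _ ENNReal.ofReal_ne_top]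
    exact ENNReal.mul_lt_top ENNReal.ofReal_lt_top
      (lintegral_mul_lintegral_kernel_lt_top hμ hs hbox hf)
  -- With the order exchanged, the inner integral over `z` is the reproducing formula for `f(w)`.
  have hswap := integral_integral_swap hint
  simp only [integral_const_mul] at hswap
  rw [toeplitz_eq, ← show ∫ z, f z * (∫ w, kernel (s + 1) w z * kernel (2 + β) u w ∂μ)
    ∂weightedArea (s - 1) = ∫ z, f z * kernelImage μ β s z u ∂weightedArea (s - 1) from rfl,
    ← hswap]
  refine integral_congr_ae ((ae_mem_disk hμ).mono fun w hw => ?_)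
  have := hf.integral_mul_kernel (by linarith) hw
  rw [show s - 2 + 1 = s - 1 by ring, show s - 2 + 3 = s + 1 by ring] at this
  simp only [← mul_assoc, integral_mul_const, this]

/-- Minkowski's integral inequality in `L^1(ω_β)`. This makes the kernels sufficient test functions
for the whole operator. -/
lemma bergmanNorm_toeplitz_le [SFinite μ] (hμ : μ diskᶜ = 0) (hβ : -1 < β) (hs : 1 < s)
    (hbox : BoundedBox μ s) (hf : MemBergman 1 (s - 2) f) :
    bergmanNorm 1 β (toeplitz μ β f) ≤
      ∫⁻ z, ‖f z‖ₑ * kernelImageNorm μ β s z ∂weightedArea (s - 1) := by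
  have hfm := aemeasurable_of_differentiableOn hf.1 (measure_weightedArea_compl (s - 1))
  have hk : Measurable fun q : ℂ × ℂ => ‖kernelImage μ β s q.2 q.1‖ₑ :=
    ((stronglyMeasurable_kernelImage (μ := μ) (β := β) (s := s)).measurable.comp
      measurable_swap).enorm
  rw [bergmanNorm_one]
  calc _ ≤ ∫⁻ u, (∫⁻ z, ‖f z‖ₑ * ‖kernelImage μ β s z u‖ₑ ∂weightedArea (s - 1))
        ∂weightedArea β := by
        refine lintegral_mono_ae ((ae_mem_disk (measure_weightedArea_compl β)).mono fun u hu => ?_)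
        rw [toeplitz_eq_integral_kernelImage hμ hβ hs hbox hf hu]
        refine (enorm_integral_le_lintegral_enorm _).trans (le_of_eq ?_)
        simp only [enorm_mul]
    _ = ∫⁻ z, (∫⁻ u, ‖f z‖ₑ * ‖kernelImage μ β s z u‖ₑ ∂weightedArea β)
        ∂weightedArea (s - 1) :=
        lintegral_lintegral_swap ((hfm.comp_snd (μ := weightedArea β)).enorm.mul hk.aemeasurable)
    _ = _ := by
        simp only [lintegral_const_mul' _ _ enorm_ne_top]
        rfl

lemma differentiableOn_toeplitz (hμ : μ diskᶜ = 0) (hβ : -1 < β) (hf : Integrable f μ) :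
    DifferentiableOn ℂ (toeplitz μ β f) disk := by
  have := differentiableOn_integral_kernel hμ hf (b := 2 + β) (by linarith)
  exact this.congr fun z _ => toeplitz_eq μ β f z

lemma integrable_toeplitzIntegrand (hμ : μ diskᶜ = 0) (hβ : -1 < β) (hf : Integrable f μ)
    {z : ℂ} (hz : z ∈ disk) : Integrable (toeplitzIntegrand β f z) μ := by
  have := integrable_mul_kernel hμ hf (b := 2 + β) (by linarith) hz
  exact this.congr (Eventually.of_forall fun w => (toeplitzIntegrand_eq β f z w).symm)

/-- A bound for the images of the kernels yields a bound for the operator. -/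
lemma toeplitzMaps_of_kernelImageNorm_le {p α : ℝ} (hp : 0 < p) (hp1 : p ≤ 1) (hα : -1 < α)
    (hβ : -1 < β) [SFinite μ] (hμ : μ diskᶜ = 0) (hbox : BoundedBox μ ((2 + α) / p))
    {A : NNReal} (hA : ∀ a ∈ disk,
      ENNReal.ofReal (1 - ‖a‖) * kernelImageNorm μ β ((2 + α) / p) a ≤ A) :
    ToeplitzMaps μ p α 1 β := by
  intro f hf
  have hs : 1 < (2 + α) / p := by rw [lt_div_iff₀ hp]; linarith
  have hf1 := hf.one_of_le_one hp hp1 hα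
  have hfi := hf1.integrable_of_boundedBox hμ hs hbox
  refine ⟨fun z hz => integrable_toeplitzIntegrand hμ hβ hfi hz,
    differentiableOn_toeplitz hμ hβ hfi, (bergmanNorm_toeplitz_le hμ hβ hs hbox hf1).trans_lt ?_⟩
  have := lintegral_mul_weightedArea_add_one_le (γ := (2 + α) / p - 2) (by linarith) f hA
    ENNReal.coe_ne_top
  rw [show (2 + α) / p - 2 + 1 = (2 + α) / p - 1 by ring] at this
  exact this.trans_lt (ENNReal.mul_lt_top
    (ENNReal.mul_lt_top ENNReal.ofReal_lt_top ENNReal.coe_lt_top) hf1.2)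

/-- The norm of `T f_n` is dominated by an integral of `|f_n|` against the kernel norms, and the
latter become, after the change of weight, a bounded multiplier vanishing at the circle. -/
lemma toeplitzCompact_of_tendsto_kernelImageNorm {p α : ℝ} (hp : 0 < p) (hp1 : p ≤ 1)
    (hα : -1 < α) (hβ : -1 < β) [SFinite μ] (hμ : μ diskᶜ = 0)
    (hbox : BoundedBox μ ((2 + α) / p)) {A : NNReal} (hA : ∀ a ∈ disk,
      ENNReal.ofReal (1 - ‖a‖) * kernelImageNorm μ β ((2 + α) / p) a ≤ A)
    (h : Tendsto (fun a => ENNReal.ofReal (1 - ‖a‖) * kernelImageNorm μ β ((2 + α) / p) a)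
      toCircle (𝓝 0)) :
    ToeplitzCompact μ p α 1 β := by
  refine ⟨toeplitzMaps_of_kernelImageNorm_le hp hp1 hα hβ hμ hbox hA, fun f hf hf0 => ?_⟩
  have hs : 1 < (2 + α) / p := by rw [lt_div_iff₀ hp]; linarith
  have hf1 := hf.one_of_le_one hp hp1 hα
  have := tendsto_lintegral_add_one_of_null (γ := (2 + α) / p - 2) (by linarith) hf1 hf0 hA
    ENNReal.coe_ne_top h
  rw [show (2 + α) / p - 2 + 1 = (2 + α) / p - 1 by ring] at this
  exact tendsto_of_tendsto_of_tendsto_of_le_of_le tendsto_const_nhds this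
    (fun _ => zero_le) fun n => bergmanNorm_toeplitz_le hμ hβ hs hbox (hf1.1 n)

end

end ToeplitzBergman

/-! ### Kernel means and the logarithmic Bloch condition -/

namespace ToeplitzBergman
open MeasureTheory Filter Topology ComplexConjugate Set

lemma log_two_div_nonneg {a : ℂ} (ha : a ∈ disk) : 0 ≤ Real.log (2 / (1 - ‖a‖ ^ 2)) := by
  have h := mem_disk.1 ha
  have h0 : 0 < 1 - ‖a‖ ^ 2 := by nlinarith [norm_nonneg a]
  exact Real.log_nonneg ((one_le_div h0).2 (by nlinarith [sq_nonneg ‖a‖]))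

/-- A logarithm is dominated by any power, here through `log x ≤ 4 x^(1/4)`. It disposes of the
undifferentiated symbol in the Bloch condition. -/
lemma rpow_half_mul_log_le {a : ℂ} (ha : a ∈ disk) :
    (1 - ‖a‖) ^ (1 / 2 : ℝ) * Real.log (2 / (1 - ‖a‖ ^ 2)) ≤ 8 * (1 - ‖a‖) ^ (1 / 4 : ℝ) := by
  have h := mem_disk.1 ha
  have h0 : 0 < 1 - ‖a‖ := by linarith
  have h1 := (one_sub_sq_comparable (norm_nonneg a) h).2
  have h2 : Real.log (2 / (1 - ‖a‖ ^ 2)) ≤ 8 * (1 - ‖a‖) ^ (-(1 / 4) : ℝ) := by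
    calc _ ≤ (2 / (1 - ‖a‖ ^ 2)) ^ (1 / 4 : ℝ) / (1 / 4) :=
          Real.log_le_rpow_div (div_nonneg zero_le_two (h0.le.trans h1)) (by norm_num)
      _ ≤ (2 / (1 - ‖a‖)) ^ (1 / 4 : ℝ) / (1 / 4) := by
          gcongr
          exact div_nonneg zero_le_two (h0.le.trans h1)
      _ = 4 * (2 ^ (1 / 4 : ℝ) * (1 - ‖a‖) ^ (-(1 / 4) : ℝ)) := by
          rw [Real.div_rpow zero_le_two h0.le, Real.rpow_neg h0.le]; ring
      _ ≤ 4 * (2 ^ (1 : ℝ) * (1 - ‖a‖) ^ (-(1 / 4) : ℝ)) := by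
          gcongr <;> norm_num
      _ = _ := by rw [Real.rpow_one]; ring
  calc _ ≤ (1 - ‖a‖) ^ (1 / 2 : ℝ) * (8 * (1 - ‖a‖) ^ (-(1 / 4) : ℝ)) := by gcongr
    _ = _ := by
      rw [mul_left_comm, ← Real.rpow_add h0]; norm_num

section

variable {μ : Measure ℂ} {s : ℝ}

lemma toeplitz_one_eq (a : ℂ) :
    toeplitz μ (s - 2) (fun _ => 1) a = ∫ w, kernel s a w ∂μ := by
  rw [toeplitz_eq, show 2 + (s - 2) = s by ring]
  simp only [one_mul]

/-- The exponent `s` is critical for the box condition. Using `|1 - w ā| ≤ 2` to raise it to `s +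
1/2` costs half a power but stays in the range of the kernel estimate; the growth obtained is crude
but sufficient. -/
lemma exists_norm_toeplitz_one_le [SFinite μ] (hμ : μ diskᶜ = 0) (hs : 1 < s)
    (hbox : BoundedBox μ s) : ∃ C : ℝ, 0 ≤ C ∧ ∀ a ∈ disk,
      ‖toeplitz μ (s - 2) (fun _ => 1) a‖ ≤ C * (1 - ‖a‖) ^ (-(1 / 2) : ℝ) := by
  obtain ⟨A, hA, h⟩ := hbox
  obtain ⟨C, hC, hK⟩ := exists_carlesonIntegral_le (s := s) (δ := 0) (t := s + 1 / 2)
    (by linarith) (by linarith)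
  refine ⟨2 ^ (1 / 2 : ℝ) * (C * A), by positivity, fun a ha => ?_⟩
  have ha' := mem_disk.1 ha
  have ha0 : 0 < 1 - ‖a‖ := by linarith
  have h1 : ‖∫ w, kernel s a w ∂μ‖ₑ ≤
      ENNReal.ofReal (2 ^ (1 / 2 : ℝ) * (C * A) * (1 - ‖a‖) ^ (-(1 / 2) : ℝ)) := by
    calc _ ≤ ∫⁻ w, ‖kernel s a w‖ₑ ∂μ := enorm_integral_le_lintegral_enorm _
      _ ≤ ∫⁻ w, ENNReal.ofReal (2 ^ (1 / 2 : ℝ)) *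
          ENNReal.ofReal ((1 - ‖w‖) ^ (-(0 : ℝ)) * ‖1 - w * conj a‖ ^ (-(s + 1 / 2))) ∂μ := by
          refine lintegral_mono_ae ((ae_mem_disk hμ).mono fun w hw => ?_)
          have hw' := mem_disk.1 hw
          have hp := norm_one_sub_mul_conj_pos hw' ha'.le
          have h2 := norm_one_sub_mul_conj_le_two hw'.le ha'.le
          rw [neg_zero, Real.rpow_zero, one_mul, ← ENNReal.ofReal_mul (by positivity),
            ← ofReal_norm, norm_kernel_comm, norm_kernel]
          refine ENNReal.ofReal_le_ofReal ?_
          rw [show -s = 1 / 2 + -(s + 1 / 2) by ring, Real.rpow_add hp]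
          gcongr
      _ = ENNReal.ofReal (2 ^ (1 / 2 : ℝ)) * carlesonIntegral μ 0 (s + 1 / 2) a :=
          lintegral_const_mul' _ _ ENNReal.ofReal_ne_top
      _ ≤ ENNReal.ofReal (2 ^ (1 / 2 : ℝ)) *
          ENNReal.ofReal (C * A * (1 - ‖a‖) ^ (s - 0 - (s + 1 / 2))) :=
          mul_le_mul_right (hK μ hμ A hA h a ha) _
      _ = _ := by
          rw [← ENNReal.ofReal_mul (by positivity), show s - 0 - (s + 1 / 2) = -(1 / 2) by ring,
            mul_assoc (2 ^ (1 / 2 : ℝ) : ℝ)]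
  rw [toeplitz_one_eq]
  rw [← ofReal_norm] at h1
  exact (ENNReal.ofReal_le_ofReal_iff (by positivity)).1 h1

/-- Differentiating `(1 - a w̄)^(-s)` in `a` and writing `a w̄ = 1 - (1 - a w̄)` produces `s` times
the difference of the kernels of exponents `s + 1` and `s`. The conjugate appears because `a` sits
in the second slot of the kernel mean. -/
lemma conj_kernelMean_eq [IsFiniteMeasure μ] (hμ : μ diskᶜ = 0) (hs : 0 < s) {a : ℂ}
    (ha : a ∈ disk) : s * conj (kernelMean μ s a) =
      s * toeplitz μ (s - 2) (fun _ => 1) a + a * deriv (toeplitz μ (s - 2) fun _ => 1) a := by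
  have hi : Integrable (fun _ : ℂ => (1 : ℂ)) μ := integrable_const 1
  have hd := (hasDerivAt_integral_kernel hμ hi hs.le ha).deriv
  have hfun : toeplitz μ (s - 2) (fun _ => 1) = fun z => ∫ w, 1 * kernel s z w ∂μ := by
    funext z; rw [toeplitz_one_eq]; simp only [one_mul]
  have hI₁ := integrable_mul_kernel hμ hi hs.le ha
  have hI₂ := integrable_mul_kernel hμ hi (b := s + 1) (by linarith) ha
  rw [hfun, hd, kernelMean, ← integral_conj, ← integral_const_mul, ← integral_const_mul,
    ← integral_const_mul]
  have key : ∀ w ∈ disk, a * (1 * (s * conj w * kernel (s + 1) a w)) =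
      s * (1 * kernel (s + 1) a w) - s * (1 * kernel s a w) := fun w hw => by
    rw [kernel_eq_mul_kernel_add_one s (mem_disk.1 ha) (mem_disk.1 hw).le]
    ring
  rw [← integral_add (hI₁.const_mul _)]
  · refine integral_congr_ae ((ae_mem_disk hμ).mono fun w hw => ?_)
    simp only [key w hw, conj_kernel (s + 1) (mem_disk.1 hw) (mem_disk.1 ha).le]
    ring
  · exact ((hI₂.const_mul _).sub (hI₁.const_mul _)).congr
      ((ae_mem_disk hμ).mono fun w hw => (key w hw).symm)

/-- The logarithmic Bloch condition on the symbol in terms of kernel means. -/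
lemma memLittleLogBloch_iff [IsFiniteMeasure μ] (hμ : μ diskᶜ = 0) (hs : 1 < s)
    (hbox : BoundedBox μ s) :
    MemLittleLogBloch 1 (toeplitz μ (s - 2) fun _ => 1) ↔
      Tendsto (fun a => (1 - ‖a‖) * Real.log (2 / (1 - ‖a‖ ^ 2)) * ‖kernelMean μ s a‖)
        toCircle (𝓝 0) := by
  obtain ⟨C, hC, hG⟩ := exists_norm_toeplitz_one_le hμ hs hbox
  have hs0 : 0 < s := by linarith
  set G := toeplitz μ (s - 2) fun _ => 1 with hGdef
  -- The value of `G` is negligible in both directions, so only its derivative has to be compared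
  -- with the kernel mean.
  have hG0 : Tendsto (fun a => (1 - ‖a‖) * Real.log (2 / (1 - ‖a‖ ^ 2)) * ‖G a‖)
      toCircle (𝓝 0) := by
    have h0 : Tendsto (fun a : ℂ => C * (8 * (1 - ‖a‖) ^ (1 / 4 : ℝ))) toCircle (𝓝 0) := by
      simpa using ((tendsto_one_sub_norm_rpow (κ := 1 / 4) (by norm_num)).const_mul 8).const_mul C
    refine tendsto_of_tendsto_of_tendsto_of_le_of_le' tendsto_const_nhds h0
      (eventually_mem_disk.mono fun a ha => ?_) (eventually_mem_disk.mono fun a ha => ?_)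
    · have := log_two_div_nonneg ha
      have ha0 : 0 < 1 - ‖a‖ := by linarith [mem_disk.1 ha]
      positivity
    · have hl := log_two_div_nonneg ha
      have ha0 : 0 < 1 - ‖a‖ := by linarith [mem_disk.1 ha]
      calc _ ≤ (1 - ‖a‖) * Real.log (2 / (1 - ‖a‖ ^ 2)) * (C * (1 - ‖a‖) ^ (-(1 / 2) : ℝ)) := by
            gcongr; exact hG a ha
        _ = C * ((1 - ‖a‖) ^ (1 / 2 : ℝ) * Real.log (2 / (1 - ‖a‖ ^ 2))) := by
            rw [show (1 / 2 : ℝ) = 1 + -(1 / 2) by norm_num, Real.rpow_add ha0, Real.rpow_one]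
            norm_num
            ring
        _ ≤ _ := mul_le_mul_of_nonneg_left (rpow_half_mul_log_le ha) hC
  have hid := fun a (ha : a ∈ disk) => conj_kernelMean_eq hμ hs0 ha
  constructor
  · rintro ⟨-, h⟩
    have h0 := hG0.add (h.const_mul s⁻¹)
    rw [mul_zero, add_zero] at h0
    refine tendsto_of_tendsto_of_tendsto_of_le_of_le' tendsto_const_nhds h0
      (eventually_mem_disk.mono fun a ha => ?_) (eventually_mem_disk.mono fun a ha => ?_)
    · have := log_two_div_nonneg ha
      have ha0 : 0 < 1 - ‖a‖ := by linarith [mem_disk.1 ha]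
      positivity
    · have hl := log_two_div_nonneg ha
      have ha' := mem_disk.1 ha
      have ha0 : 0 < 1 - ‖a‖ := by linarith
      have hle : ‖kernelMean μ s a‖ ≤ ‖G a‖ + s⁻¹ * ‖deriv G a‖ := by
        have h1 : s * ‖kernelMean μ s a‖ ≤ s * ‖G a‖ + 1 * ‖deriv G a‖ := by
          have := congrArg norm (hid a ha)
          rw [norm_mul, Complex.norm_real, Real.norm_of_nonneg hs0.le, RCLike.norm_conj] at this
          rw [this]
          refine (norm_add_le _ _).trans ?_
          rw [norm_mul, norm_mul, Complex.norm_real, Real.norm_of_nonneg hs0.le]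
          gcongr
        have h2 : ‖kernelMean μ s a‖ = s⁻¹ * (s * ‖kernelMean μ s a‖) := by field_simp
        rw [h2]
        calc _ ≤ s⁻¹ * (s * ‖G a‖ + 1 * ‖deriv G a‖) := by gcongr
          _ = _ := by field_simp
      have hsq := (one_sub_sq_comparable (norm_nonneg a) ha').2
      rw [Real.rpow_one]
      calc _ ≤ (1 - ‖a‖) * Real.log (2 / (1 - ‖a‖ ^ 2)) * (‖G a‖ + s⁻¹ * ‖deriv G a‖) := by gcongr
        _ = (1 - ‖a‖) * Real.log (2 / (1 - ‖a‖ ^ 2)) * ‖G a‖ +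
            s⁻¹ * ((1 - ‖a‖) * Real.log (2 / (1 - ‖a‖ ^ 2)) * ‖deriv G a‖) := by ring
        _ ≤ _ := by gcongr
  · intro h
    refine ⟨differentiableOn_toeplitz hμ (by linarith) (integrable_const 1), ?_⟩
    have h0 := (h.add hG0).const_mul (4 * s)
    rw [add_zero, mul_zero] at h0
    refine tendsto_of_tendsto_of_tendsto_of_le_of_le' tendsto_const_nhds h0
      (eventually_mem_disk.mono fun a ha => ?_)
      (eventually_toCircle.2 ⟨1 / 2, by norm_num, fun a ha2 ha' => ?_⟩)
    · have := log_two_div_nonneg ha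
      have : 0 < 1 - ‖a‖ ^ 2 := by nlinarith [norm_nonneg a, mem_disk.1 ha]
      positivity
    · have ha := mem_disk.2 ha'
      have hl := log_two_div_nonneg ha
      have ha0 : 0 < 1 - ‖a‖ := by linarith
      -- Restricting to `|a| > 1/2` allows division by the factor `a` that multiplies `G'(a)`.
      have hle : ‖deriv G a‖ ≤ 2 * s * (‖kernelMean μ s a‖ + ‖G a‖) := by
        have h1 : ‖a‖ * ‖deriv G a‖ ≤ s * ‖kernelMean μ s a‖ + s * ‖G a‖ := by
          have h2 : a * deriv G a = s * conj (kernelMean μ s a) - s * G a := by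
            rw [hid a ha]; ring
          rw [← norm_mul, h2]
          refine (norm_sub_le _ _).trans ?_
          rw [norm_mul, norm_mul, Complex.norm_real, Real.norm_of_nonneg hs0.le, RCLike.norm_conj]
        nlinarith [norm_nonneg (deriv G a)]
      have hsq := (one_sub_sq_comparable (norm_nonneg a) ha').1
      rw [Real.rpow_one]
      calc _ ≤ 2 * (1 - ‖a‖) * Real.log (2 / (1 - ‖a‖ ^ 2)) *
            (2 * s * (‖kernelMean μ s a‖ + ‖G a‖)) := by gcongr
        _ = _ := by ring

end

end ToeplitzBergman

/-! ### Norms of kernel images versus kernel means; sufficiency -/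

namespace ToeplitzBergman
open MeasureTheory Filter Topology ComplexConjugate Set

variable {μ : Measure ℂ} {β s : ℝ}

/-- On a compact disc the error, the kernel mean and the logarithm are all bounded, so a bound near
the circle extends to the whole disk. -/
lemma exists_kernelImageNorm_le_of_norm_le [IsFiniteMeasure μ] (hμ : μ diskᶜ = 0) (hβ : -1 < β)
    (hs : 1 < s) (hbox : BoundedBox μ s) {R : ℝ} (hR : R < 1) : ∃ A : NNReal, ∀ a, ‖a‖ ≤ R →
      ENNReal.ofReal (1 - ‖a‖) * kernelImageNorm μ β s a ≤ A := by
  obtain ⟨E, hE⟩ := exists_kernelImageError_le hμ hβ hs hbox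
  obtain ⟨C, hC, hL⟩ := exists_lintegral_kernel_log_le hβ
  refine ⟨E + (μ.real univ * (1 - R) ^ (-(s + 1)) *
    (C * Real.log (2 / (1 - R ^ 2)))).toNNReal, fun a ha => ?_⟩
  have had : a ∈ disk := mem_disk.2 (ha.trans_lt hR)
  have ha0 : 0 < 1 - ‖a‖ := by linarith
  have hR0 : 0 ≤ R := (norm_nonneg a).trans ha
  have hR1 : 0 < 1 - R := by linarith
  have hR2 : 0 < 1 - R ^ 2 := by nlinarith
  have hF : ‖kernelMean μ s a‖ₑ ≤ ENNReal.ofReal (μ.real univ * (1 - R) ^ (-(s + 1))) := by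
    rw [← ofReal_norm]
    refine ENNReal.ofReal_le_ofReal ?_
    have := norm_integral_le_of_norm_le_const (μ := μ) (f := fun w => kernel (s + 1) w a)
      (C := (1 - R) ^ (-(s + 1))) ((ae_mem_disk hμ).mono fun w hw => by
        rw [norm_kernel_comm]
        refine (norm_kernel_le (s + 1) (by linarith) (mem_disk.1 had) (mem_disk.1 hw).le).trans ?_
        exact Real.rpow_le_rpow_of_nonpos hR1 (by linarith) (by linarith))
    rw [mul_comm]
    exact this
  have hlog : ENNReal.ofReal (C * Real.log (2 / (1 - ‖a‖ ^ 2))) ≤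
      ENNReal.ofReal (C * Real.log (2 / (1 - R ^ 2))) := by
    have h1 : ‖a‖ ^ 2 ≤ R ^ 2 := by gcongr
    have h2 : 0 < 1 - ‖a‖ ^ 2 := by linarith
    refine ENNReal.ofReal_le_ofReal (mul_le_mul_of_nonneg_left ?_ hC.le)
    gcongr
  rw [ENNReal.coe_add, ENNReal.ofNNReal_toNNReal, ENNReal.ofReal_mul (by positivity)]
  calc _ ≤ ENNReal.ofReal (1 - ‖a‖) * (kernelImageError μ β s a +
        ‖kernelMean μ s a‖ₑ * ∫⁻ u, ‖kernel (2 + β) u a‖ₑ ∂weightedArea β) :=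
        mul_le_mul_right (kernelImageNorm_le a) _
    _ = ENNReal.ofReal (1 - ‖a‖) * kernelImageError μ β s a + ENNReal.ofReal (1 - ‖a‖) *
        (‖kernelMean μ s a‖ₑ * ∫⁻ u, ‖kernel (2 + β) u a‖ₑ ∂weightedArea β) := mul_add _ _ _
    _ ≤ _ := by
        refine add_le_add (hE a had) ((mul_le_of_le_one_left zero_le ?_).trans
          (mul_le_mul' hF ((hL a had).trans hlog)))
        exact ENNReal.ofReal_le_one.2 (by linarith [norm_nonneg a])

lemma exists_kernelImageNorm_le [IsFiniteMeasure μ] (hμ : μ diskᶜ = 0) (hβ : -1 < β)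
    (hs : 1 < s) (hbox : BoundedBox μ s) {B : NNReal} (h : ∀ᶠ a in toCircle,
      ENNReal.ofReal (1 - ‖a‖) * kernelImageNorm μ β s a ≤ B) :
    ∃ A : NNReal, ∀ a ∈ disk, ENNReal.ofReal (1 - ‖a‖) * kernelImageNorm μ β s a ≤ A := by
  obtain ⟨R, hR, h⟩ := eventually_toCircle.1 h
  obtain ⟨A, hA⟩ := exists_kernelImageNorm_le_of_norm_le hμ hβ hs hbox hR
  refine ⟨A + B, fun a ha => ?_⟩
  rw [ENNReal.coe_add]
  rcases le_or_gt ‖a‖ R with h1 | h1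
  · exact (hA a h1).trans le_self_add
  · exact (h a h1 (mem_disk.1 ha)).trans le_add_self

/-- The norms of the kernel images are governed by the kernel means. -/
lemma tendsto_kernelImageNorm_iff [IsFiniteMeasure μ] (hμ : μ diskᶜ = 0) (hβ : -1 < β)
    (hs : 1 < s) (hbox : VanishingBox μ s) :
    Tendsto (fun a => ENNReal.ofReal (1 - ‖a‖) * kernelImageNorm μ β s a) toCircle (𝓝 0) ↔
      Tendsto (fun a => (1 - ‖a‖) * Real.log (2 / (1 - ‖a‖ ^ 2)) * ‖kernelMean μ s a‖)
        toCircle (𝓝 0) := by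
  have hE := tendsto_kernelImageError hμ hβ hs hbox
  constructor
  · intro h
    obtain ⟨c, hc, hL⟩ := exists_le_lintegral_kernel_log hβ
    -- The lower Forelli–Rudin bound replaces the logarithm by the norm of a kernel; the mean times
    -- this norm is at most the error plus the norm of the image.
    have h0 : Tendsto (fun a => ENNReal.ofReal c * (ENNReal.ofReal (1 - ‖a‖) *
        kernelImageError μ β s a + ENNReal.ofReal (1 - ‖a‖) * kernelImageNorm μ β s a))
        toCircle (𝓝 0) := by
      simpa using ENNReal.Tendsto.const_mul (hE.add h) (Or.inr ENNReal.ofReal_ne_top)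
    have h1 : Tendsto (fun a => ENNReal.ofReal ((1 - ‖a‖) * Real.log (2 / (1 - ‖a‖ ^ 2)) *
        ‖kernelMean μ s a‖)) toCircle (𝓝 0) := by
      refine tendsto_of_tendsto_of_tendsto_of_le_of_le' tendsto_const_nhds h0
        (Eventually.of_forall fun _ => zero_le)
        (eventually_toCircle.2 ⟨7 / 8, by norm_num, fun a ha ha1 => ?_⟩)
      have ha0 : 0 < 1 - ‖a‖ := by linarith
      have hl := log_two_div_nonneg (mem_disk.2 ha1)
      rw [ENNReal.ofReal_mul (by positivity), ENNReal.ofReal_mul ha0.le, ofReal_norm]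
      calc _ ≤ ENNReal.ofReal (1 - ‖a‖) * (ENNReal.ofReal c *
            ∫⁻ u, ‖kernel (2 + β) u a‖ₑ ∂weightedArea β) * ‖kernelMean μ s a‖ₑ :=
            mul_le_mul_left (mul_le_mul_right (hL a ha.le ha1) _) _
        _ = ENNReal.ofReal c * (ENNReal.ofReal (1 - ‖a‖) * (‖kernelMean μ s a‖ₑ *
            ∫⁻ u, ‖kernel (2 + β) u a‖ₑ ∂weightedArea β)) := by ring
        _ ≤ ENNReal.ofReal c * (ENNReal.ofReal (1 - ‖a‖) *
            (kernelImageError μ β s a + kernelImageNorm μ β s a)) :=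
            mul_le_mul_right (mul_le_mul_right (enorm_kernelMean_mul_le a) _) _
        _ = _ := by rw [mul_add]
    have h2 := (ENNReal.tendsto_toReal ENNReal.zero_ne_top).comp h1
    refine h2.congr' (eventually_mem_disk.mono fun a ha => ?_)
    have ha0 : 0 < 1 - ‖a‖ := by linarith [mem_disk.1 ha]
    have hl := log_two_div_nonneg ha
    exact ENNReal.toReal_ofReal (by positivity)
  · intro h
    obtain ⟨C, hC, hL⟩ := exists_lintegral_kernel_log_le hβ
    have h0 := hE.add (ENNReal.tendsto_ofReal (h.const_mul C))
    rw [mul_zero, ENNReal.ofReal_zero, add_zero] at h0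
    refine tendsto_of_tendsto_of_tendsto_of_le_of_le' tendsto_const_nhds h0
      (Eventually.of_forall fun _ => zero_le) (eventually_mem_disk.mono fun a ha => ?_)
    have ha0 : 0 < 1 - ‖a‖ := by linarith [mem_disk.1 ha]
    have hl := log_two_div_nonneg ha
    refine (mul_le_mul_right (kernelImageNorm_le a) _).trans ?_
    rw [mul_add]
    refine add_le_add le_rfl ((mul_le_mul_right (mul_le_mul_right (hL a ha) _) _).trans
      (le_of_eq ?_))
    rw [← ofReal_norm, ← ENNReal.ofReal_mul (norm_nonneg _), ← ENNReal.ofReal_mul ha0.le]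
    congr 1
    ring

/-- Sufficiency of the Carleson and logarithmic Bloch conditions. -/
lemma toeplitzCompact_of_vanishingBox {p α : ℝ} (hp : 0 < p) (hp1 : p ≤ 1) (hα : -1 < α)
    (hβ : -1 < β) [IsFiniteMeasure μ] (hμ : μ diskᶜ = 0) (hbox : VanishingBox μ ((2 + α) / p))
    (hG : MemLittleLogBloch 1 (toeplitz μ ((2 + α) / p - 2) fun _ => 1)) :
    ToeplitzCompact μ p α 1 β := by
  have hs : 1 < (2 + α) / p := by rw [lt_div_iff₀ hp]; linarith
  have hb := hbox.boundedBox (by linarith)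
  have hN := (tendsto_kernelImageNorm_iff hμ hβ hs hbox).2
    ((memLittleLogBloch_iff hμ hs hb).1 hG)
  obtain ⟨A, hA⟩ := exists_kernelImageNorm_le hμ hβ hs hb (B := 1)
    (ENNReal.tendsto_nhds_zero.1 hN _ (by simp))
  exact toeplitzCompact_of_tendsto_kernelImageNorm hp hp1 hα hβ hμ hb hA hN

end ToeplitzBergman

/-! ### From the vanishing box condition to the vanishing Carleson property -/

namespace ToeplitzBergman
open MeasureTheory Filter Topology ComplexConjugate Set

/-- The vanishing Carleson condition on boxes is sufficient. -/
lemma isVanishingCarleson_of_vanishingBox {μ : Measure ℂ} [IsFiniteMeasure μ] {p α : ℝ}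
    (hp : 0 < p) (hp1 : p ≤ 1) (hα : -1 < α) (hμ : μ diskᶜ = 0)
    (hbox : VanishingBox μ ((2 + α) / p)) : IsVanishingCarleson μ (1 / p) 1 α := by
  refine ⟨inferInstance, fun f hf hf0 => ?_⟩
  obtain ⟨hm, B, hB⟩ := id hf
  obtain ⟨C, hC⟩ := exists_enorm_mul_le_bergmanNorm one_pos le_rfl hα
  set s := (2 + α) / p with hs
  have hps : p * s = 2 + α := by rw [hs]; field_simp
  have hs1 : 2 + α ≤ s := by rw [hs, le_div_iff₀ hp]; nlinarith
  -- Split `|f|^(1/p) = |f| |f|^q`. The pointwise growth of `L^1_a(ω_α)` functions bounds the second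
  -- factor by a multiple of `(1 - |w|)^(-τ)`, leaving an expression linear in `|f|`.
  set q := 1 / p - 1 with hq
  have hq0 : 0 ≤ q := by rw [hq, sub_nonneg]; exact (one_le_div hp).2 hp1
  set τ := (2 + α) * q with hτ
  have hτs : τ = s - (2 + α) := by rw [hτ, hq, hs]; ring
  have hτ0 : 0 ≤ τ := mul_nonneg (by linarith) hq0
  have hpt : ∀ n, ∀ w ∈ disk, ‖f n w‖ₑ ^ (1 / p) ≤
      ((C * B : NNReal) : ENNReal) ^ q * (‖f n w‖ₑ * ENNReal.ofReal ((1 - ‖w‖) ^ (-τ))) := by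
    intro n w hw
    have hw0 : 0 < 1 - ‖w‖ := by linarith [mem_disk.1 hw]
    have h1 : ‖f n w‖ₑ * ENNReal.ofReal ((1 - ‖w‖) ^ ((2 + α) / 1)) ≤ ((C * B : NNReal) : ENNReal) :=
      (hC _ (hm n).1 w hw).trans (by
        rw [ENNReal.coe_mul]; exact mul_le_mul_right (hB n) _)
    have h2 : ‖f n w‖ₑ ^ q ≤
        ((C * B : NNReal) : ENNReal) ^ q * ENNReal.ofReal ((1 - ‖w‖) ^ (-τ)) := by
      have h3 := ENNReal.rpow_le_rpow h1 hq0
      rw [ENNReal.mul_rpow_of_nonneg _ _ hq0, ENNReal.ofReal_rpow_of_pos (by positivity),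
        ← Real.rpow_mul hw0.le, div_one, ← hτ] at h3
      have h4 := mul_le_mul_left h3 (ENNReal.ofReal ((1 - ‖w‖) ^ (-τ)))
      rwa [mul_assoc, ← ENNReal.ofReal_mul (by positivity), ← Real.rpow_add hw0, add_neg_cancel,
        Real.rpow_zero, ENNReal.ofReal_one, mul_one] at h4
    rw [show 1 / p = 1 + q by rw [hq]; ring, ENNReal.rpow_add_of_nonneg _ _ zero_le_one hq0,
      ENNReal.rpow_one]
    calc _ ≤ ‖f n w‖ₑ * (((C * B : NNReal) : ENNReal) ^ q * ENNReal.ofReal ((1 - ‖w‖) ^ (-τ))) :=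
          mul_le_mul_right h2 _
      _ = _ := by ring
  have hcar : ∀ z, ∫⁻ w, ENNReal.ofReal ((1 - ‖w‖) ^ (-τ)) * ‖kernel (α + 3) w z‖ₑ ∂μ =
      carlesonIntegral μ τ (α + 3) z := fun z => by
    refine lintegral_congr_ae ((ae_mem_disk hμ).mono fun w hw => ?_)
    have hw0 : 0 < 1 - ‖w‖ := by linarith [mem_disk.1 hw]
    simp only [enorm_kernel]
    rw [← ENNReal.ofReal_mul (by positivity)]
  -- Since `τ = s - (2 + α)`, the condition `τ < s - 1` is just `α > -1`, and the resulting power of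
  -- `1 - |a|` is exactly the first, as the change of weight requires.
  have hlim := hbox.tendsto_carlesonIntegral hμ (δ := τ) (t := α + 3) hτ0 (by linarith)
    (by linarith)
  rw [show α + 3 + τ - s = 1 by linarith] at hlim
  simp only [Real.rpow_one] at hlim
  obtain ⟨A, hA, hbd⟩ := hbox.boundedBox (by linarith)
  obtain ⟨K, hK, hKb⟩ := exists_carlesonIntegral_le (s := s) (δ := τ) (t := α + 3)
    (by linarith) (by linarith)
  have hle : ∀ z ∈ disk, ENNReal.ofReal (1 - ‖z‖) * carlesonIntegral μ τ (α + 3) z ≤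
      ENNReal.ofReal (K * A) := fun z hz => by
    have hz0 : 0 < 1 - ‖z‖ := by linarith [mem_disk.1 hz]
    refine (mul_le_mul_right (hKb μ hμ A hA hbd z hz) _).trans (le_of_eq ?_)
    rw [← ENNReal.ofReal_mul hz0.le, show s - τ - (α + 3) = -1 by linarith, Real.rpow_neg_one]
    congr 1
    field_simp
  have hT := tendsto_lintegral_add_one_of_null hα hf hf0 hle ENNReal.ofReal_ne_top hlim
  have hT' := ENNReal.Tendsto.const_mul (a := ((C * B : NNReal) : ENNReal) ^ q) hT
    (Or.inr (ENNReal.rpow_ne_top_of_nonneg hq0 ENNReal.coe_ne_top))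
  rw [mul_zero] at hT'
  refine tendsto_of_tendsto_of_tendsto_of_le_of_le tendsto_const_nhds hT'
    (fun _ => zero_le) fun n => ?_
  calc _ ≤ ∫⁻ w, ((C * B : NNReal) : ENNReal) ^ q *
        (‖f n w‖ₑ * ENNReal.ofReal ((1 - ‖w‖) ^ (-τ))) ∂μ :=
        lintegral_mono_ae ((ae_mem_disk hμ).mono (hpt n))
    _ = ((C * B : NNReal) : ENNReal) ^ q *
        ∫⁻ w, ‖f n w‖ₑ * ENNReal.ofReal ((1 - ‖w‖) ^ (-τ)) ∂μ :=
        lintegral_const_mul' _ _ (ENNReal.rpow_ne_top_of_nonneg hq0 ENNReal.coe_ne_top)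
    _ ≤ _ := by
        refine mul_le_mul_right ?_ _
        have := lintegral_mul_le_lintegral_kernel hα (hm n) hμ
          (φ := fun w => ENNReal.ofReal ((1 - ‖w‖) ^ (-τ))) (by fun_prop)
        simpa only [hcar] using this

/-! ### Test functions -/

/-- The test functions `w ↦ w^k (1 - |a|)^c (1 - w ā)^(-b)`. -/
noncomputable def testFunction (k : ℕ) (c b : ℝ) (a w : ℂ) : ℂ :=
  (((1 - ‖a‖) ^ c : ℝ) : ℂ) * (w ^ k * kernel b w a)

lemma differentiableOn_testFunction (k : ℕ) (c b : ℝ) {a : ℂ} (ha : a ∈ disk) :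
    DifferentiableOn ℂ (testFunction k c b a) disk :=
  (((differentiable_id.pow k).differentiableOn).mul
    (differentiableOn_kernel b (mem_disk.1 ha).le)).const_mul _

lemma norm_testFunction_le (k : ℕ) (c b : ℝ) {a w : ℂ} (ha : a ∈ disk) (hw : w ∈ disk) :
    ‖testFunction k c b a w‖ ≤ (1 - ‖a‖) ^ c * ‖1 - w * conj a‖ ^ (-b) := by
  have ha0 : 0 < 1 - ‖a‖ := by linarith [mem_disk.1 ha]
  rw [testFunction, norm_mul, norm_mul, Complex.norm_real, norm_kernel, norm_pow,
    Real.norm_of_nonneg (by positivity)]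
  refine mul_le_mul_of_nonneg_left (mul_le_of_le_one_left (by positivity) ?_) (by positivity)
  exact pow_le_one₀ (norm_nonneg w) (mem_disk.1 hw).le

lemma exists_bergmanNorm_testFunction_le {p α c : ℝ} (hp : 0 < p) (hα : -1 < α) (hc : 0 < c)
    (k : ℕ) : ∃ C : NNReal, ∀ a ∈ disk,
      bergmanNorm p α (testFunction k c ((2 + α) / p + c) a) ≤ C := by
  -- The `p`-th power of the kernel has exponent `2 + α + c p`, supercritical because `c p > 0`;
  -- Forelli–Rudin gives `(1 - |a|)^(-cp)`, which the normalizing factor cancels.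
  obtain ⟨C, hC, h⟩ := exists_lintegral_kernel_le (t := 2 + α + c * p) hα
    (by nlinarith [mul_pos hc hp])
  refine ⟨C.toNNReal ^ (1 / p), fun a ha => ?_⟩
  have ha0 : 0 < 1 - ‖a‖ := by linarith [mem_disk.1 ha]
  rw [← ENNReal.rpow_le_rpow_iff hp, bergmanNorm_rpow hp,
    ← ENNReal.coe_rpow_of_nonneg _ hp.le, ← NNReal.rpow_mul, one_div, inv_mul_cancel₀ hp.ne',
    NNReal.rpow_one, ENNReal.ofNNReal_toNNReal]
  calc _ ≤ ∫⁻ w, ENNReal.ofReal ((1 - ‖a‖) ^ (c * p)) *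
        ENNReal.ofReal (‖1 - w * conj a‖ ^ (-(2 + α + c * p))) ∂weightedArea α := by
        refine lintegral_mono_ae ((ae_mem_disk (measure_weightedArea_compl α)).mono fun w hw => ?_)
        have hpos := norm_one_sub_mul_conj_pos (mem_disk.1 hw) (mem_disk.1 ha).le
        rw [← ENNReal.ofReal_mul (by positivity), ← ofReal_norm,
          ENNReal.ofReal_rpow_of_nonneg (norm_nonneg _) hp.le]
        refine ENNReal.ofReal_le_ofReal ((Real.rpow_le_rpow (norm_nonneg _)
          (norm_testFunction_le k c _ ha hw) hp.le).trans (le_of_eq ?_))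
        rw [Real.mul_rpow (by positivity) (by positivity), ← Real.rpow_mul ha0.le,
          ← Real.rpow_mul hpos.le]
        congr 2
        field_simp
    _ = ENNReal.ofReal ((1 - ‖a‖) ^ (c * p)) *
        ∫⁻ w, ENNReal.ofReal (‖1 - w * conj a‖ ^ (-(2 + α + c * p))) ∂weightedArea α :=
        lintegral_const_mul' _ _ ENNReal.ofReal_ne_top
    _ ≤ ENNReal.ofReal ((1 - ‖a‖) ^ (c * p)) *
        ENNReal.ofReal (C * (1 - ‖a‖) ^ (α + 2 - (2 + α + c * p))) := by
        exact mul_le_mul_right (h a ha) _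
    _ = _ := by
        rw [← ENNReal.ofReal_mul (by positivity), mul_left_comm, ← Real.rpow_add ha0]
        congr 1
        rw [show c * p + (α + 2 - (2 + α + c * p)) = 0 by ring, Real.rpow_zero, mul_one]

lemma testFunction_isBoundedSeq {p α c : ℝ} (hp : 0 < p) (hα : -1 < α) (hc : 0 < c) (k : ℕ)
    {a : ℕ → ℂ} (ha : ∀ n, a n ∈ disk) :
    IsBoundedSeq p α fun n => testFunction k c ((2 + α) / p + c) (a n) := by
  obtain ⟨C, hC⟩ := exists_bergmanNorm_testFunction_le hp hα hc k
  exact ⟨fun n => ⟨differentiableOn_testFunction _ _ _ (ha n),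
    (hC _ (ha n)).trans_lt ENNReal.coe_lt_top⟩, C, fun n => hC _ (ha n)⟩

/-- On a compact set the kernels stay bounded uniformly in `a`, while the prefactor `(1 - |a|)^c`
tends to `0`. -/
lemma testFunction_locallyUniformlyNull {c b : ℝ} (hc : 0 < c) (hb : 0 ≤ b) (k : ℕ)
    {a : ℕ → ℂ} (ha : ∀ n, a n ∈ disk) (hlim : Tendsto a atTop toCircle) :
    LocallyUniformlyNull fun n => testFunction k c b (a n) := by
  intro K hK hKc
  rcases K.eq_empty_or_nonempty with rfl | hne
  · simp [tendstoUniformlyOn_empty]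
  obtain ⟨z₀, hz₀, hmax⟩ := hKc.exists_isMaxOn hne continuous_norm.continuousOn
  have hz0 : 0 < 1 - ‖z₀‖ := by linarith [mem_disk.1 (hK hz₀)]
  have h0 : Tendsto (fun n => (1 - ‖a n‖) ^ c * (1 - ‖z₀‖) ^ (-b)) atTop (𝓝 0) := by
    simpa using ((tendsto_one_sub_norm_rpow hc).comp hlim).mul_const ((1 - ‖z₀‖) ^ (-b))
  rw [Metric.tendstoUniformlyOn_iff]
  intro ε hε
  filter_upwards [h0.eventually_lt_const hε] with n hn z hz
  rw [dist_zero_left]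
  refine lt_of_le_of_lt ((norm_testFunction_le k c b (ha n) (hK hz)).trans ?_) hn
  have ha0 : 0 < 1 - ‖a n‖ := by linarith [mem_disk.1 (ha n)]
  refine mul_le_mul_of_nonneg_left ?_ (by positivity)
  have h1 := one_sub_norm_le_norm_one_sub_mul_conj (z := z) (mem_disk.1 (ha n)).le
  have h2 : ‖z‖ ≤ ‖z₀‖ := hmax hz
  exact Real.rpow_le_rpow_of_nonpos hz0 (by linarith) (by linarith)

/-- The filter is countably generated, so sequences suffice; finitely many terms outside the disk
are replaced by `0`. -/
lemma tendsto_toCircle_of_seq {Ψ : ℂ → ENNReal} (h : ∀ a : ℕ → ℂ, (∀ n, a n ∈ disk) →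
    Tendsto a atTop toCircle → Tendsto (fun n => Ψ (a n)) atTop (𝓝 0)) :
    Tendsto Ψ toCircle (𝓝 0) := by
  refine tendsto_of_seq_tendsto fun a ha => ?_
  classical
  set a' : ℕ → ℂ := fun n => if a n ∈ disk then a n else 0 with ha'
  have hd : ∀ n, a' n ∈ disk := fun n => by
    by_cases h : a n ∈ disk
    · simp [ha', h]
    · simp [ha', h, zero_mem_disk]
  have heq : a' =ᶠ[atTop] a := (ha.eventually eventually_mem_disk).mono fun n hn => by simp [ha', hn]
  exact (h a' hd (ha.congr' heq.symm)).congr' (heq.mono fun n hn => by simp only [hn, Function.comp])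

/-- Sequential null conditions, tested on test functions, give a limit at the circle. -/
lemma tendsto_testFunction {p α c : ℝ} (hp : 0 < p) (hα : -1 < α) (hc : 0 < c) (k : ℕ)
    {Φ : (ℂ → ℂ) → ENNReal} (hΦ : ∀ f : ℕ → ℂ → ℂ, IsBoundedSeq p α f → LocallyUniformlyNull f →
      Tendsto (fun n => Φ (f n)) atTop (𝓝 0)) :
    Tendsto (fun a => Φ (testFunction k c ((2 + α) / p + c) a)) toCircle (𝓝 0) := by
  have hs : 0 < (2 + α) / p := div_pos (by linarith) hp
  exact tendsto_toCircle_of_seq fun a hd ha => hΦ _ (testFunction_isBoundedSeq hp hα hc k hd)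
    (testFunction_locallyUniformlyNull hc (by linarith) k hd ha)

end ToeplitzBergman

/-! ### Lower bounds that recover the box masses -/

namespace ToeplitzBergman
open MeasureTheory Filter Topology ComplexConjugate Set

lemma measure_nearSet_mul_le {μ : Measure ℂ} {a : ℂ} {c : ENNReal} {F : ℂ → ENNReal}
    (h : ∀ w ∈ nearSet a, c ≤ F w) : μ (nearSet a) * c ≤ ∫⁻ w, F w ∂μ := by
  calc _ = ∫⁻ _ in nearSet a, c ∂μ := by rw [setLIntegral_const, mul_comm]
    _ ≤ ∫⁻ w in nearSet a, F w ∂μ := setLIntegral_mono' (measurableSet_nearSet a) h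
    _ ≤ _ := setLIntegral_le_lintegral _ _

lemma le_norm_kernel_of_mem_nearSet {b : ℝ} (hb : 0 ≤ b) {a w : ℂ} (h : w ∈ nearSet a) :
    3 ^ (-b) * (1 - ‖a‖) ^ (-b) ≤ ‖kernel b w a‖ := by
  obtain ⟨hw, ha⟩ := norm_lt_one_of_near h
  rw [← Real.mul_rpow (by norm_num) (by linarith), norm_kernel]
  exact Real.rpow_le_rpow_of_nonpos (norm_one_sub_mul_conj_pos hw ha.le)
    (norm_one_sub_mul_conj_le_of_near h) (by linarith)

/-- A vanishing Carleson measure satisfies a vanishing condition on boxes. -/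
lemma vanishingBox_of_isVanishingCarleson {μ : Measure ℂ} {p α : ℝ} (hp : 0 < p) (hα : -1 < α)
    (h : IsVanishingCarleson μ (1 / p) 1 α) : VanishingBox μ ((2 + α) / p) := by
  have hlim := tendsto_testFunction (p := 1) one_pos hα one_pos 0
    (Φ := fun f => ∫⁻ z, ‖f z‖ₑ ^ (1 / p) ∂μ) h.2
  set K : ℝ := (3 ^ ((2 + α) / 1 + 1)) ^ (1 / p) with hK
  have h0 := ENNReal.Tendsto.const_mul (a := ENNReal.ofReal K) hlim (Or.inr ENNReal.ofReal_ne_top)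
  rw [mul_zero] at h0
  refine tendsto_of_tendsto_of_tendsto_of_le_of_le' tendsto_const_nhds h0
    (Eventually.of_forall fun _ => zero_le) (eventually_mem_disk.mono fun a ha => ?_)
  have ha0 : 0 < 1 - ‖a‖ := by linarith [mem_disk.1 ha]
  rw [← lintegral_const_mul' _ _ ENNReal.ofReal_ne_top]
  refine measure_nearSet_mul_le fun w hw => ?_
  have hq : 0 ≤ 1 / p := by positivity
  -- On the box of `a` the test function `(1 - |a|)(1 - w ā)^(-(α+3))` has size at least a constant
  -- times `(1 - |a|)^(-(2+α))`; the power `1/p` turns this into the exponent `-s`.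
  have h1 : (1 - ‖a‖) ^ (-(2 + α)) ≤
      3 ^ ((2 + α) / 1 + 1) * ‖testFunction 0 1 ((2 + α) / 1 + 1) a w‖ := by
    have h2 := le_norm_kernel_of_mem_nearSet (b := (2 + α) / 1 + 1) (by linarith) hw
    rw [testFunction, pow_zero, one_mul, Real.rpow_one, norm_mul, Complex.norm_real,
      Real.norm_of_nonneg ha0.le]
    calc (1 - ‖a‖) ^ (-(2 + α)) = 3 ^ ((2 + α) / 1 + 1) *
          ((1 - ‖a‖) * (3 ^ (-((2 + α) / 1 + 1)) * (1 - ‖a‖) ^ (-((2 + α) / 1 + 1)))) := by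
          rw [Real.rpow_neg (by norm_num : (0 : ℝ) ≤ 3), show -(2 + α) = 1 + -((2 + α) / 1 + 1) by ring,
            Real.rpow_add ha0, Real.rpow_one]
          field_simp
      _ ≤ _ := by gcongr
  rw [← ofReal_norm, ENNReal.ofReal_rpow_of_nonneg (norm_nonneg _) hq,
    ← ENNReal.ofReal_mul (by positivity)]
  refine ENNReal.ofReal_le_ofReal ?_
  have h3 := Real.rpow_le_rpow (by positivity) h1 hq
  rw [Real.mul_rpow (by positivity) (norm_nonneg _), ← Real.rpow_mul ha0.le] at h3
  rwa [show -(2 + α) * (1 / p) = -((2 + α) / p) by ring] at h3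

lemma integrable_mul_conj_pow {μ : Measure ℂ} (hμ : μ diskᶜ = 0) {φ : ℂ → ℂ}
    (hφ : Integrable φ μ) (k : ℕ) : Integrable (fun w => φ w * conj w ^ k) μ := by
  have hc : Continuous fun w : ℂ => conj w := Complex.continuous_conj
  refine hφ.norm.mono' (hφ.aestronglyMeasurable.mul (hc.pow k).aestronglyMeasurable)
    ((ae_mem_disk hμ).mono fun w hw => ?_)
  rw [norm_mul, norm_pow, RCLike.norm_conj]
  exact mul_le_of_le_one_right (norm_nonneg _) (pow_le_one₀ (norm_nonneg w) (mem_disk.1 hw).le)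

/-- Growth bounds for a kernel integral yield growth bounds for its derivatives. -/
lemma exists_norm_integral_conj_pow_mul_kernel_le {b : ℝ} (hb : 0 < b) (k : ℕ) :
    ∃ C : ℝ, 0 < C ∧ ∀ μ : Measure ℂ, μ diskᶜ = 0 → ∀ φ : ℂ → ℂ, Integrable φ μ →
      ∀ M : ℝ, 0 ≤ M → (∀ z ∈ disk, ‖∫ w, φ w * kernel b z w ∂μ‖ ≤ M * (1 - ‖z‖) ^ (-b)) →
      ∀ z ∈ disk, ‖∫ w, φ w * conj w ^ k * kernel (b + k) z w ∂μ‖ ≤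
        C * M * (1 - ‖z‖) ^ (-(b + k)) := by
  induction k with
  | zero =>
    refine ⟨1, one_pos, fun μ _ φ _ M _ h z hz => ?_⟩
    simpa using h z hz
  | succ k ih =>
    obtain ⟨C, hC, h⟩ := ih
    have hbk : 0 < b + k := by positivity
    refine ⟨C * 2 ^ (b + k + 1) / (b + k), by positivity, fun μ hμ φ hφ M hM hM' z hz => ?_⟩
    have hz0 : 0 < 1 - ‖z‖ := by linarith [mem_disk.1 hz]
    have hφk := integrable_mul_conj_pow hμ hφ k
    set g : ℂ → ℂ := fun z => ∫ w, φ w * conj w ^ k * kernel (b + k) z w ∂μ with hg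
    set r := (1 - ‖z‖) / 2 with hr
    have hr0 : 0 < r := by positivity
    have hcb : Metric.closedBall z r ⊆ disk := fun x hx => by
      have h1 := mem_closedBall_iff_norm.1 hx
      have h2 := norm_sub_norm_le x z
      rw [mem_disk]; linarith
    have hdiff : DifferentiableOn ℂ g disk := differentiableOn_integral_kernel hμ hφk hbk.le
    have hsph : ∀ x ∈ Metric.sphere z r, ‖g x‖ ≤ C * M * r ^ (-(b + k)) := fun x hx => by
      have h1 := mem_sphere_iff_norm.1 hx
      have h2 := norm_sub_norm_le x z
      refine (h μ hμ φ hφ M hM hM' x (hcb (Metric.sphere_subset_closedBall hx))).trans ?_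
      exact mul_le_mul_of_nonneg_left (Real.rpow_le_rpow_of_nonpos hr0 (by linarith) (by linarith))
        (by positivity)
    -- Cauchy's estimate on a circle of radius half the distance to the boundary loses one power of
    -- `1 - |z|`, while differentiation raises the kernel exponent by one and brings out a factor
    -- `w̄`.
    have hd := Complex.norm_deriv_le_of_forall_mem_sphere_norm_le hr0
      (hdiff.diffContOnCl_ball hcb) hsph
    have hderiv : deriv g z =
        ((b + k : ℝ) : ℂ) * ∫ w, φ w * conj w ^ (k + 1) * kernel (b + (k + 1 : ℕ)) z w ∂μ := by
      rw [(hasDerivAt_integral_kernel hμ hφk hbk.le hz).deriv, ← integral_const_mul]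
      refine integral_congr_ae (Eventually.of_forall fun w => ?_)
      simp only
      rw [show b + ((k + 1 : ℕ) : ℝ) = b + k + 1 by push_cast; ring]
      ring
    rw [hderiv, norm_mul, Complex.norm_real, Real.norm_of_nonneg hbk.le] at hd
    rw [show b + ((k + 1 : ℕ) : ℝ) = b + k + 1 by push_cast; ring] at hd ⊢
    have hfin : C * M * r ^ (-(b + k)) / r =
        C * 2 ^ (b + k + 1) * M * (1 - ‖z‖) ^ (-(b + k + 1)) := by
      rw [mul_div_assoc, ← Real.rpow_sub_one hr0.ne', show -(b + k) - 1 = -(b + k + 1) by ring, hr,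
        Real.div_rpow hz0.le zero_le_two, Real.rpow_neg zero_le_two, div_inv_eq_mul]
      ring
    rw [hfin, ← le_div_iff₀' hbk] at hd
    refine hd.trans (le_of_eq ?_)
    ring

lemma integrable_testFunction {μ : Measure ℂ} [IsFiniteMeasure μ] (hμ : μ diskᶜ = 0) (k : ℕ)
    {c b : ℝ} (hb : 0 ≤ b) {a : ℂ} (ha : a ∈ disk) : Integrable (testFunction k c b a) μ := by
  have ha0 : 0 < 1 - ‖a‖ := by linarith [mem_disk.1 ha]
  refine (integrable_const ((1 - ‖a‖) ^ c * (1 - ‖a‖) ^ (-b))).mono'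
    (aemeasurable_of_differentiableOn (differentiableOn_testFunction k c b ha) hμ)
    ((ae_mem_disk hμ).mono fun w hw => (norm_testFunction_le k c b ha hw).trans ?_)
  refine mul_le_mul_of_nonneg_left ?_ (by positivity)
  rw [norm_one_sub_mul_conj_comm]
  exact Real.rpow_le_rpow_of_nonpos ha0
    (one_sub_norm_le_norm_one_sub_mul_conj (mem_disk.1 hw).le) (by linarith)

/-- Box masses are controlled by the images of test functions. -/
lemma exists_measure_nearSet_le {β s c : ℝ} (hβ : -1 < β) (k : ℕ)
    (hc : s + c = 2 + β + k) : ∃ C : NNReal, ∀ (μ : Measure ℂ) [IsFiniteMeasure μ],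
      μ diskᶜ = 0 → ∀ a : ℂ, 3 / 4 ≤ ‖a‖ → ‖a‖ < 1 →
      MemBergman 1 β (toeplitz μ β (testFunction k c (s + c) a)) →
      μ (nearSet a) * ENNReal.ofReal ((1 - ‖a‖) ^ (-s)) ≤
        C * bergmanNorm 1 β (toeplitz μ β (testFunction k c (s + c) a)) := by
  obtain ⟨C₁, h₁⟩ := exists_enorm_mul_le_bergmanNorm one_pos le_rfl hβ
  obtain ⟨C₂, hC₂, h₂⟩ := exists_norm_integral_conj_pow_mul_kernel_le (b := 2 + β)
    (by linarith) k
  -- The lower bound on the box: `|w| ≥ 1/2` for the monomials and `|1 - w ā| ≤ 3(1 - |a|)` for the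
  -- squared kernel.
  set κ : ℝ := (1 / 2) ^ (2 * k) * (3 ^ (-(s + c))) ^ 2 with hκ
  have hκ0 : 0 < κ := by positivity
  have hb0 : 0 < s + c := by rw [hc]; linarith [(Nat.cast_nonneg k : (0 : ℝ) ≤ k)]
  refine ⟨(κ⁻¹ * (C₂ * C₁)).toNNReal, fun μ _ hμ a ha ha1 hT => ?_⟩
  have had := mem_disk.2 ha1
  have ha0 : 0 < 1 - ‖a‖ := by linarith
  have hfi := integrable_testFunction hμ k (c := c) hb0.le had
  set f := testFunction k c (s + c) a with hf
  set N := (bergmanNorm 1 β (toeplitz μ β f)).toReal with hN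
  have hNe : bergmanNorm 1 β (toeplitz μ β f) = ENNReal.ofReal N :=
    (ENNReal.ofReal_toReal hT.2.ne).symm
  have hgrow : ∀ z ∈ disk, ‖∫ w, f w * kernel (2 + β) z w ∂μ‖ ≤
      (C₁ * N) * (1 - ‖z‖) ^ (-(2 + β)) := fun z hz => by
    have hz0 : 0 < 1 - ‖z‖ := by linarith [mem_disk.1 hz]
    have h3 := h₁ _ hT.1 z hz
    rw [hNe, toeplitz_eq, ← ofReal_norm, ← ENNReal.ofReal_mul (norm_nonneg _), div_one,
      ← ENNReal.ofReal_coe_nnreal, ← ENNReal.ofReal_mul C₁.coe_nonneg,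
      ENNReal.ofReal_le_ofReal_iff (by positivity)] at h3
    rw [Real.rpow_neg hz0.le, ← div_eq_mul_inv]
    exact (le_div_iff₀ (by positivity)).2 h3
  have h4 := h₂ μ hμ f hfi (C₁ * N) (by positivity) hgrow a had
  rw [← hc] at h4
  set F : ℂ → ℂ := fun w => f w * conj w ^ k * kernel (s + c) a w with hF
  -- By the choice `s + c = 2 + β + k` the differentiated kernel at `z = a` is the conjugate of the
  -- kernel in the test function, and `w̄^k` pairs with `w^k`. The integrand is nonnegative, so
  -- there is no cancellation.
  have hFeq : ∀ w ∈ disk, F w =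
      (((1 - ‖a‖) ^ c * ((‖w‖ ^ k) ^ 2 * ‖kernel (s + c) w a‖ ^ 2) : ℝ) : ℂ) := fun w hw => by
    have e1 : kernel (s + c) a w = conj (kernel (s + c) w a) :=
      (conj_kernel _ (mem_disk.1 hw) ha1.le).symm
    have e2 := Complex.mul_conj (kernel (s + c) w a)
    have e3 := Complex.mul_conj (w ^ k)
    rw [Complex.normSq_eq_norm_sq] at e2 e3
    rw [map_pow, norm_pow] at e3
    change testFunction k c (s + c) a w * conj w ^ k * kernel (s + c) a w = _
    rw [testFunction, e1]
    push_cast at e2 e3 ⊢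
    rw [← e2, ← e3]
    ring
  have hFn : ∀ w ∈ disk, ‖F w‖ = (1 - ‖a‖) ^ c * ((‖w‖ ^ k) ^ 2 * ‖kernel (s + c) w a‖ ^ 2) :=
    fun w hw => by rw [hFeq w hw, Complex.norm_real, Real.norm_of_nonneg (by positivity)]
  have hFi : Integrable F μ :=
    integrable_mul_kernel hμ (integrable_mul_conj_pow hμ hfi k) hb0.le had
  have hFint : ∫⁻ w, ‖F w‖ₑ ∂μ = ENNReal.ofReal ‖∫ w, F w ∂μ‖ := by
    have e : ∫ w, F w ∂μ = ((∫ w, ‖F w‖ ∂μ : ℝ) : ℂ) := by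
      rw [← integral_complex_ofReal]
      exact integral_congr_ae ((ae_mem_disk hμ).mono fun w hw => by
        simp only [hFn w hw]
        exact hFeq w hw)
    rw [e, Complex.norm_real, Real.norm_of_nonneg (integral_nonneg fun _ => norm_nonneg _),
      ofReal_integral_norm_eq_lintegral_enorm hFi]
  have h5 : μ (nearSet a) * ENNReal.ofReal (κ * (1 - ‖a‖) ^ (c - 2 * (s + c))) ≤
      ENNReal.ofReal (C₂ * (C₁ * N) * (1 - ‖a‖) ^ (-(s + c))) := by
    refine (measure_nearSet_mul_le fun w hw => ?_).trans
      (hFint.le.trans (ENNReal.ofReal_le_ofReal h4))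
    have hw1 := (norm_lt_one_of_near hw).1
    rw [← ofReal_norm, hFn w (mem_disk.2 hw1)]
    refine ENNReal.ofReal_le_ofReal ?_
    have hk := le_norm_kernel_of_mem_nearSet hb0.le hw
    -- On the box `|w| > 2|a| - 1`, which is at least 1/2 because `|a| ≥ 3/4`.
    have hwl : 1 / 2 ≤ ‖w‖ := by
      have h6 : ‖a - w‖ < (1 - ‖w‖) / 2 := hw
      have h7 := norm_sub_norm_le a w
      linarith
    calc _ = (1 - ‖a‖) ^ c * (((1 / 2) ^ k) ^ 2 *
          (3 ^ (-(s + c)) * (1 - ‖a‖) ^ (-(s + c))) ^ 2) := by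
          rw [hκ, show c - 2 * (s + c) = c + -(s + c) + -(s + c) by ring, Real.rpow_add ha0,
            Real.rpow_add ha0]
          ring
      _ ≤ _ := by gcongr
  have h8 := mul_le_mul_left h5 (ENNReal.ofReal (κ⁻¹ * (1 - ‖a‖) ^ (s + c)))
  rw [mul_assoc, ← ENNReal.ofReal_mul (by positivity), ← ENNReal.ofReal_mul (by positivity)] at h8
  rw [hNe, ENNReal.ofNNReal_toNNReal, ← ENNReal.ofReal_mul (by positivity)]
  have e1 : κ * (1 - ‖a‖) ^ (c - 2 * (s + c)) * (κ⁻¹ * (1 - ‖a‖) ^ (s + c)) =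
      (1 - ‖a‖) ^ (-s) := by
    rw [mul_mul_mul_comm, mul_inv_cancel₀ hκ0.ne', one_mul, ← Real.rpow_add ha0]
    congr 1
    ring
  have e2 : C₂ * (C₁ * N) * (1 - ‖a‖) ^ (-(s + c)) * (κ⁻¹ * (1 - ‖a‖) ^ (s + c)) =
      κ⁻¹ * (C₂ * C₁) * N := by
    rw [Real.rpow_neg ha0.le]
    field_simp
  rwa [e1, e2] at h8

end ToeplitzBergman

/-! ### Necessity and the characterization of compactness -/

namespace ToeplitzBergman
open MeasureTheory Filter Topology ComplexConjugate Set

variable {μ : Measure ℂ} {p α β : ℝ}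

lemma memBergman_one (hp : 0 < p) (hα : -1 < α) : MemBergman p α fun _ => 1 := by
  obtain ⟨C, hC⟩ := exists_bergmanNorm_testFunction_le hp hα one_pos 0
  have h := hC 0 zero_mem_disk
  have e : testFunction 0 1 ((2 + α) / p + 1) 0 = fun _ => 1 := by
    funext w
    simp [testFunction, kernel]
  rw [e] at h
  exact ⟨differentiableOn_const _, h.trans_lt ENNReal.coe_lt_top⟩

/-- Absolute convergence for `f = 1` at the point `z = 0`, where the kernel is 1, says that `μ` is
finite. -/
lemma ToeplitzMaps.isFiniteMeasure {q : ℝ} (hp : 0 < p) (hα : -1 < α)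
    (h : ToeplitzMaps μ p α q β) : IsFiniteMeasure μ := by
  have := (h _ (memBergman_one hp hα)).1 0 zero_mem_disk
  have e : toeplitzIntegrand β (fun _ => 1) 0 = fun _ => 1 := by
    funext w
    simp [toeplitzIntegrand]
  rw [e] at this
  exact (integrable_const_iff_isFiniteMeasure one_ne_zero).1 this

lemma toeplitz_testFunction (s : ℝ) (a u : ℂ) :
    toeplitz μ β (testFunction 0 1 (s + 1) a) u =
      ((1 - ‖a‖ : ℝ) : ℂ) * kernelImage μ β s a u := by
  rw [toeplitz_eq, kernelImage, ← integral_const_mul]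
  refine integral_congr_ae (Eventually.of_forall fun w => ?_)
  simp only [testFunction, pow_zero, one_mul, Real.rpow_one]
  ring

lemma bergmanNorm_toeplitz_testFunction (s : ℝ) {a : ℂ} (ha : a ∈ disk) :
    bergmanNorm 1 β (toeplitz μ β (testFunction 0 1 (s + 1) a)) =
      ENNReal.ofReal (1 - ‖a‖) * kernelImageNorm μ β s a := by
  have ha0 : 0 ≤ 1 - ‖a‖ := by linarith [mem_disk.1 ha]
  rw [bergmanNorm_one, kernelImageNorm, ← lintegral_const_mul' _ _ ENNReal.ofReal_ne_top]
  refine lintegral_congr fun u => ?_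
  rw [toeplitz_testFunction, enorm_mul, ← ofReal_norm, Complex.norm_real,
    Real.norm_of_nonneg ha0]

lemma testFunction_memBergman (hp : 0 < p) (hα : -1 < α) {c : ℝ} (hc : 0 < c) (k : ℕ) {a : ℂ}
    (ha : a ∈ disk) : MemBergman p α (testFunction k c ((2 + α) / p + c) a) :=
  (testFunction_isBoundedSeq hp hα hc k fun _ => ha).1 0

/-- Box masses are controlled by the images of a bounded family of test functions. -/
lemma ToeplitzMaps.exists_measure_nearSet_le [IsFiniteMeasure μ] (hp : 0 < p) (hα : -1 < α)
    (hβ : -1 < β) (hμ : μ diskᶜ = 0) (h : ToeplitzMaps μ p α 1 β) :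
    ∃ (k : ℕ) (c : ℝ) (C : NNReal), 0 < c ∧ ∀ᶠ a in toCircle,
      μ (nearSet a) * ENNReal.ofReal ((1 - ‖a‖) ^ (-((2 + α) / p))) ≤
        C * bergmanNorm 1 β (toeplitz μ β (testFunction k c ((2 + α) / p + c) a)) := by
  -- Enough derivatives are taken to make `c = 2 + β + k - s` positive; this is the only role of the
  -- monomial factor.
  obtain ⟨k, hk⟩ := exists_nat_gt ((2 + α) / p - (2 + β))
  have hc : 0 < 2 + β + k - (2 + α) / p := by linarith
  obtain ⟨C, hC⟩ := ToeplitzBergman.exists_measure_nearSet_le (s := (2 + α) / p)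
    (c := 2 + β + k - (2 + α) / p) hβ k (by ring)
  refine ⟨k, _, C, hc, eventually_toCircle.2 ⟨3 / 4, by norm_num, fun a ha ha1 => ?_⟩⟩
  exact hC μ hμ a ha.le ha1 (h _ (testFunction_memBergman hp hα hc k (mem_disk.2 ha1))).2

lemma ToeplitzCompact.vanishingBox (hp : 0 < p) (hα : -1 < α) (hβ : -1 < β) (hμ : μ diskᶜ = 0)
    (h : ToeplitzCompact μ p α 1 β) : VanishingBox μ ((2 + α) / p) := by
  have := h.1.isFiniteMeasure hp hα
  obtain ⟨k, c, C, hc, hC⟩ := h.1.exists_measure_nearSet_le hp hα hβ hμ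
  have h0 := ENNReal.Tendsto.const_mul (a := (C : ENNReal)) (tendsto_testFunction hp hα hc k
    (Φ := fun f => bergmanNorm 1 β (toeplitz μ β f)) h.2) (Or.inr ENNReal.coe_ne_top)
  rw [mul_zero] at h0
  exact tendsto_of_tendsto_of_tendsto_of_le_of_le' tendsto_const_nhds h0
    (Eventually.of_forall fun _ => zero_le) hC

/-- With `k = 0` and `c = 1` the test function is the normalized reproducing kernel, so its image
has exactly this norm. -/
lemma ToeplitzCompact.tendsto_kernelImageNorm (hp : 0 < p) (hα : -1 < α)
    (h : ToeplitzCompact μ p α 1 β) :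
    Tendsto (fun a => ENNReal.ofReal (1 - ‖a‖) * kernelImageNorm μ β ((2 + α) / p) a)
      toCircle (𝓝 0) :=
  (tendsto_testFunction hp hα one_pos 0 (Φ := fun f => bergmanNorm 1 β (toeplitz μ β f)) h.2).congr'
    (eventually_mem_disk.mono fun _ ha => bergmanNorm_toeplitz_testFunction _ ha)

/-- The characterization of compact Toeplitz operators. -/
theorem toeplitzCompact_iff (hμ : μ diskᶜ = 0) (hp : 0 < p) (hp1 : p ≤ 1) (hα : -1 < α)
    (hβ : -1 < β) : ToeplitzCompact μ p α 1 β ↔ IsVanishingCarleson μ (1 / p) 1 α ∧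
      MemLittleLogBloch 1 (toeplitz μ ((2 + α) / p - 2) fun _ => 1) := by
  have hs : 1 < (2 + α) / p := by rw [lt_div_iff₀ hp]; linarith
  constructor
  · intro h
    have := h.1.isFiniteMeasure hp hα
    have hbox := h.vanishingBox hp hα hβ hμ
    exact ⟨isVanishingCarleson_of_vanishingBox hp hp1 hα hμ hbox,
      (memLittleLogBloch_iff hμ hs (hbox.boundedBox (by linarith))).2
        ((tendsto_kernelImageNorm_iff hμ hβ hs hbox).1 (h.tendsto_kernelImageNorm hp hα))⟩
  · rintro ⟨h, hG⟩
    have := h.1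
    exact toeplitzCompact_of_vanishingBox hp hp1 hα hβ hμ
      (vanishingBox_of_isVanishingCarleson hp hα h) hG

end ToeplitzBergman

/-! ### Montel's theorem and convergent subsequences of images -/

namespace ToeplitzBergman
open MeasureTheory Filter Topology ComplexConjugate Set

lemma norm_taylorCoeff_le {f : ℂ → ℂ} (hf : DifferentiableOn ℂ f disk) {r M : ℝ} (hr0 : 0 < r)
    (hr1 : r < 1) (hM : ∀ z, ‖z‖ ≤ r → ‖f z‖ ≤ M) (k : ℕ) : ‖taylorCoeff f k‖ ≤ M / r ^ k := by
  have hcb : Metric.closedBall (0 : ℂ) r ⊆ disk := fun z hz =>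
    mem_disk.2 ((mem_closedBall_zero_iff.1 hz).trans_lt hr1)
  have h := Complex.norm_iteratedDeriv_le_of_forall_mem_sphere_norm_le k hr0
    (hf.diffContOnCl_ball hcb) fun z hz => hM z (mem_sphere_zero_iff_norm.1 hz).le
  rw [taylorCoeff, norm_mul, norm_inv, Complex.norm_natCast,
    inv_mul_le_iff₀ (by exact_mod_cast k.factorial_pos)]
  exact h.trans (le_of_eq (mul_div_assoc _ _ _))

lemma exists_subset_closedBall {K : Set ℂ} (hK : K ⊆ disk) (hKc : IsCompact K) :
    ∃ ρ : ℝ, 0 < ρ ∧ ρ < 1 ∧ ∀ z ∈ K, ‖z‖ ≤ ρ := by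
  rcases K.eq_empty_or_nonempty with rfl | hne
  · exact ⟨1 / 2, by norm_num, by norm_num, by simp⟩
  obtain ⟨z₀, hz₀, hmax⟩ := hKc.exists_isMaxOn hne continuous_norm.continuousOn
  have h1 := mem_disk.1 (hK hz₀)
  refine ⟨(1 + ‖z₀‖) / 2, by positivity, by linarith, fun z hz => ?_⟩
  have : ‖z‖ ≤ ‖z₀‖ := hmax hz
  linarith

/-- Montel's theorem in the unit disk. -/
lemma exists_subseq_locallyUniformlyNull {f : ℕ → ℂ → ℂ}
    (hf : ∀ n, DifferentiableOn ℂ (f n) disk) {M : ℝ → ℝ}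
    (hM : ∀ r < 1, ∀ n, ∀ z, ‖z‖ ≤ r → ‖f n z‖ ≤ M r) :
    ∃ φ : ℕ → ℕ, StrictMono φ ∧ ∃ g : ℂ → ℂ, DifferentiableOn ℂ g disk ∧
      LocallyUniformlyNull fun n z => f (φ n) z - g z := by
  have hc : ∀ r, 0 < r → r < 1 → ∀ n k, ‖taylorCoeff (f n) k‖ ≤ M r / r ^ k :=
    fun r hr0 hr1 n k => norm_taylorCoeff_le (hf n) hr0 hr1 (hM r hr1 n) k
  -- A countable product of closed balls is sequentially compact, which replaces a diagonal argument
  -- on the Taylor coefficients. The radius 1/2 is an arbitrary choice.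
  have hcomp : IsCompact (Set.pi univ fun k : ℕ =>
      Metric.closedBall (0 : ℂ) (M (1 / 2) / (1 / 2) ^ k)) :=
    isCompact_univ_pi fun k => isCompact_closedBall _ _
  obtain ⟨d, -, φ, hφ, hlim⟩ := hcomp.tendsto_subseq (x := fun n k => taylorCoeff (f n) k)
    fun n k _ => mem_closedBall_zero_iff.2 (hc _ (by norm_num) (by norm_num) n k)
  rw [tendsto_pi_nhds] at hlim
  have hd : ∀ r, 0 < r → r < 1 → ∀ k, ‖d k‖ ≤ M r / r ^ k := fun r hr0 hr1 k =>
    le_of_tendsto (hlim k).norm (Eventually.of_forall fun n => hc r hr0 hr1 _ k)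
  have hMnn : ∀ r, 0 < r → r < 1 → 0 ≤ M r := fun r hr0 hr1 =>
    (norm_nonneg _).trans (hM r hr1 0 0 (by simpa using hr0.le))
  set g : ℂ → ℂ := fun z => ∑' k, d k * z ^ k with hg
  have key : LocallyUniformlyNull fun n z => f (φ n) z - g z := by
    intro K hK hKc
    obtain ⟨ρ, hρ0, hρ1, hρ⟩ := exists_subset_closedBall hK hKc
    obtain ⟨r, hr⟩ : ∃ r : ℝ, r = (1 + ρ) / 2 := ⟨_, rfl⟩
    have hr0 : 0 < r := by linarith
    have hr1 : r < 1 := by linarith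
    have hq : ρ / r < 1 := (div_lt_one hr0).2 (by linarith)
    have hq0 : 0 ≤ ρ / r := by positivity
    have hMr := hMnn r hr0 hr1
    have hgeo : Summable fun k : ℕ => 2 * M r * (ρ / r) ^ k :=
      (summable_geometric_of_lt_one hq0 hq).mul_left _
    have hbd : ∀ n k, ‖‖taylorCoeff (f (φ n)) k - d k‖ * ρ ^ k‖ ≤ 2 * M r * (ρ / r) ^ k := by
      intro n k
      rw [norm_mul, norm_norm, norm_pow, Real.norm_of_nonneg hρ0.le]
      calc _ ≤ (M r / r ^ k + M r / r ^ k) * ρ ^ k := by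
            gcongr
            exact (norm_sub_le _ _).trans (add_le_add (hc r hr0 hr1 _ k) (hd r hr0 hr1 k))
        _ = _ := by rw [div_pow]; ring
    have hsum : ∀ n, Summable fun k => ‖taylorCoeff (f (φ n)) k - d k‖ * ρ ^ k :=
      fun n => hgeo.of_norm_bounded (hbd n)
    -- On `|z| ≤ ρ < r` the coefficient differences are dominated by a geometric series of ratio
    -- `ρ/r`, so coefficientwise convergence becomes uniform convergence.
    have h0 := tendsto_tsum_of_dominated_convergence (𝓕 := atTop) hgeo
      (f := fun n k => ‖taylorCoeff (f (φ n)) k - d k‖ * ρ ^ k) (g := fun _ => 0)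
      (fun k => by
        have h1 := ((hlim k).sub_const (d k)).norm.mul_const (ρ ^ k)
        simpa using h1)
      (Eventually.of_forall hbd)
    rw [tsum_zero] at h0
    rw [Metric.tendstoUniformlyOn_iff]
    intro ε hε
    filter_upwards [h0.eventually_lt_const hε] with n hn z hz
    rw [dist_zero_left]
    refine lt_of_le_of_lt ?_ hn
    have hzd := hK hz
    have hdz : Summable fun k => d k * z ^ k := by
      refine ((summable_geometric_of_lt_one hq0 hq).mul_left (M r)).of_norm_bounded fun k => ?_
      rw [norm_mul, norm_pow]
      calc _ ≤ M r / r ^ k * ρ ^ k := by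
            gcongr
            · exact hd r hr0 hr1 k
            · exact hρ z hz
        _ = _ := by rw [div_pow]; ring
    have h2 := ((hasSum_taylorCoeff (hf (φ n)) hzd).sub hdz.hasSum)
    have h3 : ‖∑' k, (taylorCoeff (f (φ n)) k - d k) * z ^ k‖ ≤
        ∑' k, ‖taylorCoeff (f (φ n)) k - d k‖ * ρ ^ k :=
      tsum_of_norm_bounded (hsum n).hasSum fun k => by
        rw [norm_mul, norm_pow]
        gcongr
        exact hρ z hz
    refine le_trans (le_of_eq ?_) h3
    rw [← h2.tsum_eq]
    simp only [sub_mul]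
  refine ⟨φ, hφ, g, ?_, key⟩
  have hloc : TendstoLocallyUniformlyOn (fun n => f (φ n)) g atTop disk := by
    rw [tendstoLocallyUniformlyOn_iff_forall_isCompact isOpen_disk]
    intro K hK hKc
    have := Metric.tendstoUniformlyOn_iff.1 (key K hK hKc)
    rw [Metric.tendstoUniformlyOn_iff]
    intro ε hε
    filter_upwards [this ε hε] with n hn z hz
    have h := hn z hz
    rwa [dist_zero_left, ← dist_eq_norm, dist_comm] at h
  exact hloc.differentiableOn (Eventually.of_forall fun n => hf (φ n)) isOpen_disk

variable {μ : Measure ℂ} {p α β : ℝ}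

lemma bergmanNorm_congr {q : ℝ} {f g : ℂ → ℂ} (h : ∀ z ∈ disk, f z = g z) :
    bergmanNorm q β f = bergmanNorm q β g :=
  eLpNorm_congr_ae ((ae_mem_disk (measure_weightedArea_compl β)).mono h)

lemma MemBergman.sub {f g : ℂ → ℂ} (hf : MemBergman 1 α f) (hg : MemBergman 1 α g) :
    MemBergman 1 α (fun z => f z - g z) ∧
      bergmanNorm 1 α (fun z => f z - g z) ≤ bergmanNorm 1 α f + bergmanNorm 1 α g := by
  have hle : bergmanNorm 1 α (fun z => f z - g z) ≤ bergmanNorm 1 α f + bergmanNorm 1 α g :=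
    eLpNorm_sub_le (aemeasurable_of_differentiableOn hf.1 (measure_weightedArea_compl α))
      (aemeasurable_of_differentiableOn hg.1 (measure_weightedArea_compl α)) (by simp)
  exact ⟨⟨hf.1.sub hg.1, hle.trans_lt (ENNReal.add_lt_top.2 ⟨hf.2, hg.2⟩)⟩, hle⟩

/-- Pointwise growth of functions in a Bergman space. -/
lemma exists_norm_le_of_bergmanNorm_le (hp : 0 < p) (hp1 : p ≤ 1) (hα : -1 < α) :
    ∃ C : ℝ, 0 ≤ C ∧ ∀ f : ℂ → ℂ, DifferentiableOn ℂ f disk → ∀ B : NNReal,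
      bergmanNorm p α f ≤ B → ∀ z ∈ disk, ‖f z‖ ≤ C * B * (1 - ‖z‖) ^ (-((2 + α) / p)) := by
  obtain ⟨C, hC⟩ := exists_enorm_mul_le_bergmanNorm hp hp1 hα
  refine ⟨C, C.coe_nonneg, fun f hf B hB z hz => ?_⟩
  have hz0 : 0 < 1 - ‖z‖ := by linarith [mem_disk.1 hz]
  have h := (hC f hf z hz).trans (mul_le_mul_right hB _)
  rw [← ENNReal.coe_mul, ← ENNReal.ofReal_coe_nnreal, ← ofReal_norm,
    ← ENNReal.ofReal_mul (norm_nonneg _), ENNReal.ofReal_le_ofReal_iff (by positivity)] at h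
  rw [Real.rpow_neg hz0.le, ← div_eq_mul_inv]
  exact (le_div_iff₀ (by positivity)).2 h

/-- Bounded sequences in Bergman spaces have locally uniformly convergent subsequences. -/
lemma IsBoundedSeq.exists_subseq (hp : 0 < p) (hp1 : p ≤ 1) (hα : -1 < α) {f : ℕ → ℂ → ℂ}
    (hf : IsBoundedSeq p α f) : ∃ φ : ℕ → ℕ, StrictMono φ ∧ ∃ g : ℂ → ℂ, MemBergman p α g ∧
      LocallyUniformlyNull fun n z => f (φ n) z - g z := by
  obtain ⟨hm, B, hB⟩ := hf
  obtain ⟨C, hC, h⟩ := exists_norm_le_of_bergmanNorm_le hp hp1 hα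
  have hs : 0 < (2 + α) / p := div_pos (by linarith) hp
  obtain ⟨φ, hφ, g, hg, hlim⟩ := exists_subseq_locallyUniformlyNull
    (M := fun r => C * B * (1 - r) ^ (-((2 + α) / p))) (fun n => (hm n).1) fun r hr n z hz => by
      refine (h _ (hm n).1 B (hB n) z (mem_disk.2 (hz.trans_lt hr))).trans ?_
      exact mul_le_mul_of_nonneg_left (Real.rpow_le_rpow_of_nonpos (by linarith) (by linarith)
        (by linarith)) (by positivity)
  refine ⟨φ, hφ, g, ⟨hg, lt_of_le_of_lt ?_ (ENNReal.coe_lt_top (r := B))⟩, hlim⟩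
  -- Fatou's lemma keeps the limit in the space; local uniform convergence supplies the pointwise
  -- limits.
  refine (Lp.eLpNorm_lim_le_liminf_eLpNorm (f := fun n => f (φ n)) (fun n =>
    aemeasurable_of_differentiableOn (hm _).1 (measure_weightedArea_compl α)) g
    ((ae_mem_disk (measure_weightedArea_compl α)).mono fun z hz => ?_)).trans ?_
  · have := (hlim {z} (by simpa using hz) isCompact_singleton).tendsto_at (mem_singleton z)
    have := this.add_const (g z)
    simpa using this
  · refine liminf_le_of_le (by isBoundedDefault) fun b hb => ?_
    obtain ⟨n, hn⟩ := hb.exists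
    exact hn.trans (hB _)

lemma ToeplitzMaps.toeplitz_sub {q : ℝ} (h : ToeplitzMaps μ p α q β) {f g : ℂ → ℂ}
    (hf : MemBergman p α f) (hg : MemBergman p α g) {z : ℂ} (hz : z ∈ disk) :
    toeplitz μ β (fun w => f w - g w) z = toeplitz μ β f z - toeplitz μ β g z := by
  rw [toeplitz, toeplitz, toeplitz, ← integral_sub ((h f hf).1 z hz) ((h g hg).1 z hz)]
  simp only [toeplitzIntegrand, sub_div]

/-- Pass to a locally uniformly convergent subsequence with limit `g`. The differences form a
bounded null sequence, so the images converge to `T g`. -/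
lemma ToeplitzCompact.usual (hα : -1 < α) (h : ToeplitzCompact μ 1 α 1 β) :
    ToeplitzCompactUsual μ 1 α 1 β := by
  refine ⟨h.1, fun f hf => ?_⟩
  obtain ⟨φ, hφ, g, hg, hlim⟩ := hf.exists_subseq one_pos le_rfl hα
  obtain ⟨hm, B, hB⟩ := hf
  refine ⟨φ, hφ, toeplitz μ β g, (h.1 g hg).2, ?_⟩
  have hb : IsBoundedSeq 1 α fun n z => f (φ n) z - g z := by
    refine ⟨fun n => ((hm _).sub hg).1, B + (bergmanNorm 1 α g).toNNReal, fun n => ?_⟩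
    rw [ENNReal.coe_add, ENNReal.coe_toNNReal hg.2.ne]
    exact ((hm _).sub hg).2.trans (add_le_add (hB _) le_rfl)
  exact (h.2 _ hb hlim).congr fun n => bergmanNorm_congr fun z hz => h.1.toeplitz_sub (hm _) hg hz

end ToeplitzBergman

/-! ### From usual compactness to the sequential form -/

namespace ToeplitzBergman
open MeasureTheory Filter Topology ComplexConjugate Set

variable {μ : Measure ℂ} {p α β : ℝ}

/-- A compact operator is bounded on bounded families. -/
lemma ToeplitzCompactUsual.exists_bergmanNorm_le {ι : Type*} {S : Set ι}
    (h : ToeplitzCompactUsual μ p α 1 β) {F : ι → ℂ → ℂ} (hF : ∀ i ∈ S, MemBergman p α (F i))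
    {C : NNReal} (hC : ∀ i ∈ S, bergmanNorm p α (F i) ≤ C) :
    ∃ B : NNReal, ∀ i ∈ S, bergmanNorm 1 β (toeplitz μ β (F i)) ≤ B := by
  -- Otherwise some members have images of norm greater than `n`, for each `n`; a norm convergent
  -- subsequence of these images would be bounded.
  by_contra! hcon
  choose i hiS hi using fun n : ℕ => hcon n
  obtain ⟨φ, hφ, g, hg, hlim⟩ := h.2 (fun n => F (i n))
    ⟨fun n => hF _ (hiS n), C, fun n => hC _ (hiS n)⟩
  have hev := hlim.eventually_le_const (show (0 : ENNReal) < 1 by simp)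
  obtain ⟨N, hN⟩ := ENNReal.exists_nat_gt (ENNReal.add_lt_top.2 ⟨ENNReal.one_lt_top, hg.2⟩).ne
  obtain ⟨n, hn1, hn2⟩ := (hev.and (eventually_ge_atTop N)).exists
  have hT := (h.1 _ (hF _ (hiS (φ n)))).2
  have hsub := (hT.sub hg).1
  have hle : bergmanNorm 1 β (toeplitz μ β (F (i (φ n)))) ≤
      bergmanNorm 1 β (fun z => toeplitz μ β (F (i (φ n))) z - g z) + bergmanNorm 1 β g := by
    refine le_trans (le_of_eq (congrArg _ ?_)) (eLpNorm_add_le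
      (aemeasurable_of_differentiableOn hsub.1 (measure_weightedArea_compl β))
      (aemeasurable_of_differentiableOn hg.1 (measure_weightedArea_compl β)) (by simp))
    funext z
    simp
  have h1 := (hi (φ n)).trans_le (hle.trans (add_le_add hn1 le_rfl))
  have h2 : (N : ENNReal) ≤ ((φ n : ℕ) : NNReal) := by
    rw [ENNReal.coe_natCast]
    exact_mod_cast hn2.trans (hφ.id_le n)
  exact absurd (h1.trans hN) (not_lt.2 h2)

/-- Norm convergence from pointwise convergence of the images. -/
lemma ToeplitzCompactUsual.tendsto_of_pointwise (hβ : -1 < β)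
    (h : ToeplitzCompactUsual μ p α 1 β) {f : ℕ → ℂ → ℂ} (hf : IsBoundedSeq p α f)
    (h0 : ∀ z ∈ disk, Tendsto (fun n => toeplitz μ β (f n) z) atTop (𝓝 0)) :
    Tendsto (fun n => bergmanNorm 1 β (toeplitz μ β (f n))) atTop (𝓝 0) := by
  refine tendsto_of_subseq_tendsto fun ns hns => ?_
  obtain ⟨C, hC⟩ := exists_enorm_mul_le_bergmanNorm one_pos le_rfl hβ
  obtain ⟨φ, hφ, g, hg, hlim⟩ := h.2 (fun n => f (ns n))
    ⟨fun n => hf.1 _, hf.2.imp fun C hC n => hC _⟩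
  refine ⟨φ, hlim.congr fun n => bergmanNorm_congr fun z hz => ?_⟩
  have hz0 : 0 < (1 - ‖z‖) ^ ((2 + β) / 1) :=
    Real.rpow_pos_of_pos (by linarith [mem_disk.1 hz]) _
  -- Norm convergence implies pointwise convergence by the growth estimate, so the limit `g` agrees
  -- with the pointwise limit `0`.
  have h1 : Tendsto (fun n => ‖toeplitz μ β (f (ns (φ n))) z - g z‖ₑ *
      ENNReal.ofReal ((1 - ‖z‖) ^ ((2 + β) / 1))) atTop (𝓝 0) := by
    have h2 := ENNReal.Tendsto.const_mul (a := (C : ENNReal)) hlim (Or.inr ENNReal.coe_ne_top)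
    rw [mul_zero] at h2
    exact tendsto_of_tendsto_of_tendsto_of_le_of_le tendsto_const_nhds h2 (fun _ => zero_le)
      fun n => hC _ ((h.1 _ (hf.1 _)).2.1.sub hg.1) z hz
  have h3 : Tendsto (fun n => ‖toeplitz μ β (f (ns (φ n))) z - g z‖ₑ *
      ENNReal.ofReal ((1 - ‖z‖) ^ ((2 + β) / 1))) atTop
      (𝓝 (‖0 - g z‖ₑ * ENNReal.ofReal ((1 - ‖z‖) ^ ((2 + β) / 1)))) :=
    ENNReal.Tendsto.mul_const
      ((((h0 z hz).comp (hns.comp hφ.tendsto_atTop)).sub_const (g z)).enorm)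
      (Or.inr ENNReal.ofReal_ne_top)
  have h4 := tendsto_nhds_unique h3 h1
  have h5 : g z = 0 := by
    rcases mul_eq_zero.1 h4 with h6 | h6
    · simpa using h6
    · exact absurd (ENNReal.ofReal_eq_zero.1 h6) (not_le.2 hz0)
  rw [h5, sub_zero]

lemma ToeplitzCompactUsual.boundedBox [IsFiniteMeasure μ] (hp : 0 < p) (hα : -1 < α)
    (hβ : -1 < β) (hμ : μ diskᶜ = 0) (h : ToeplitzCompactUsual μ p α 1 β) :
    BoundedBox μ ((2 + α) / p) := by
  obtain ⟨k, c, C, hc, hC⟩ := h.1.exists_measure_nearSet_le hp hα hβ hμ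
  obtain ⟨D, hD⟩ := exists_bergmanNorm_testFunction_le hp hα hc k
  obtain ⟨B, hB⟩ := h.exists_bergmanNorm_le (S := disk)
    (fun a ha => testFunction_memBergman hp hα hc k ha) hD
  refine boundedBox_of_eventually (div_nonneg (by linarith) hp.le) (C * B).coe_nonneg ?_
  filter_upwards [hC, eventually_mem_disk] with a ha had
  refine (measure_nearSet_le_iff (C * B).coe_nonneg had).1 (ha.trans ?_)
  rw [ENNReal.ofReal_coe_nnreal, ENNReal.coe_mul]
  exact mul_le_mul_right (hB a had) _

/-- Pointwise approximation of kernel images by multiples of the kernel. -/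
lemma tendsto_kernelImage_sub [IsFiniteMeasure μ] {s : ℝ} (hμ : μ diskᶜ = 0) (hβ : -1 < β)
    (hs : 1 < s) (hbox : BoundedBox μ s) {u : ℂ} (hu : u ∈ disk) :
    Tendsto (fun a => (1 - ‖a‖) *
      ‖kernelImage μ β s a u - kernelMean μ s a * kernel (2 + β) u a‖) toCircle (𝓝 0) := by
  obtain ⟨A, hA, h⟩ := hbox
  obtain ⟨C, hC, hK⟩ := exists_carlesonIntegral_le (s := s) (δ := 0) (t := s + 1 / 2)
    (by linarith) (by linarith)
  have hb : 0 < 2 + β := by linarith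
  have hu0 : 0 < 1 - ‖u‖ := by linarith [mem_disk.1 hu]
  -- With `u` fixed, the Hölder constant of order 1/2 of the kernel is uniform in `w` and `a`. The
  -- gained half power makes the error vanish under the mere bounded box condition.
  set D : ℝ := (4 + (2 + β) * 2 ^ (2 + β + 1)) *
    ((1 - ‖u‖) ^ (-(2 + β + 1 / 2)) + (1 - ‖u‖) ^ (-(2 + β + 1 / 2))) with hD
  have hD0 : 0 ≤ D := by positivity
  have hk : ∀ w ∈ disk, ∀ a ∈ disk, ‖kernel (2 + β) u w - kernel (2 + β) u a‖ ≤
      D * ‖1 - w * conj a‖ ^ (1 / 2 : ℝ) := fun w hw a ha => by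
    have hle : ∀ v ∈ disk, ‖1 - u * conj v‖ ^ (-(2 + β + 1 / 2)) ≤
        (1 - ‖u‖) ^ (-(2 + β + 1 / 2)) := fun v hv =>
      Real.rpow_le_rpow_of_nonpos hu0
        (one_sub_norm_le_norm_one_sub_mul_conj (mem_disk.1 hv).le) (by linarith)
    calc _ ≤ _ := norm_kernel_sub_le (δ := 1 / 2) hb (by norm_num) (by norm_num) hu hw ha
      _ ≤ (4 + (2 + β) * 2 ^ (2 + β + 1)) * (‖1 - w * conj a‖ ^ (1 / 2 : ℝ) *
          ((1 - ‖u‖) ^ (-(2 + β + 1 / 2)) + (1 - ‖u‖) ^ (-(2 + β + 1 / 2)))) := by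
          gcongr ?_ * (?_ * (?_ + ?_))
          · exact hle w hw
          · exact hle a ha
      _ = _ := by rw [hD]; ring
  have h0 : Tendsto (fun a : ℂ => D * (C * A) * (1 - ‖a‖) ^ (1 / 2 : ℝ)) toCircle (𝓝 0) := by
    simpa using (tendsto_one_sub_norm_rpow (κ := 1 / 2) (by norm_num)).const_mul (D * (C * A))
  refine tendsto_of_tendsto_of_tendsto_of_le_of_le' tendsto_const_nhds h0
    (eventually_mem_disk.mono fun a ha => ?_) (eventually_mem_disk.mono fun a ha => ?_)
  · have : 0 < 1 - ‖a‖ := by linarith [mem_disk.1 ha]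
    positivity
  have ha0 : 0 < 1 - ‖a‖ := by linarith [mem_disk.1 ha]
  have h1 : ‖∫ w, kernel (s + 1) w a * (kernel (2 + β) u w - kernel (2 + β) u a) ∂μ‖ₑ ≤
      ENNReal.ofReal (D * (C * A * (1 - ‖a‖) ^ (-(1 / 2) : ℝ))) := by
    calc _ ≤ ∫⁻ w, ‖kernel (s + 1) w a * (kernel (2 + β) u w - kernel (2 + β) u a)‖ₑ ∂μ :=
          enorm_integral_le_lintegral_enorm _
      _ ≤ ∫⁻ w, ENNReal.ofReal D * ENNReal.ofReal
          ((1 - ‖w‖) ^ (-(0 : ℝ)) * ‖1 - w * conj a‖ ^ (-(s + 1 / 2))) ∂μ := by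
          refine lintegral_mono_ae ((ae_mem_disk hμ).mono fun w hw => ?_)
          have hpos := norm_one_sub_mul_conj_pos (mem_disk.1 hw) (mem_disk.1 ha).le
          rw [← ENNReal.ofReal_mul hD0, ← ofReal_norm, norm_mul, norm_kernel, neg_zero,
            Real.rpow_zero, one_mul]
          refine ENNReal.ofReal_le_ofReal ?_
          calc _ ≤ ‖1 - w * conj a‖ ^ (-(s + 1)) * (D * ‖1 - w * conj a‖ ^ (1 / 2 : ℝ)) := by
                gcongr
                exact hk w hw a ha
            _ = _ := by
                rw [show -(s + 1 / 2) = -(s + 1) + 1 / 2 by ring, Real.rpow_add hpos]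
                ring
      _ = ENNReal.ofReal D * carlesonIntegral μ 0 (s + 1 / 2) a :=
          lintegral_const_mul' _ _ ENNReal.ofReal_ne_top
      _ ≤ ENNReal.ofReal D * ENNReal.ofReal (C * A * (1 - ‖a‖) ^ (s - 0 - (s + 1 / 2))) :=
          mul_le_mul_right (hK μ hμ A hA h a ha) _
      _ = _ := by
          rw [← ENNReal.ofReal_mul hD0, show s - 0 - (s + 1 / 2) = -(1 / 2) by ring]
  rw [← ofReal_norm, ENNReal.ofReal_le_ofReal_iff (by positivity)] at h1
  rw [kernelImage_sub_eq hμ hβ hs ha hu]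
  calc _ ≤ (1 - ‖a‖) * (D * (C * A * (1 - ‖a‖) ^ (-(1 / 2) : ℝ))) := by gcongr
    _ = D * (C * A) * ((1 - ‖a‖) ^ (1 : ℝ) * (1 - ‖a‖) ^ (-(1 / 2) : ℝ)) := by
        rw [Real.rpow_one]; ring
    _ = _ := by rw [← Real.rpow_add ha0]; norm_num

lemma tendsto_log_toCircle :
    Tendsto (fun a : ℂ => Real.log (2 / (1 - ‖a‖ ^ 2))) toCircle atTop := by
  have h1 : Tendsto (fun a : ℂ => 1 - ‖a‖ ^ 2) toCircle (𝓝[>] 0) := by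
    refine tendsto_nhdsWithin_iff.2 ⟨?_, eventually_mem_disk.mono fun a ha => ?_⟩
    · have := (tendsto_norm_toCircle.pow 2).const_sub 1
      simpa using this
    · have := mem_disk.1 ha
      change 0 < 1 - ‖a‖ ^ 2
      nlinarith [norm_nonneg a]
  have h2 := (tendsto_inv_nhdsGT_zero.comp h1).const_mul_atTop (two_pos (α := ℝ))
  exact Real.tendsto_log_atTop.comp h2

/-- If the norms of kernel images are bounded then the kernel means are small. -/
lemma tendsto_kernelMean [IsFiniteMeasure μ] {s : ℝ} (hμ : μ diskᶜ = 0) (hβ : -1 < β)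
    (hs : 1 < s) (hbox : BoundedBox μ s) {B : NNReal} (hB : ∀ a ∈ disk,
      ENNReal.ofReal (1 - ‖a‖) * kernelImageNorm μ β s a ≤ B) :
    Tendsto (fun a => (1 - ‖a‖) * ‖kernelMean μ s a‖) toCircle (𝓝 0) := by
  obtain ⟨E, hE⟩ := exists_kernelImageError_le hμ hβ hs hbox
  obtain ⟨c, hc, hL⟩ := exists_le_lintegral_kernel_log hβ
  have hbd : ∀ a : ℂ, 7 / 8 ≤ ‖a‖ → ‖a‖ < 1 →
      (1 - ‖a‖) * ‖kernelMean μ s a‖ * Real.log (2 / (1 - ‖a‖ ^ 2)) ≤ c * (E + B) := by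
    intro a ha ha1
    have had := mem_disk.2 ha1
    have ha0 : 0 < 1 - ‖a‖ := by linarith
    refine (ENNReal.ofReal_le_ofReal_iff (by positivity)).1 ?_
    rw [ENNReal.ofReal_mul (by positivity), ENNReal.ofReal_mul ha0.le, ofReal_norm,
      ENNReal.ofReal_mul hc.le, ENNReal.ofReal_add E.coe_nonneg B.coe_nonneg,
      ENNReal.ofReal_coe_nnreal, ENNReal.ofReal_coe_nnreal]
    calc _ ≤ ENNReal.ofReal (1 - ‖a‖) * ‖kernelMean μ s a‖ₑ *
          (ENNReal.ofReal c * ∫⁻ u, ‖kernel (2 + β) u a‖ₑ ∂weightedArea β) :=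
          mul_le_mul_right (hL a ha ha1) _
      _ = ENNReal.ofReal c * (ENNReal.ofReal (1 - ‖a‖) *
          (‖kernelMean μ s a‖ₑ * ∫⁻ u, ‖kernel (2 + β) u a‖ₑ ∂weightedArea β)) := by ring
      _ ≤ ENNReal.ofReal c * (ENNReal.ofReal (1 - ‖a‖) *
          (kernelImageError μ β s a + kernelImageNorm μ β s a)) :=
          mul_le_mul_right (mul_le_mul_right (enorm_kernelMean_mul_le a) _) _
      _ ≤ _ := by
          rw [mul_add (ENNReal.ofReal (1 - ‖a‖))]
          exact mul_le_mul_right (add_le_add (hE a had) (hB a had)) _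
  -- Boundedness with the logarithmic factor gives convergence to `0` without it.
  have h0 : Tendsto (fun a : ℂ => c * (E + B) / Real.log (2 / (1 - ‖a‖ ^ 2))) toCircle (𝓝 0) :=
    tendsto_log_toCircle.const_div_atTop _
  refine tendsto_of_tendsto_of_tendsto_of_le_of_le' tendsto_const_nhds h0
    (eventually_mem_disk.mono fun a ha => ?_) ?_
  · have : 0 < 1 - ‖a‖ := by linarith [mem_disk.1 ha]
    positivity
  · filter_upwards [tendsto_log_toCircle.eventually_gt_atTop 0,
      eventually_toCircle.2 ⟨7 / 8, by norm_num, fun a ha ha1 => hbd a ha.le ha1⟩] with a ha1 ha2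
    exact (le_div_iff₀ ha1).2 ha2

/-- For an arbitrary null sequence the bounded box condition does not visibly make the images tend
to `0` pointwise, as mass may escape to the circle. For normalized kernels it does so by the
approximation through kernel means, and kernels are all that the compactness criterion tests. -/
lemma ToeplitzCompactUsual.compact (hp : 0 < p) (hp1 : p ≤ 1) (hα : -1 < α) (hβ : -1 < β)
    (hμ : μ diskᶜ = 0) (h : ToeplitzCompactUsual μ p α 1 β) : ToeplitzCompact μ p α 1 β := by
  have := h.1.isFiniteMeasure hp hα
  have hs : 1 < (2 + α) / p := by rw [lt_div_iff₀ hp]; linarith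
  have hbox := h.boundedBox hp hα hβ hμ
  obtain ⟨D, hD⟩ := exists_bergmanNorm_testFunction_le hp hα one_pos 0
  obtain ⟨B, hB⟩ := h.exists_bergmanNorm_le (S := disk)
    (fun a ha => testFunction_memBergman hp hα one_pos 0 ha) hD
  have hN : ∀ a ∈ disk, ENNReal.ofReal (1 - ‖a‖) * kernelImageNorm μ β ((2 + α) / p) a ≤ B :=
    fun a ha => (bergmanNorm_toeplitz_testFunction _ ha).symm.trans_le (hB a ha)
  have hF := tendsto_kernelMean hμ hβ hs hbox hN
  have hpt : ∀ u ∈ disk, Tendsto (fun a => toeplitz μ β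
      (testFunction 0 1 ((2 + α) / p + 1) a) u) toCircle (𝓝 0) := fun u hu => by
    have hu0 : 0 < 1 - ‖u‖ := by linarith [mem_disk.1 hu]
    have h1 := (tendsto_kernelImage_sub hμ hβ hs hbox hu).add
      (hF.mul_const ((1 - ‖u‖) ^ (-(2 + β))))
    rw [zero_mul, add_zero] at h1
    refine squeeze_zero_norm' (eventually_mem_disk.mono fun a ha => ?_) h1
    have ha0 : 0 < 1 - ‖a‖ := by linarith [mem_disk.1 ha]
    rw [toeplitz_testFunction, norm_mul, Complex.norm_real, Real.norm_of_nonneg ha0.le, mul_assoc,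
      ← mul_add]
    refine mul_le_mul_of_nonneg_left ?_ ha0.le
    have h2 := norm_add_le
      (kernelImage μ β ((2 + α) / p) a u - kernelMean μ ((2 + α) / p) a * kernel (2 + β) u a)
      (kernelMean μ ((2 + α) / p) a * kernel (2 + β) u a)
    rw [sub_add_cancel, norm_mul] at h2
    refine h2.trans (add_le_add le_rfl (mul_le_mul_of_nonneg_left ?_ (norm_nonneg _)))
    exact norm_kernel_le _ (by linarith) (mem_disk.1 hu) (mem_disk.1 ha).le
  refine toeplitzCompact_of_tendsto_kernelImageNorm hp hp1 hα hβ hμ hbox hN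
    (tendsto_toCircle_of_seq fun a hd ha => ?_)
  refine (h.tendsto_of_pointwise hβ (testFunction_isBoundedSeq hp hα one_pos 0 hd)
    fun z hz => (hpt z hz).comp ha).congr fun n => bergmanNorm_toeplitz_testFunction _ (hd n)

end ToeplitzBergman

theorem theorem1p2 (μ : MeasureTheory.Measure ℂ) (hμ : μ ToeplitzBergman.diskᶜ = 0)
    (p α β : ℝ) (hp : 0 < p) (hp1 : p ≤ 1) (hα : -1 < α) (hβ : -1 < β) :
    (ToeplitzBergman.ToeplitzCompact μ p α 1 β ↔
      ToeplitzBergman.IsVanishingCarleson μ (1 / p) 1 α ∧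
        ToeplitzBergman.MemLittleLogBloch 1
          (ToeplitzBergman.toeplitz μ ((2 + α) / p - 2) (fun _ => 1))) ∧
    (p = 1 →
      (ToeplitzBergman.ToeplitzCompactUsual μ p α 1 β ↔
        ToeplitzBergman.IsVanishingCarleson μ (1 / p) 1 α ∧
          ToeplitzBergman.MemLittleLogBloch 1
            (ToeplitzBergman.toeplitz μ ((2 + α) / p - 2) (fun _ => 1)))) := by
  refine ⟨ToeplitzBergman.toeplitzCompact_iff hμ hp hp1 hα hβ, fun h => ?_⟩
  rw [← ToeplitzBergman.toeplitzCompact_iff hμ hp hp1 hα hβ]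
  subst h
  exact ⟨fun h => h.compact hp hp1 hα hβ hμ, fun h => h.usual hα⟩
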